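/- Let $0<b_1\le 1$ and $\varepsilon>0$. For every sufficiently large constant $C$ (depending only on $b_1,\varepsilon$) the following holds, with constants in $O(\cdot)$ that depend only on $b_1,\varepsilon,C$. Let $n\ge 2$, $p_1,\dots,p_d\in[0,\tfrac12)$ with $\sum_{i=1}^d p_i\ge C\log n$, and let $\mathcal D$ be the distribution on $\{0,1\}^d$ under which the bits are independent and bit $i$ is $1$ with probability $p_i$. Let $S=(x_1,\dots,x_n)$ consist of $n$ independent samples from $\mathcal D$. Write $|x|$ for the number of ones of $x$, identify vectors with subsets of $\{1,\dots,d\}$, and let $B(q,x)=|q\cap x|/\max(|q|,|x|)$ be the Braun-Blanquet similarity. Consider the following randomized data structure on a unit-cost RAM with the real numbers $b_1,C,p_i$ available. In each of $2\lceil\log_2 n\rceil$ independent repetitions, every vector $x$ with $|x|\ge b_1C\log n$ is assigned a set $F(x)$ of paths, that is, sequences of distinct elements of $x$. Starting with the empty path, a path $v$ is extended by an element $i\in x\setminus v$ if a pairwise independent random hash value of $(v,i)$ in $[0,1)$, shared by all vectors, is less than $1/(b_1|x|-|v|)$ (always, if $b_1|x|\le |v|$); a path is not extended any more, and is put into $F(x)$,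 as soon as $\prod_{i\in v}p_i\le 1/n$. A trie stores, for each path $v$, the list of all $x\in S$ with $v\in F(x)$. A search for $q$ computes $F(q)$, compares $q$ with the vectors stored under the paths in $F(q)$, and returns the first one found with similarity at least $b_1$. (1) If $\rho_u$ satisfies $\sum_{i=1}^d p_i^{1+\rho_u}=b_1\sum_{i=1}^d p_i$, then the data structure uses expected space $O(n^{1+\rho_u+\varepsilon}+dn)$ and is built in expected time $O(dn^{1+\rho_u+\varepsilon})$; expectations are over $S$ and the random choices of the data structure. (2) Suppose that an adversary who knows $S$, but not the random choices of the data structure, chooses a query $q$ with $|q|\ge C\log n$ and $B(q,x)\ge b_1$ for some $x\in S$. Let $\rho(q)\ge 0$ satisfy $\sum_{i\in q}p_i^{\rho(q)}=b_1|q|$. Then the search takes expected time $O(dn^{\rho(q)+\varepsilon})$, in the sense that the expectation, over $S$ and the random choices of the data structure, of the number of steps divided by $dn^{\rho(q)+\varepsilon}$ is $O(1)$ (data sets for which the adversary chooses no such $q$ and $\rho(q)$ contribute $0$). The same holds if $\rho(q)\ge0$ satisfies $\sum_{i\in q}p_i^{\rho(q)}=b_1\sum_{i\in q}p_i$ instead.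 (3) For every $S$ and every query $q$ with $|q|\ge C\log n$ and $B(q,x)\ge b_1$ for some $x\in S$, the search returns a vector $x\in S$ with $B(q,x)\ge b_1$ with probability at least $\tfrac12$ over the random choices of the data structure. -/

import Mathlib

namespace SkewSearch

/-! ## Step counting -/

/-- A value together with the number of elementary steps spent on computing it. -/
structure Timed (α : Type) where
  val : α
  steps : ℕ

instance : Monad Timed where
  pure a := ⟨a, 0⟩
  bind m f := ⟨(f m.val).val, m.steps + (f m.val).steps⟩

/-- Spend `k` elementary steps. -/
def tick (k : ℕ) : Timed Unit := ⟨(), k⟩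

/-- Run `f` on every entry of a list and concatenate the outputs. -/
def collect {α β : Type} (f : α → Timed (List β)) : List α → Timed (List β)
  | [] => pure []
  | a :: l => do
    tick 1
    let r ← f a
    let rs ← collect f l
    tick r.length
    pure (r ++ rs)

/-! ## Vectors, similarity, and the data distribution -/

/-- Boolean vectors of dimension `d`, stored as bit arrays. -/
abbrev Vec (d : ℕ) : Type := Fin d → Bool

/-- The Hamming weight `|x|`. -/
def size {d : ℕ} (x : Vec d) : ℕ := (Finset.univ.filter fun i => x i = true).card

/-- The coordinatewise conjunction, i.e. the intersection of the corresponding sets. -/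
def inter {d : ℕ} (x y : Vec d) : Vec d := fun i => x i && y i

/-- Braun-Blanquet similarity `|x ∩ y| / max(|x|, |y|)` (equal to `0` if both vectors are zero). -/
noncomputable def braunBlanquet {d : ℕ} (x y : Vec d) : ℝ :=
  (size (inter x y) : ℝ) / (max (size x) (size y) : ℕ)

/-- Expectation of `f S` when the vectors `S 0, …, S (n - 1)` are independent and every `S j` has
independent bits, bit `i` being `1` with probability `p i`. -/
noncomputable def dataExp {n d : ℕ} (p : Fin d → ℝ) (f : (Fin n → Vec d) → ℝ) : ℝ :=
  ∑ S : Fin n → Vec d, (∏ j, ∏ i, if S j i then p i else 1 - p i) * f S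

/-- Expectation of `f ω` for uniformly random `ω`. -/
noncomputable def coinExp {Ω : Type} [Fintype Ω] (f : Ω → ℝ) : ℝ :=
  (∑ ω, f ω) / Fintype.card Ω

open Classical in
/-- Probability of the event `E` for uniformly random `ω`. -/
noncomputable def coinProb {Ω : Type} [Fintype Ω] (E : Ω → Prop) : ℝ :=
  coinExp fun ω => if E ω then 1 else 0

/-! ## Hash functions on paths -/

/-- A path is a sequence of coordinates. -/
abbrev Path (d : ℕ) : Type := List (Fin d)

/-- The maximal length of a path, `⌈log₂ n⌉`. -/
def depth (n : ℕ) : ℕ := Nat.clog 2 n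

/-- The number of independent repetitions. -/
def reps (n : ℕ) : ℕ := 2 * depth n

/-- The least prime that is at least `n * d`. -/
def hashPrime (n d : ℕ) : ℕ := Nat.find (Nat.exists_infinite_primes (n * d))

/-- The coefficients of one repetition: row `l` defines the hash function for paths with
`l + 1` entries. -/
abbrev Coeffs (n d : ℕ) : Type := Fin (depth n) → Fin (depth n + 1) → Fin (hashPrime n d)

/-- The random coefficients of all repetitions. -/
abbrev Coins (n d : ℕ) : Type := Fin (reps n) → Coeffs n d

/-- Read the coefficient in row `l`, column `t`. -/
def coef {n d : ℕ} (c : Coeffs n d) (l t : ℕ) : ℕ :=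
  if h : l < depth n ∧ t < depth n + 1 then (c ⟨l, h.1⟩ ⟨t, h.2⟩ : ℕ) else 0

/-- `row t * u₀ + row (t + 1) * u₁ + …` modulo `P`. -/
def hashLoop {d : ℕ} (P : ℕ) (row : ℕ → ℕ) : ℕ → Path d → Timed ℕ
  | _, [] => pure 0
  | t, i :: u => do
    tick 1
    let r ← hashLoop P row (t + 1) u
    pure ((row t * (i : ℕ) + r) % P)

/-- The pairwise independent hash function `u ↦ a₀ + a₁ u₀ + a₂ u₁ + … mod P`, whose coefficients
depend on the length of the path; the value divided by `P` plays the role of a number that is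
uniform in `[0, 1)`. -/
def hash {n d : ℕ} (c : Coeffs n d) (u : Path d) : Timed ℕ := do
  tick 1
  let r ← hashLoop (hashPrime n d) (coef c (u.length - 1)) 1 u
  pure ((coef c (u.length - 1) 0 + r) % hashPrime n d)

/-! ## The paths of a vector -/

/-- Count the ones of `x` among the listed coordinates. -/
def countLoop {d : ℕ} (x : Vec d) : List (Fin d) → Timed ℕ
  | [] => pure 0
  | i :: is => do
    tick 1
    let r ← countLoop x is
    pure (if x i then r + 1 else r)

/-- Compute `|x|`. -/
def countOnes {d : ℕ} (x : Vec d) : Timed ℕ := countLoop x (List.finRange d)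

/-- The chosen one-step extensions of the path `v` by listed coordinates of `x` that are not yet
on `v`: with `|x| = m`, the extension `v ++ [i]` is chosen if its hash value, scaled to `[0, 1)`, is
below `1 / (b₁ m - |v|)`. -/
noncomputable def extensions {n d : ℕ} (b₁ : ℝ) (c : Coeffs n d) (x : Vec d) (m : ℕ) (v : Path d) :
    List (Fin d) → Timed (List (Path d))
  | [] => pure []
  | i :: is => do
    tick 1
    let rest ← extensions b₁ c x m v is
    if x i then
      tick (v.length + 1)
      if i ∈ v then
        pure rest
      else
        tick (v.length + 1)
        let h ← hash c (v ++ [i])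
        tick 1
        if (h : ℝ) * (b₁ * m - v.length) < hashPrime n d then
          pure ((v ++ [i]) :: rest)
        else
          pure rest
    else
      pure rest

/-- Split a list of paths into the finished ones, i.e. those with `∏ p_i ≤ 1 / n` (product over the
entries), and the unfinished ones. -/
noncomputable def split {d : ℕ} (n : ℕ) (p : Fin d → ℝ) :
    List (Path d) → Timed (List (Path d) × List (Path d))
  | [] => pure ([], [])
  | v :: vs => do
    tick (v.length + 1)
    let r ← split n p vs
    if (v.map p).prod ≤ 1 / n then
      pure (v :: r.1, r.2)
    else
      pure (r.1, v :: r.2)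

/-- Extend the unfinished paths level by level, for at most `k` levels, and return all finished
paths. -/
noncomputable def grow {n d : ℕ} (p : Fin d → ℝ) (b₁ : ℝ) (c : Coeffs n d) (x : Vec d) (m : ℕ) :
    ℕ → List (Path d) → Timed (List (Path d))
  | 0, _ => pure []
  | k + 1, frontier => do
    tick 1
    let next ← collect (fun v => extensions b₁ c x m v (List.finRange d)) frontier
    let r ← split n p next
    let rest ← grow p b₁ c x m k r.2
    tick r.1.length
    pure (r.1 ++ rest)

/-- The set `F(x)` of finished paths chosen by `x`. Vectors of weight below `b₁ C log n`, which are
not `b₁`-similar to any vector of weight at least `C log n`, choose no path. -/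
noncomputable def filters {n d : ℕ} (p : Fin d → ℝ) (b₁ C : ℝ) (c : Coeffs n d) (x : Vec d) :
    Timed (List (Path d)) := do
  let m ← countOnes x
  tick 1
  if (m : ℝ) < b₁ * (C * Real.log n) then
    pure []
  else
    grow p b₁ c x m (depth n) [[]]

/-! ## The inverted index -/

/-- A trie with linked sibling lists. A node holds the last entry of its path, the list of the
indices of the data vectors stored for this path, the first child, and the next sibling. -/
inductive Trie (n d : ℕ) : Type where
  | nil : Trie n d
  | node (key : Fin d) (ids : List (Fin n)) (child sibling : Trie n d) : Trie n d

/-- The number of memory words of a trie: four per node, two per cell of a linked list. -/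
def Trie.words {n d : ℕ} : Trie n d → ℕ
  | .nil => 0
  | .node _ ids child sibling => 4 + 2 * ids.length + child.words + sibling.words

/-- A trie that holds just the entry `j` under the given path. -/
def Trie.single {n d : ℕ} (j : Fin n) : Path d → Timed (Trie n d)
  | [] => pure .nil
  | [a] => do
    tick 1
    pure (.node a [j] .nil .nil)
  | a :: u => do
    tick 1
    let t ← Trie.single j u
    pure (.node a [] t .nil)

/-- Insert the entry `j` under a nonempty path. -/
def Trie.insert {n d : ℕ} (j : Fin n) : Trie n d → Path d → Timed (Trie n d)
  | t, [] => pure t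
  | .nil, a :: u => Trie.single j (a :: u)
  | .node k ids child sibling, a :: u => do
    tick 1
    if k = a then
      match u with
      | [] => pure (.node k (j :: ids) child sibling)
      | b :: w => do
        let t ← Trie.insert j child (b :: w)
        pure (.node k ids t sibling)
    else
      let t ← Trie.insert j sibling (a :: u)
      pure (.node k ids child t)

/-- The entries stored under a path. -/
def Trie.lookup {n d : ℕ} : Trie n d → Path d → Timed (List (Fin n))
  | _, [] => pure []
  | .nil, _ :: _ => do
    tick 1
    pure []
  | .node k ids child sibling, a :: u => do
    tick 1
    if k = a then
      match u with
      | [] => pure ids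
      | b :: w => child.lookup (b :: w)
    else
      sibling.lookup (a :: u)

/-- Insert the entry `j` under all listed paths. -/
def insertAll {n d : ℕ} (j : Fin n) : List (Path d) → Trie n d → Timed (Trie n d)
  | [], t => pure t
  | v :: vs, t => do
    tick 1
    let t' ← t.insert j v
    insertAll j vs t'

/-! ## Building and searching -/

/-- Insert the paths of the listed data vectors into a trie. -/
noncomputable def buildTrie {n d : ℕ} (p : Fin d → ℝ) (b₁ C : ℝ) (S : Fin n → Vec d)
    (c : Coeffs n d) : List (Fin n) → Trie n d → Timed (Trie n d)
  | [], t => pure t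
  | j :: js, t => do
    tick 1
    let vs ← filters p b₁ C c (S j)
    let t' ← insertAll j vs t
    buildTrie p b₁ C S c js t'

/-- The data structure: the data vectors, and for every repetition its hash coefficients and its
trie. -/
structure Index (n d : ℕ) where
  data : Fin n → Vec d
  tables : List (Coeffs n d × Trie n d)

/-- The number of memory words of the data structure: data vectors, the probabilities `p`, and the
hash coefficients and the trie of every repetition. -/
def Index.words {n d : ℕ} (D : Index n d) : ℕ :=
  n * d + d + (D.tables.map fun T => depth n * (depth n + 1) + T.2.words).sum

/-- Build the tables for the listed repetitions. Drawing a coefficient takes one step. -/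
noncomputable def buildTables {n d : ℕ} (p : Fin d → ℝ) (b₁ C : ℝ) (ω : Coins n d)
    (S : Fin n → Vec d) : List (Fin (reps n)) → Timed (List (Coeffs n d × Trie n d))
  | [] => pure []
  | r :: rs => do
    tick (depth n * (depth n + 1))
    let t ← buildTrie p b₁ C S (ω r) (List.finRange n) .nil
    let ts ← buildTables p b₁ C ω S rs
    pure ((ω r, t) :: ts)

/-- Build the data structure for `S` with the random coefficients `ω`; storing the data takes
`n * d` steps. -/
noncomputable def build {n d : ℕ} (p : Fin d → ℝ) (b₁ C : ℝ) (ω : Coins n d)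
    (S : Fin n → Vec d) : Timed (Index n d) := do
  tick (n * d)
  let ts ← buildTables p b₁ C ω S (List.finRange (reps n))
  pure ⟨S, ts⟩

/-- Compute the Braun-Blanquet similarity. -/
noncomputable def similarity {d : ℕ} (x y : Vec d) : Timed ℝ := do
  let a ← countOnes x
  let b ← countOnes y
  let k ← countOnes (inter x y)
  tick 1
  pure ((k : ℝ) / (max a b : ℕ))

/-- The first listed data vector with similarity at least `b₁` to `q`. -/
noncomputable def firstSimilar {n d : ℕ} (b₁ : ℝ) (S : Fin n → Vec d) (q : Vec d) :
    List (Fin n) → Timed (Option (Fin n))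
  | [] => pure none
  | j :: js => do
    let s ← similarity q (S j)
    tick 1
    if b₁ ≤ s then
      pure (some j)
    else
      firstSimilar b₁ S q js

/-- Examine the data vectors stored under the listed paths until one has similarity at least `b₁`
to `q`. -/
noncomputable def searchPaths {n d : ℕ} (b₁ : ℝ) (S : Fin n → Vec d) (q : Vec d) (T : Trie n d) :
    List (Path d) → Timed (Option (Fin n))
  | [] => pure none
  | v :: vs => do
    tick 1
    let ids ← T.lookup v
    let r ← firstSimilar b₁ S q ids
    match r with
    | some j => pure (some j)
    | none => searchPaths b₁ S q T vs

/-- Search the tables one after the other. -/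
noncomputable def searchTables {n d : ℕ} (p : Fin d → ℝ) (b₁ C : ℝ) (S : Fin n → Vec d)
    (q : Vec d) : List (Coeffs n d × Trie n d) → Timed (Option (Fin n))
  | [] => pure none
  | T :: Ts => do
    tick 1
    let vs ← filters p b₁ C T.1 q
    let r ← searchPaths b₁ S q T.2 vs
    match r with
    | some j => pure (some j)
    | none => searchTables p b₁ C S q Ts

/-- Search for a data vector with similarity at least `b₁` to `q`; the result is its index. -/
noncomputable def search {n d : ℕ} (p : Fin d → ℝ) (b₁ C : ℝ) (D : Index n d) (q : Vec d) :
    Timed (Option (Fin n)) :=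
  searchTables p b₁ C D.data q D.tables

/-! ## Queries and their exponents -/

/-- `q` is a query for `S`: it has weight at least `C log n`, and `B(q, x) ≥ b₁` for some
`x ∈ S`. -/
def IsQuery {n d : ℕ} (b₁ C : ℝ) (S : Fin n → Vec d) (q : Vec d) : Prop :=
  C * Real.log n ≤ size q ∧ ∃ j, b₁ ≤ braunBlanquet q (S j)

/-- `ρ` is an exponent for `q`: `∑_{i ∈ q} p_i ^ ρ` equals `b₁ |q|`, or
`b₁ ∑_{i ∈ q} p_i` (which gives a larger exponent). -/
def IsExponent {d : ℕ} (p : Fin d → ℝ) (b₁ : ℝ) (q : Vec d) (ρ : ℝ) : Prop :=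
  0 ≤ ρ ∧
    ((∑ i with q i = true, p i ^ ρ = b₁ * size q) ∨
      (∑ i with q i = true, p i ^ ρ = b₁ * ∑ i with q i = true, p i))

open Classical in
/-- The expected value, over the data and the random coefficients, of the number of steps of a
search divided by `d n ^ (ρ + ε)`, when an adversary who knows the data `S` (but not the random
coefficients) chooses the query `Q S` and `ρ = ρ S` is an exponent for it. Data sets for which the
choice is not a query with an exponent contribute nothing. -/
noncomputable def adversarialRatio {n d : ℕ} (p : Fin d → ℝ) (b₁ C ε : ℝ)
    (Q : (Fin n → Vec d) → Vec d) (ρ : (Fin n → Vec d) → ℝ) : ℝ :=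
  dataExp p fun S =>
    if IsQuery b₁ C S (Q S) ∧ IsExponent p b₁ (Q S) (ρ S) then
      (coinExp fun ω : Coins n d => ((search p b₁ C (build p b₁ C ω S).val (Q S)).steps : ℝ)) /
        (d * (n : ℝ) ^ (ρ S + ε))
    else 0

end SkewSearch

/-!
# Similarity search on skewed data

The paths of a vector `x` form a branching process: a path with `l` entries is extended by each of
its roughly `|x|` fresh coordinates with probability about `1 / (b₁ |x|)`, and it stops once
`∏ p_i ≤ 1 / n`. As all `p_i` are below `1 / 2`, this happens within `⌈log₂ n⌉` levels, and the
hash functions of different levels are independent.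

**Number of paths.** The expected number of unfinished paths with `l` entries is at most
`(b₁ |x|) ^ (-l)`, up to a factor `n ^ O(δ)`, times the number of unfinished sequences in `x`. An
unfinished sequence satisfies `n ^ ρ * ∏ p_i ^ ρ ≥ 1`, so this number is at most
`n ^ ρ * (∑_{i ∈ x} p_i ^ ρ) ^ l`, which the equation for `ρ` cancels against `(b₁ |x|) ^ l`
(`coinExp_length_front_le`). For a random vector, `v ⊆ x` has probability `∏ p_i`, which turns
`p_i ^ ρ` into `p_i ^ (1 + ρ)`, and a Chernoff bound replaces `|x|` by its mean
(`vecExp_frontCount_le`). On average, finished paths are at most `2 / b₁` times as many as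
unfinished ones. These counts, and a trie whose sibling lists have distinct keys, give space and
building time.

**Adversarial queries.** In a search, a path `v` of the query costs at most `cover S v` comparisons,
where `cover S v` counts the data vectors containing `v`. As the query may depend on the data, this
number is bounded simultaneously for all queries: paths with `cover S v ≤ ⌈log₂ n⌉` only cost a
logarithmic factor. Every query similar to a data vector has weight at least a constant times
`∑ p_i`, except with tiny probability, so the other paths contribute at most the query-independent
sum `heavyMoment`. Its expectation is small, since `cover S v` is a sum of `n` independent
indicators with total mean at most `1`, and an exponential moment of it is at most a constant times
`n * ∏ p_i` (`dataExp_cover_le`, `dataExp_heavyMoment_le_const`, `coinExp_sum_cover_le`).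

**Success probability.** For a query `q` and a similar data vector `x`, the paths inside `q ∩ x`
chosen with the threshold of the larger of the two weights belong to both. On average each of them
has at least one extension. Weighting the paths so that this mean becomes exactly one yields a
martingale with mean `1`, whose second moment grows by at most `1` per level because the hash
function is pairwise independent (`coinExp_variance_le`, `coinExp_totalWeight_sq_le`). Hence a
common path exists with probability at least `1 / (⌈log₂ n⌉ + 1)`, and `2 ⌈log₂ n⌉` repetitions
amplify this to more than `1 / 2`.
-/

namespace SkewSearch

/-! ### Step counting -/

section Timed

variable {α β : Type}

@[simp] theorem Timed.val_pure (a : α) : (pure a : Timed α).val = a := rfl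

@[simp] theorem Timed.steps_pure (a : α) : (pure a : Timed α).steps = 0 := rfl

@[simp] theorem Timed.val_bind (m : Timed α) (f : α → Timed β) :
    (m >>= f).val = (f m.val).val := rfl

@[simp] theorem Timed.steps_bind (m : Timed α) (f : α → Timed β) :
    (m >>= f).steps = m.steps + (f m.val).steps := rfl

@[simp] theorem tick_steps (k : ℕ) : (tick k).steps = k := rfl

theorem collect_val (f : α → Timed (List β)) (l : List α) :
    (collect f l).val = l.flatMap fun a => (f a).val := by
  induction l with
  | nil => rfl
  | cons a l ih => simp [collect, ih]

theorem collect_steps (f : α → Timed (List β)) (l : List α) :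
    (collect f l).steps = (l.map fun a => 1 + (f a).steps + (f a).val.length).sum := by
  induction l with
  | nil => rfl
  | cons a l ih => simp [collect, ih]; ring

end Timed

section Paths

variable {n d : ℕ}

theorem hashLoop_steps (P : ℕ) (row : ℕ → ℕ) (t : ℕ) (u : Path d) :
    (hashLoop P row t u).steps = u.length := by
  induction u generalizing t with
  | nil => rfl
  | cons i u ih => simp [hashLoop, ih]; ring

theorem hash_steps (c : Coeffs n d) (u : Path d) : (hash c u).steps = u.length + 1 := by
  simp [hash, hashLoop_steps]; ring

theorem countLoop_steps (x : Vec d) (l : List (Fin d)) : (countLoop x l).steps = l.length := by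
  induction l with
  | nil => rfl
  | cons i l ih => simp [countLoop, ih]; ring

theorem countOnes_steps (x : Vec d) : (countOnes x).steps = d := by
  simp [countOnes, countLoop_steps]

theorem countLoop_val (x : Vec d) (l : List (Fin d)) : (countLoop x l).val = l.countP (x ·) := by
  induction l with
  | nil => rfl
  | cons i l ih => by_cases h : x i <;> simp [countLoop, ih, h]

theorem countOnes_val (x : Vec d) : (countOnes x).val = size x := by
  rw [countOnes, countLoop_val, size, List.countP_eq_length_filter,
    ← List.toFinset_card_of_nodup ((List.nodup_finRange d).filter _)]
  congr 1
  ext i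
  simp

/-! ### The levels of the path process -/

/-- The nonempty path `u` passes the hash test for the threshold parameter `m`, by which it is
chosen as an extension of its prefix with `u.length - 1` entries. The parameter is `|x|` for the
paths of `x`, but is kept separate from `x` so that paths inside an intersection `q ∩ x` can be
studied with the threshold of the larger vector. -/
def Selected (b₁ : ℝ) (c : Coeffs n d) (m : ℕ) (u : Path d) : Prop :=
  ((hash c u).val : ℝ) * (b₁ * m - (u.length - 1 : ℕ)) < hashPrime n d

/-- The product of the probabilities along the path is at most `1 / n`. -/
def Finished (n : ℕ) (p : Fin d → ℝ) (v : Path d) : Prop := (v.map p).prod ≤ 1 / n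

/-- The coordinates of `x` that are not on the path `v`. -/
def freshCoords (x : Vec d) (v : Path d) : List (Fin d) :=
  (List.finRange d).filter fun i => x i = true ∧ i ∉ v

open Classical in
/-- The chosen one-step extensions of `v`. -/
noncomputable def children (b₁ : ℝ) (c : Coeffs n d) (x : Vec d) (m : ℕ) (v : Path d) :
    List (Path d) :=
  ((freshCoords x v).map fun i => v ++ [i]).filter fun u => Selected b₁ c m u

theorem extensions_val (b₁ : ℝ) (c : Coeffs n d) (x : Vec d) (m : ℕ) (v : Path d) :
    (extensions b₁ c x m v (List.finRange d)).val = children b₁ c x m v := by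
  classical
  suffices H : ∀ l : List (Fin d), (extensions b₁ c x m v l).val =
      ((l.filter fun i => x i = true ∧ i ∉ v).map fun i => v ++ [i]).filter
        fun u => Selected b₁ c m u from H _
  intro l
  induction l with
  | nil => rfl
  | cons i l ih =>
    by_cases hx : x i <;> by_cases hv : i ∈ v <;>
      by_cases hs : ((hash c (v ++ [i])).val : ℝ) * (b₁ * m - v.length) < hashPrime n d <;>
      simp [extensions, hx, hv, hs, ih, Selected]

theorem extensions_steps_le (b₁ : ℝ) (c : Coeffs n d) (x : Vec d) (m : ℕ) (v : Path d)
    (l : List (Fin d)) :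
    (extensions b₁ c x m v l).steps ≤ l.length * (3 * v.length + 6) := by
  induction l with
  | nil => simp [extensions]
  | cons i l ih =>
    by_cases hx : x i <;> by_cases hv : i ∈ v <;>
      by_cases hs : ((hash c (v ++ [i])).val : ℝ) * (b₁ * m - v.length) < hashPrime n d <;>
      simp [extensions, hx, hv, hs, hash_steps] <;> nlinarith

open Classical in
theorem split_val (p : Fin d → ℝ) (l : List (Path d)) :
    (split n p l).val = (l.filter fun v => Finished n p v, l.filter fun v => ¬ Finished n p v) := by
  induction l with
  | nil => rfl
  | cons v l ih =>
    by_cases h : (v.map p).prod ≤ 1 / (n : ℝ)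
    · have h' : Finished n p v := h
      simp only [split, Timed.val_bind, if_pos h, ih, Timed.val_pure]
      simp [h']
    · have h' : ¬ Finished n p v := h
      simp only [split, Timed.val_bind, if_neg h, ih, Timed.val_pure]
      simp [h']

theorem split_steps (p : Fin d → ℝ) (l : List (Path d)) :
    (split n p l).steps = (l.map fun v => v.length + 1).sum := by
  induction l with
  | nil => rfl
  | cons v l ih =>
    by_cases h : (v.map p).prod ≤ 1 / (n : ℝ)
    · simp only [split, Timed.steps_bind, if_pos h, ih, Timed.steps_pure]
      simp
    · simp only [split, Timed.steps_bind, if_neg h, ih, Timed.steps_pure]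
      simp

open Classical in
/-- The unfinished paths with `l` entries. -/
noncomputable def front (p : Fin d → ℝ) (b₁ : ℝ) (c : Coeffs n d) (x : Vec d) (m : ℕ) :
    ℕ → List (Path d)
  | 0 => [[]]
  | l + 1 => ((front p b₁ c x m l).flatMap (children b₁ c x m)).filter fun v => ¬ Finished n p v

open Classical in
/-- The finished paths with `l + 1` entries. -/
noncomputable def done (p : Fin d → ℝ) (b₁ : ℝ) (c : Coeffs n d) (x : Vec d) (m l : ℕ) :
    List (Path d) :=
  ((front p b₁ c x m l).flatMap (children b₁ c x m)).filter fun v => Finished n p v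

/-- The finished paths are those of the single levels, one level after the other. -/
theorem grow_val (p : Fin d → ℝ) (b₁ : ℝ) (c : Coeffs n d) (x : Vec d) (m k s : ℕ) :
    (grow p b₁ c x m k (front p b₁ c x m s)).val =
      (List.range' s k).flatMap (done p b₁ c x m) := by
  induction k generalizing s with
  | zero => rfl
  | succ k ih =>
    have h := ih (s + 1)
    simp only [front] at h
    simp only [grow, Timed.val_bind, Timed.val_pure, collect_val, split_val, extensions_val,
      List.range'_succ, List.flatMap_cons, h, done]

theorem mem_children {b₁ : ℝ} {c : Coeffs n d} {x : Vec d} {m : ℕ} {u v : Path d} :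
    u ∈ children b₁ c x m v ↔
      ∃ i, x i = true ∧ i ∉ v ∧ u = v ++ [i] ∧ Selected b₁ c m (v ++ [i]) := by
  simp only [children, freshCoords, List.mem_filter, List.mem_map, List.mem_finRange, true_and,
    decide_eq_true_eq]
  constructor
  · rintro ⟨⟨i, ⟨h1, h2⟩, rfl⟩, h3⟩
    exact ⟨i, h1, h2, rfl, h3⟩
  · rintro ⟨i, h1, h2, rfl, h3⟩
    exact ⟨⟨i, ⟨h1, h2⟩, rfl⟩, h3⟩

/-- `v` is a sequence of `l` distinct elements of `x`. -/
def IsPathIn (x : Vec d) (l : ℕ) (v : Path d) : Prop :=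
  v.length = l ∧ v.Nodup ∧ ∀ i ∈ v, x i = true

theorem IsPathIn.snoc {x : Vec d} {l : ℕ} {v : Path d} (h : IsPathIn x l v) {i : Fin d}
    (hx : x i = true) (hi : i ∉ v) : IsPathIn x (l + 1) (v ++ [i]) := by
  obtain ⟨h1, h2, h3⟩ := h
  refine ⟨by simp [h1], ?_, ?_⟩
  · rw [List.nodup_append]
    refine ⟨h2, List.nodup_singleton _, ?_⟩
    rintro a ha b hb rfl
    simp only [List.mem_singleton] at hb
    exact hi (hb ▸ ha)
  · intro k hk
    rcases List.mem_append.1 hk with hk | hk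
    · exact h3 k hk
    · simp only [List.mem_singleton] at hk
      exact hk ▸ hx

theorem isPathIn_of_mem_front {p : Fin d → ℝ} {b₁ : ℝ} {c : Coeffs n d} {x : Vec d} {m l : ℕ}
    {v : Path d} (h : v ∈ front p b₁ c x m l) : IsPathIn x l v := by
  induction l generalizing v with
  | zero =>
    simp only [front, List.mem_singleton] at h
    subst h
    exact ⟨rfl, List.nodup_nil, by simp⟩
  | succ l ih =>
    simp only [front, List.mem_filter, List.mem_flatMap, mem_children] at h
    obtain ⟨⟨v', hv', i, h1, h2, rfl, -⟩, -⟩ := h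
    exact (ih hv').snoc h1 h2

theorem isPathIn_of_mem_next {p : Fin d → ℝ} {b₁ : ℝ} {c : Coeffs n d} {x : Vec d} {m l : ℕ}
    {v : Path d} (h : v ∈ (front p b₁ c x m l).flatMap (children b₁ c x m)) :
    IsPathIn x (l + 1) v := by
  simp only [List.mem_flatMap, mem_children] at h
  obtain ⟨v', hv', i, h1, h2, rfl, -⟩ := h
  exact (isPathIn_of_mem_front hv').snoc h1 h2

theorem isPathIn_of_mem_done {p : Fin d → ℝ} {b₁ : ℝ} {c : Coeffs n d} {x : Vec d} {m l : ℕ}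
    {v : Path d} (h : v ∈ done p b₁ c x m l) : IsPathIn x (l + 1) v :=
  isPathIn_of_mem_next (List.mem_of_mem_filter h)

theorem nodup_flatMap_freshCoords (x : Vec d) {F : List (Path d)} (hF : F.Nodup) :
    (F.flatMap fun v => (freshCoords x v).map fun i => v ++ [i]).Nodup := by
  rw [List.nodup_flatMap]
  constructor
  · intro v _
    refine List.Nodup.map ?_ ((List.nodup_finRange d).filter _)
    intro i j h
    simpa using h
  · refine List.Pairwise.imp ?_ hF
    intro v w hvw
    simp only [Function.onFun, List.disjoint_left, List.mem_map]
    rintro u ⟨i, -, rfl⟩ ⟨j, -, hj⟩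
    exact hvw (List.append_inj_left' hj rfl).symm

theorem flatMap_children (b₁ : ℝ) (c : Coeffs n d) (x : Vec d) (m : ℕ) (F : List (Path d)) :
    open Classical in F.flatMap (children b₁ c x m) =
      (F.flatMap fun v => (freshCoords x v).map fun i => v ++ [i]).filter
        fun u => Selected b₁ c m u := by
  rw [List.filter_flatMap]
  rfl

theorem nodup_front (p : Fin d → ℝ) (b₁ : ℝ) (c : Coeffs n d) (x : Vec d) (m l : ℕ) :
    (front p b₁ c x m l).Nodup := by
  induction l with
  | zero => simp [front]
  | succ l ih =>
    rw [front, flatMap_children]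
    exact ((nodup_flatMap_freshCoords x ih).filter _).filter _

theorem nodup_done (p : Fin d → ℝ) (b₁ : ℝ) (c : Coeffs n d) (x : Vec d) (m l : ℕ) :
    (done p b₁ c x m l).Nodup := by
  rw [done, flatMap_children]
  exact ((nodup_flatMap_freshCoords x (nodup_front p b₁ c x m l)).filter _).filter _

/-- The weight of `x` is below the threshold under which no path is assigned. -/
def IsLight (n : ℕ) (b₁ C : ℝ) (x : Vec d) : Prop := (size x : ℝ) < b₁ * (C * Real.log n)

open Classical in
theorem filters_val (p : Fin d → ℝ) (b₁ C : ℝ) (c : Coeffs n d) (x : Vec d) :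
    (filters p b₁ C c x).val = if IsLight n b₁ C x then [] else
      (List.range (depth n)).flatMap (done p b₁ c x (size x)) := by
  have h := grow_val p b₁ c x (size x) (depth n) 0
  simp only [front, ← List.range_eq_range'] at h
  by_cases hx : (size x : ℝ) < b₁ * (C * Real.log n)
  · have hx' : IsLight n b₁ C x := hx
    simp [filters, countOnes_val, hx, hx']
  · have hx' : ¬ IsLight n b₁ C x := hx
    simp [filters, countOnes_val, hx, hx', h]

theorem mem_filters {p : Fin d → ℝ} {b₁ C : ℝ} {c : Coeffs n d} {x : Vec d} {u : Path d} :
    u ∈ (filters p b₁ C c x).val ↔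
      ¬ IsLight n b₁ C x ∧ ∃ l < depth n, u ∈ done p b₁ c x (size x) l := by
  rw [filters_val]
  by_cases h : IsLight n b₁ C x <;> simp [h, List.mem_flatMap]

theorem nodup_filters (p : Fin d → ℝ) (b₁ C : ℝ) (c : Coeffs n d) (x : Vec d) :
    (filters p b₁ C c x).val.Nodup := by
  rw [filters_val]
  split_ifs
  · exact List.nodup_nil
  · rw [List.nodup_flatMap]
    refine ⟨fun l _ => nodup_done _ _ _ _ _ _, ?_⟩
    refine List.Pairwise.imp ?_ List.nodup_range
    intro l k hlk
    simp only [Function.onFun, List.disjoint_left]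
    intro u h1 h2
    have e1 := (isPathIn_of_mem_done h1).1
    have e2 := (isPathIn_of_mem_done h2).1
    omega

theorem exists_isPathIn_of_mem_filters {p : Fin d → ℝ} {b₁ C : ℝ} {c : Coeffs n d} {x : Vec d}
    {u : Path d} (h : u ∈ (filters p b₁ C c x).val) :
    u ≠ [] ∧ u.length ≤ depth n ∧ u.Nodup ∧ ∀ i ∈ u, x i = true := by
  obtain ⟨-, l, hl, hu⟩ := mem_filters.1 h
  obtain ⟨h1, h2, h3⟩ := isPathIn_of_mem_done hu
  refine ⟨?_, by omega, h2, h3⟩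
  rintro rfl
  simp at h1

/-! ### Cost of computing the paths -/

theorem length_children_le (b₁ : ℝ) (c : Coeffs n d) (x : Vec d) (m : ℕ) (v : Path d) :
    (children b₁ c x m v).length ≤ d := by
  refine (List.length_filter_le _ _).trans ?_
  rw [List.length_map]
  refine (List.length_filter_le _ _).trans ?_
  simp

theorem length_next_le (p : Fin d → ℝ) (b₁ : ℝ) (c : Coeffs n d) (x : Vec d) (m l : ℕ) :
    ((front p b₁ c x m l).flatMap (children b₁ c x m)).length ≤
      (front p b₁ c x m l).length * d := by
  rw [List.length_flatMap]
  refine (List.sum_le_card_nsmul _ d ?_).trans (by simp)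
  simp only [List.mem_map]
  rintro _ ⟨v, -, rfl⟩
  exact length_children_le _ _ _ _ _

/-- A level costs `O(d l)` steps for every unfinished path with `l` entries. -/
theorem grow_steps_le (p : Fin d → ℝ) (b₁ : ℝ) (c : Coeffs n d) (x : Vec d) (m k s : ℕ)
    (hd : 1 ≤ d) :
    (grow p b₁ c x m k (front p b₁ c x m s)).steps ≤
      ∑ l ∈ Finset.range k, (1 + (front p b₁ c x m (s + l)).length * (d * (4 * (s + l) + 11))) := by
  classical
  induction k generalizing s with
  | zero => simp [grow]
  | succ k ih =>
    have h := ih (s + 1)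
    set F := front p b₁ c x m s with hF
    have h1 : (collect (fun v => extensions b₁ c x m v (List.finRange d)) F).steps ≤
        F.length * (1 + d * (3 * s + 6) + d) := by
      rw [collect_steps]
      refine (List.sum_le_card_nsmul _ (1 + d * (3 * s + 6) + d) ?_).trans (by simp)
      simp only [List.mem_map]
      rintro _ ⟨v, hv, rfl⟩
      have e1 := extensions_steps_le b₁ c x m v (List.finRange d)
      have e2 := length_children_le b₁ c x m v
      rw [(isPathIn_of_mem_front hv).1, List.length_finRange] at e1
      rw [extensions_val]
      omega
    have h2 : (split n p (F.flatMap (children b₁ c x m))).steps ≤ F.length * d * (s + 2) := by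
      rw [split_steps]
      refine (List.sum_le_card_nsmul _ (s + 2) ?_).trans ?_
      · simp only [List.mem_map]
        rintro _ ⟨v, hv, rfl⟩
        rw [(isPathIn_of_mem_next hv).1]
      · rw [List.length_map, smul_eq_mul]
        exact Nat.mul_le_mul_right _ (length_next_le p b₁ c x m s)
    have h3 : (done p b₁ c x m s).length ≤ F.length * d :=
      (List.length_filter_le _ _).trans (length_next_le p b₁ c x m s)
    rw [Finset.sum_range_succ']
    have h4 : ∑ l ∈ Finset.range k,
        (1 + (front p b₁ c x m (s + (l + 1))).length * (d * (4 * (s + (l + 1)) + 11))) =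
        ∑ l ∈ Finset.range k,
          (1 + (front p b₁ c x m (s + 1 + l)).length * (d * (4 * (s + 1 + l) + 11))) :=
      Finset.sum_congr rfl fun l _ => by rw [show s + (l + 1) = s + 1 + l by ring]
    rw [h4]
    have h6 : front p b₁ c x m (s + 1) =
        (F.flatMap (children b₁ c x m)).filter fun v => ¬ Finished n p v := rfl
    have h7 : (grow p b₁ c x m k (front p b₁ c x m (s + 1))).steps =
      (grow p b₁ c x m k
        ((F.flatMap (children b₁ c x m)).filter fun v => ¬ Finished n p v)).steps := by rw [h6]
    rw [h7] at h
    simp only [grow, Timed.steps_bind, collect_val, split_val, extensions_val, ← hF,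
      Timed.steps_pure, tick_steps, add_zero]
    have h5 : F.length * (1 + d * (3 * s + 6) + d) + F.length * d * (s + 2) + F.length * d ≤
        F.length * (d * (4 * s + 11)) := by
      have : F.length * 1 ≤ F.length * d := Nat.mul_le_mul_left _ hd
      nlinarith
    change 1 + (_ + (_ + (_ + (done p b₁ c x m s).length))) ≤ _
    linarith

end Paths

section Costs

variable {n d : ℕ}

theorem one_le_depth (hn : 2 ≤ n) : 1 ≤ depth n := Nat.clog_pos (by norm_num) hn

open Classical in
/-- The total number of unfinished paths of `x` in all levels. -/
noncomputable def frontCount (p : Fin d → ℝ) (b₁ C : ℝ) (c : Coeffs n d) (x : Vec d) : ℕ :=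
  if IsLight n b₁ C x then 0 else ∑ l ∈ Finset.range (depth n), (front p b₁ c x (size x) l).length

theorem filters_steps_le (p : Fin d → ℝ) (b₁ C : ℝ) (c : Coeffs n d) (x : Vec d) (hn : 2 ≤ n)
    (hd : 1 ≤ d) :
    (filters p b₁ C c x).steps ≤
      3 * (d * depth n) + 15 * (d * depth n) * frontCount p b₁ C c x := by
  have hL := one_le_depth hn
  have hdL : d ≤ d * depth n := Nat.le_mul_of_pos_right _ hL
  have hLd : depth n ≤ d * depth n := Nat.le_mul_of_pos_left _ hd
  by_cases hx : (size x : ℝ) < b₁ * (C * Real.log n)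
  · simp [filters, countOnes_val, countOnes_steps, hx]
    have : 0 ≤ 15 * (d * depth n) * frontCount p b₁ C c x := Nat.zero_le _
    omega
  · have hx' : ¬ IsLight n b₁ C x := hx
    have h := grow_steps_le p b₁ c x (size x) (depth n) 0 hd
    have h2 : ∑ l ∈ Finset.range (depth n), (1 + (front p b₁ c x (size x) (0 + l)).length *
        (d * (4 * (0 + l) + 11))) ≤
        depth n + 15 * (d * depth n) * frontCount p b₁ C c x := by
      rw [frontCount, if_neg hx', Finset.sum_add_distrib, Finset.mul_sum]
      refine Nat.add_le_add (by simp) (Finset.sum_le_sum fun l hl => ?_)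
      have hl' : 4 * l + 11 ≤ 15 * depth n := by
        have := Finset.mem_range.1 hl
        omega
      calc _ ≤ (front p b₁ c x (size x) l).length * (d * (15 * depth n)) := by
            simp only [zero_add]
            gcongr
        _ = _ := by ring
    simp only [front] at h
    simp only [filters, Timed.steps_bind, countOnes_val, countOnes_steps, if_neg hx, tick_steps]
    omega

end Costs

/-! ### The trie -/

section Trie

variable {n d : ℕ}

namespace Trie

/-- The keys of a list of siblings. -/
def keys : Trie n d → List (Fin d)
  | .nil => []
  | .node k _ _ sibling => k :: sibling.keys

/-- No two siblings have the same key. -/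
def Distinct : Trie n d → Prop
  | .nil => True
  | .node k _ child sibling => k ∉ sibling.keys ∧ child.Distinct ∧ sibling.Distinct

theorem nodup_keys {t : Trie n d} (h : t.Distinct) : t.keys.Nodup := by
  induction t with
  | nil => exact List.nodup_nil
  | node k ids child sibling _ ih => exact List.nodup_cons.2 ⟨h.1, ih h.2.2⟩

theorem length_keys_le {t : Trie n d} (h : t.Distinct) : t.keys.length ≤ d := by
  simpa using (nodup_keys h).length_le_card

theorem single_keys (j : Fin n) (a : Fin d) (u : Path d) :
    (single j (a :: u)).val.keys = [a] := by
  cases u <;> simp [single, keys]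

theorem distinct_single (j : Fin n) (u : Path d) : (single j u).val.Distinct := by
  induction u with
  | nil => trivial
  | cons a u ih =>
    cases u with
    | nil => simp [single, Distinct, keys]
    | cons b u => simpa [single, Distinct, keys] using ih

theorem single_steps (j : Fin n) (u : Path d) : (single j u).steps = u.length := by
  induction u with
  | nil => rfl
  | cons a u ih =>
    cases u with
    | nil => simp [single]
    | cons b u => simp only [single, Timed.steps_bind, ih]; simp; ring

theorem single_words (j : Fin n) (u : Path d) : (single j u).val.words ≤ 4 * u.length + 2 := by
  induction u with
  | nil => simp [single, words]
  | cons a u ih =>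
    cases u with
    | nil => simp [single, words]
    | cons b u =>
      simp only [single, Timed.val_bind, Timed.val_pure, words, List.length_cons] at *
      simp
      omega

theorem lookup_nil (u : Path d) : (lookup (.nil : Trie n d) u).val = [] := by
  cases u <;> simp [lookup]

theorem lookup_single (j : Fin n) (u v : Path d) (hu : u ≠ []) :
    (lookup (single j u).val v).val = if v = u then [j] else [] := by
  induction u generalizing v with
  | nil => exact absurd rfl hu
  | cons a u ih =>
    cases v with
    | nil => cases u <;> simp [single, lookup]
    | cons b v =>
      cases u with
      | nil =>
        by_cases hab : a = b
        · subst hab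
          cases v <;> simp [single, lookup]
        · simp [single, lookup, hab, Ne.symm hab]
      | cons a' u =>
        by_cases hab : a = b
        · subst hab
          cases v with
          | nil => simp [single, lookup]
          | cons b' v =>
            have := ih (b' :: v) (by simp)
            simp only [single, lookup, Timed.val_bind, Timed.val_pure, if_true, this]
            simp
        · simp [single, lookup, hab, Ne.symm hab]

theorem keys_insert (j : Fin n) (t : Trie n d) (a : Fin d) (u : Path d) :
    ∀ k ∈ (insert j t (a :: u)).val.keys, k = a ∨ k ∈ t.keys := by
  induction t with
  | nil => intro k hk; simp [insert, single_keys] at hk; exact Or.inl hk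
  | node k ids child sibling _ ih =>
    intro k' hk'
    by_cases hka : k = a
    · subst hka
      cases u <;> simp [insert, keys] at hk' ⊢ <;> tauto
    · simp [insert, hka, keys] at hk' ⊢
      rcases hk' with rfl | hk'
      · simp
      · rcases ih k' hk' with h | h <;> simp [h]

theorem distinct_insert (j : Fin n) (t : Trie n d) (u : Path d) (h : t.Distinct) :
    (insert j t u).val.Distinct := by
  induction t generalizing u with
  | nil => cases u with
    | nil => simpa [insert] using h
    | cons a u => simpa [insert] using distinct_single j (a :: u)
  | node k ids child sibling ihc ihs =>
    cases u with
    | nil => simpa [insert] using h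
    | cons a u =>
      by_cases hka : k = a
      · subst hka
        cases u with
        | nil => simpa [insert, Distinct] using h
        | cons b w => simpa [insert, Distinct] using ⟨h.1, ihc (b :: w) h.2.1, h.2.2⟩
      · simp only [insert, if_neg hka, Timed.val_bind, Timed.val_pure, Distinct]
        refine ⟨fun hk => ?_, h.2.1, ihs _ h.2.2⟩
        rcases keys_insert j sibling a u k hk with hk | hk
        · exact hka hk
        · exact h.1 hk

/-- On each of its levels an insertion visits at most `d` siblings, as their keys are distinct. -/
theorem insert_steps_le (j : Fin n) (t : Trie n d) (u : Path d) (h : t.Distinct) :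
    (insert j t u).steps ≤ t.keys.length + u.length * (d + 1) := by
  induction t generalizing u with
  | nil => cases u with
    | nil => simp [insert]
    | cons a u =>
      simp only [insert, single_steps, keys]
      nlinarith [Nat.zero_le (d * (a :: u).length)]
  | node k ids child sibling ihc ihs =>
    cases u with
    | nil => simp [insert]
    | cons a u =>
      by_cases hka : k = a
      · subst hka
        cases u with
        | nil => simp [insert, keys]; omega
        | cons b w =>
          have h1 := ihc (b :: w) h.2.1
          have h2 := length_keys_le h.2.1
          simp only [insert, if_true, Timed.steps_bind, Timed.steps_pure, tick_steps, keys]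
          simp only [List.length_cons] at *
          nlinarith
      · have h1 := ihs (a :: u) h.2.2
        simp only [insert, if_neg hka, Timed.steps_bind, Timed.steps_pure, tick_steps, keys]
        simp only [List.length_cons] at *
        omega

theorem lookup_steps_le (t : Trie n d) (u : Path d) (h : t.Distinct) :
    (lookup t u).steps ≤ t.keys.length + u.length * (d + 1) := by
  induction t generalizing u with
  | nil => cases u with
    | nil => simp [lookup]
    | cons a u => simp [lookup]; nlinarith [Nat.zero_le (d * (a :: u).length)]
  | node k ids child sibling ihc ihs =>
    cases u with
    | nil => simp [lookup]
    | cons a u =>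
      by_cases hka : k = a
      · subst hka
        cases u with
        | nil => simp [lookup, keys]; omega
        | cons b w =>
          have h1 := ihc (b :: w) h.2.1
          have h2 := length_keys_le h.2.1
          simp only [lookup, if_true, Timed.steps_bind, tick_steps, keys]
          simp only [List.length_cons] at *
          nlinarith
      · have h1 := ihs (a :: u) h.2.2
        simp only [lookup, if_neg hka, Timed.steps_bind, tick_steps, keys]
        simp only [List.length_cons] at *
        omega

theorem words_insert_le (j : Fin n) (t : Trie n d) (u : Path d) :
    (insert j t u).val.words ≤ t.words + (4 * u.length + 2) := by
  induction t generalizing u with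
  | nil => cases u with
    | nil => simp [insert]
    | cons a u => simpa [insert, words] using single_words j (a :: u)
  | node k ids child sibling ihc ihs =>
    cases u with
    | nil => simp [insert]
    | cons a u =>
      by_cases hka : k = a
      · subst hka
        cases u with
        | nil => simp [insert, words]; omega
        | cons b w =>
          have h1 := ihc (b :: w)
          simp only [insert, if_true, Timed.val_bind, Timed.val_pure, words]
          simp only [List.length_cons] at *
          omega
      · have h1 := ihs (a :: u)
        simp only [insert, if_neg hka, Timed.val_bind, Timed.val_pure, words]
        omega

theorem lookup_insert (j : Fin n) (t : Trie n d) (u v : Path d) (hu : u ≠ []) :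
    (lookup (insert j t u).val v).val =
      if v = u then j :: (lookup t v).val else (lookup t v).val := by
  obtain ⟨a, u, rfl⟩ := List.exists_cons_of_ne_nil hu
  clear hu
  induction t generalizing a u v with
  | nil => simp [insert, lookup_single, lookup_nil]
  | node k ids child sibling ihc ihs =>
    cases v with
    | nil => simp [lookup]
    | cons b v =>
      by_cases hka : k = a
      · subst hka
        by_cases hkb : k = b
        · subst hkb
          cases u with
          | nil => cases v <;> simp [insert, lookup]
          | cons a' u =>
            cases v with
            | nil => simp [insert, lookup]
            | cons b' v =>
              have := ihc (b' :: v) a' u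
              simp only [insert, lookup, Timed.val_bind, Timed.val_pure, if_true, this]
              simp
        · cases u <;> simp [insert, lookup, hkb, Ne.symm hkb]
      · by_cases hkb : k = b
        · subst hkb
          simp [insert, lookup, hka]
        · have := ihs (b :: v) a u
          simp [insert, lookup, hka, hkb, this]

end Trie

/-! ### Building the tables -/

/-- The effect of `insertAll` on the invariant, its time, and its effect on space and contents. -/
theorem insertAll_spec (j : Fin n) (vs : List (Path d)) (t : Trie n d) (ht : t.Distinct) (L : ℕ)
    (hvs : vs.Nodup) (hL : ∀ v ∈ vs, v ≠ [] ∧ v.length ≤ L) :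
    (insertAll j vs t).val.Distinct ∧
    (insertAll j vs t).steps ≤ vs.length * (1 + (d + L * (d + 1))) ∧
    (insertAll j vs t).val.words ≤ t.words + vs.length * (4 * L + 2) ∧
    ∀ u, ((insertAll j vs t).val.lookup u).val =
      if u ∈ vs then j :: (t.lookup u).val else (t.lookup u).val := by
  induction vs generalizing t with
  | nil => simp [insertAll, ht]
  | cons v vs ih =>
    obtain ⟨hv, hvs⟩ := List.nodup_cons.1 hvs
    have h1 := hL v (by simp)
    obtain ⟨i1, i2, i3, i4⟩ := ih (t.insert j v).val (Trie.distinct_insert j t v ht) hvs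
      fun w hw => hL w (by simp [hw])
    have s1 := Trie.insert_steps_le j t v ht
    have s2 := Trie.length_keys_le ht
    have s3 := Trie.words_insert_le j t v
    have s4 : v.length * (d + 1) ≤ L * (d + 1) := Nat.mul_le_mul_right _ h1.2
    refine ⟨i1, ?_, ?_, ?_⟩
    · simp only [insertAll, Timed.steps_bind, tick_steps, List.length_cons]
      rw [Nat.succ_mul]
      omega
    · simp only [insertAll, Timed.val_bind, List.length_cons]
      rw [Nat.succ_mul]
      omega
    · intro u
      simp only [insertAll, Timed.val_bind]
      rw [i4, Trie.lookup_insert _ _ _ _ h1.1]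
      by_cases huv : u = v
      · subst huv
        simp [hv]
      · simp [huv]

/-- Time, space and contents of a trie built from the listed data vectors: a lookup of `u` finds
exactly those vectors that choose the path `u`, each of them once. -/
theorem buildTrie_spec (p : Fin d → ℝ) (b₁ C : ℝ) (S : Fin n → Vec d) (c : Coeffs n d)
    (js : List (Fin n)) (t : Trie n d) (ht : t.Distinct) :
    (buildTrie p b₁ C S c js t).val.Distinct ∧
    (buildTrie p b₁ C S c js t).steps ≤ (js.map fun j => 1 + ((filters p b₁ C c (S j)).steps +
      (filters p b₁ C c (S j)).val.length * (1 + (d + depth n * (d + 1))))).sum ∧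
    (buildTrie p b₁ C S c js t).val.words ≤ t.words +
      (js.map fun j => (filters p b₁ C c (S j)).val.length * (4 * depth n + 2)).sum ∧
    ∀ u, ∃ ids : List (Fin n), ((buildTrie p b₁ C S c js t).val.lookup u).val =
      ids ++ (t.lookup u).val ∧ (∀ j, j ∈ ids ↔ j ∈ js ∧ u ∈ (filters p b₁ C c (S j)).val) ∧
      (js.Nodup → ids.Nodup) := by
  induction js generalizing t with
  | nil => simp [buildTrie, ht]
  | cons j js ih =>
    obtain ⟨a1, a2, a3, a4⟩ := insertAll_spec j (filters p b₁ C c (S j)).val t ht (depth n)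
      (nodup_filters p b₁ C c (S j)) fun v hv =>
        ⟨(exists_isPathIn_of_mem_filters hv).1, (exists_isPathIn_of_mem_filters hv).2.1⟩
    obtain ⟨i1, i2, i3, i4⟩ := ih _ a1
    refine ⟨i1, ?_, ?_, ?_⟩
    · simp only [buildTrie, Timed.steps_bind, tick_steps, List.map_cons, List.sum_cons]
      omega
    · simp only [buildTrie, Timed.val_bind, List.map_cons, List.sum_cons]
      omega
    · intro u
      obtain ⟨ids, h1, h2, h3⟩ := i4 u
      simp only [buildTrie, Timed.val_bind]
      by_cases hu : u ∈ (filters p b₁ C c (S j)).val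
      · refine ⟨ids ++ [j], by rw [h1, a4, if_pos hu]; simp, ?_, ?_⟩
        · intro j'
          rw [List.mem_append, h2, List.mem_singleton, List.mem_cons]
          constructor
          · rintro (h | rfl)
            · exact ⟨Or.inr h.1, h.2⟩
            · exact ⟨Or.inl rfl, hu⟩
          · rintro ⟨rfl | h, h'⟩
            · exact Or.inr rfl
            · exact Or.inl ⟨h, h'⟩
        · intro hjs
          obtain ⟨hj, hjs⟩ := List.nodup_cons.1 hjs
          rw [List.nodup_append]
          refine ⟨h3 hjs, List.nodup_singleton _, ?_⟩
          rintro a ha b hb rfl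
          rw [List.mem_singleton] at hb
          exact hj (hb ▸ ((h2 a).1 ha).1)
      · refine ⟨ids, by rw [h1, a4, if_neg hu], ?_, fun hjs => h3 (List.nodup_cons.1 hjs).2⟩
        intro j'
        rw [h2, List.mem_cons]
        constructor
        · exact fun h => ⟨Or.inr h.1, h.2⟩
        · rintro ⟨rfl | h, h'⟩
          · exact absurd h' hu
          · exact ⟨h, h'⟩

/-- The trie of one repetition. -/
noncomputable def table (p : Fin d → ℝ) (b₁ C : ℝ) (S : Fin n → Vec d) (c : Coeffs n d) :
    Trie n d :=
  (buildTrie p b₁ C S c (List.finRange n) .nil).val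

theorem distinct_table (p : Fin d → ℝ) (b₁ C : ℝ) (S : Fin n → Vec d) (c : Coeffs n d) :
    (table p b₁ C S c).Distinct :=
  (buildTrie_spec p b₁ C S c (List.finRange n) .nil trivial).1

theorem mem_lookup_table {p : Fin d → ℝ} {b₁ C : ℝ} {S : Fin n → Vec d} {c : Coeffs n d}
    {u : Path d} {j : Fin n} :
    j ∈ ((table p b₁ C S c).lookup u).val ↔ u ∈ (filters p b₁ C c (S j)).val := by
  obtain ⟨ids, h1, h2, -⟩ :=
    (buildTrie_spec p b₁ C S c (List.finRange n) .nil trivial).2.2.2 u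
  rw [table, h1, Trie.lookup_nil, List.append_nil, h2]
  simp

/-- The number of data vectors that contain all coordinates of `u`. -/
def cover (S : Fin n → Vec d) (u : Path d) : ℕ :=
  (Finset.univ.filter fun j => ∀ i ∈ u, S j i = true).card

theorem length_lookup_table_le (p : Fin d → ℝ) (b₁ C : ℝ) (S : Fin n → Vec d) (c : Coeffs n d)
    (u : Path d) : ((table p b₁ C S c).lookup u).val.length ≤ cover S u := by
  have hnd : ((table p b₁ C S c).lookup u).val.Nodup := by
    obtain ⟨ids, h1, -, h3⟩ :=
      (buildTrie_spec p b₁ C S c (List.finRange n) .nil trivial).2.2.2 u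
    rw [table, h1, Trie.lookup_nil, List.append_nil]
    exact h3 (List.nodup_finRange n)
  rw [← List.toFinset_card_of_nodup hnd, cover]
  refine Finset.card_le_card fun j hj => ?_
  rw [List.mem_toFinset, mem_lookup_table] at hj
  simpa using (exists_isPathIn_of_mem_filters hj).2.2.2

theorem buildTables_val (p : Fin d → ℝ) (b₁ C : ℝ) (ω : Coins n d) (S : Fin n → Vec d)
    (rs : List (Fin (reps n))) :
    (buildTables p b₁ C ω S rs).val = rs.map fun r => (ω r, table p b₁ C S (ω r)) := by
  induction rs with
  | nil => rfl
  | cons r rs ih => simp [buildTables, ih, table]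

theorem build_tables (p : Fin d → ℝ) (b₁ C : ℝ) (ω : Coins n d) (S : Fin n → Vec d) :
    (build p b₁ C ω S).val.tables =
      (List.finRange (reps n)).map fun r => (ω r, table p b₁ C S (ω r)) := by
  simp [build, buildTables_val]

theorem build_data (p : Fin d → ℝ) (b₁ C : ℝ) (ω : Coins n d) (S : Fin n → Vec d) :
    (build p b₁ C ω S).val.data = S := by
  simp [build]

theorem build_words_le (p : Fin d → ℝ) (b₁ C : ℝ) (ω : Coins n d) (S : Fin n → Vec d) :
    (build p b₁ C ω S).val.words ≤ n * d + d + ∑ r : Fin (reps n),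
      (depth n * (depth n + 1) +
        ∑ j, (filters p b₁ C (ω r) (S j)).val.length * (4 * depth n + 2)) := by
  rw [Index.words, build_tables, List.map_map, Fin.sum_univ_def]
  refine Nat.add_le_add_left (List.sum_le_sum fun r _ => ?_) _
  have h := (buildTrie_spec p b₁ C S (ω r) (List.finRange n) .nil trivial).2.2.1
  rw [Fin.sum_univ_def]
  simpa [table, Trie.words] using h

theorem build_steps_le (p : Fin d → ℝ) (b₁ C : ℝ) (ω : Coins n d) (S : Fin n → Vec d) :
    (build p b₁ C ω S).steps ≤ n * d + ∑ r : Fin (reps n),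
      (depth n * (depth n + 1) + ∑ j, (1 + ((filters p b₁ C (ω r) (S j)).steps +
        (filters p b₁ C (ω r) (S j)).val.length * (1 + (d + depth n * (d + 1)))))) := by
  have H : ∀ rs, (buildTables p b₁ C ω S rs).steps ≤ (rs.map fun r =>
      (depth n * (depth n + 1) + ∑ j, (1 + ((filters p b₁ C (ω r) (S j)).steps +
        (filters p b₁ C (ω r) (S j)).val.length * (1 + (d + depth n * (d + 1))))))).sum := by
    intro rs
    induction rs with
    | nil => simp [buildTables]
    | cons r rs ih =>
      have h := (buildTrie_spec p b₁ C S (ω r) (List.finRange n) .nil trivial).2.1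
      rw [← Fin.sum_univ_def] at h
      simp only [buildTables, Timed.steps_bind, tick_steps, Timed.steps_pure, List.map_cons,
        List.sum_cons]
      omega
  simp only [build, Timed.steps_bind, tick_steps, Timed.steps_pure, add_zero]
  rw [Fin.sum_univ_def]
  exact Nat.add_le_add_left (H _) _

/-! ### Searching -/

theorem similarity_steps (x y : Vec d) : (similarity x y).steps = 3 * d + 1 := by
  simp only [similarity, Timed.steps_bind, countOnes_steps, tick_steps, Timed.steps_pure]
  ring

theorem similarity_val (x y : Vec d) : (similarity x y).val = braunBlanquet x y := by
  simp [similarity, countOnes_val, braunBlanquet]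

theorem firstSimilar_steps_le (b₁ : ℝ) (S : Fin n → Vec d) (q : Vec d) (js : List (Fin n)) :
    (firstSimilar b₁ S q js).steps ≤ js.length * (3 * d + 2) := by
  induction js with
  | nil => simp [firstSimilar]
  | cons j js ih =>
    by_cases h : b₁ ≤ braunBlanquet q (S j)
    all_goals simp [firstSimilar, similarity_steps, similarity_val, h]
    all_goals nlinarith

theorem firstSimilar_some {b₁ : ℝ} {S : Fin n → Vec d} {q : Vec d} {js : List (Fin n)}
    {j : Fin n} (h : (firstSimilar b₁ S q js).val = some j) : b₁ ≤ braunBlanquet q (S j) := by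
  induction js with
  | nil => simp [firstSimilar] at h
  | cons j' js ih =>
    by_cases hj : b₁ ≤ braunBlanquet q (S j')
    · simp [firstSimilar, similarity_val, hj] at h
      exact h ▸ hj
    · simp [firstSimilar, similarity_val, hj] at h
      exact ih h

theorem firstSimilar_ne_none {b₁ : ℝ} {S : Fin n → Vec d} {q : Vec d} {js : List (Fin n)}
    {j : Fin n} (hj : j ∈ js) (h : b₁ ≤ braunBlanquet q (S j)) :
    (firstSimilar b₁ S q js).val ≠ none := by
  induction js with
  | nil => simp at hj
  | cons j' js ih =>
    by_cases hj' : b₁ ≤ braunBlanquet q (S j')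
    · simp [firstSimilar, similarity_val, hj']
    · rcases List.mem_cons.1 hj with rfl | hj
      · exact absurd h hj'
      · simpa [firstSimilar, similarity_val, hj'] using ih hj

theorem searchPaths_steps_le (b₁ : ℝ) (S : Fin n → Vec d) (q : Vec d) (T : Trie n d)
    (vs : List (Path d)) :
    (searchPaths b₁ S q T vs).steps ≤ (vs.map fun v =>
      1 + (T.lookup v).steps + (T.lookup v).val.length * (3 * d + 2)).sum := by
  induction vs with
  | nil => simp [searchPaths]
  | cons v vs ih =>
    have h := firstSimilar_steps_le b₁ S q (T.lookup v).val
    simp only [searchPaths, Timed.steps_bind, tick_steps, List.map_cons, List.sum_cons]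
    cases (firstSimilar b₁ S q (T.lookup v).val).val <;> simp only [Timed.steps_pure] <;> omega

theorem searchPaths_some {b₁ : ℝ} {S : Fin n → Vec d} {q : Vec d} {T : Trie n d}
    {vs : List (Path d)} {j : Fin n} (h : (searchPaths b₁ S q T vs).val = some j) :
    b₁ ≤ braunBlanquet q (S j) := by
  induction vs with
  | nil => simp [searchPaths] at h
  | cons v vs ih =>
    simp only [searchPaths, Timed.val_bind] at h
    cases h' : (firstSimilar b₁ S q (T.lookup v).val).val with
    | none => rw [h'] at h; exact ih h
    | some j' =>
      rw [h'] at h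
      simp only [Timed.val_pure, Option.some.injEq] at h
      exact h ▸ firstSimilar_some h'

theorem searchPaths_ne_none {b₁ : ℝ} {S : Fin n → Vec d} {q : Vec d} {T : Trie n d}
    {vs : List (Path d)} {v : Path d} {j : Fin n} (hv : v ∈ vs) (hj : j ∈ (T.lookup v).val)
    (h : b₁ ≤ braunBlanquet q (S j)) : (searchPaths b₁ S q T vs).val ≠ none := by
  induction vs with
  | nil => simp at hv
  | cons v' vs ih =>
    simp only [searchPaths, Timed.val_bind]
    cases h' : (firstSimilar b₁ S q (T.lookup v').val).val with
    | none =>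
      rcases List.mem_cons.1 hv with rfl | hv
      · exact absurd h' (firstSimilar_ne_none hj h)
      · exact ih hv
    | some j' => simp

theorem searchTables_steps_le (p : Fin d → ℝ) (b₁ C : ℝ) (S : Fin n → Vec d) (q : Vec d)
    (Ts : List (Coeffs n d × Trie n d)) :
    (searchTables p b₁ C S q Ts).steps ≤ (Ts.map fun T => 1 + (filters p b₁ C T.1 q).steps +
      (searchPaths b₁ S q T.2 (filters p b₁ C T.1 q).val).steps).sum := by
  induction Ts with
  | nil => simp [searchTables]
  | cons T Ts ih =>
    simp only [searchTables, Timed.steps_bind, tick_steps, List.map_cons, List.sum_cons]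
    cases (searchPaths b₁ S q T.2 (filters p b₁ C T.1 q).val).val <;>
      simp only [Timed.steps_pure] <;> omega

theorem searchTables_some {p : Fin d → ℝ} {b₁ C : ℝ} {S : Fin n → Vec d} {q : Vec d}
    {Ts : List (Coeffs n d × Trie n d)} {j : Fin n}
    (h : (searchTables p b₁ C S q Ts).val = some j) : b₁ ≤ braunBlanquet q (S j) := by
  induction Ts with
  | nil => simp [searchTables] at h
  | cons T Ts ih =>
    simp only [searchTables, Timed.val_bind] at h
    cases h' : (searchPaths b₁ S q T.2 (filters p b₁ C T.1 q).val).val with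
    | none => rw [h'] at h; exact ih h
    | some j' =>
      rw [h'] at h
      simp only [Timed.val_pure, Option.some.injEq] at h
      exact h ▸ searchPaths_some h'

theorem searchTables_ne_none {p : Fin d → ℝ} {b₁ C : ℝ} {S : Fin n → Vec d} {q : Vec d}
    {Ts : List (Coeffs n d × Trie n d)} {T : Coeffs n d × Trie n d} (hT : T ∈ Ts)
    (h : (searchPaths b₁ S q T.2 (filters p b₁ C T.1 q).val).val ≠ none) :
    (searchTables p b₁ C S q Ts).val ≠ none := by
  induction Ts with
  | nil => simp at hT
  | cons T' Ts ih =>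
    simp only [searchTables, Timed.val_bind]
    cases h' : (searchPaths b₁ S q T'.2 (filters p b₁ C T'.1 q).val).val with
    | none =>
      rcases List.mem_cons.1 hT with rfl | hT
      · exact absurd h' h
      · exact ih hT
    | some j' => simp

/-- A search succeeds as soon as, in some repetition, the query shares a path with a similar data
vector. -/
theorem search_succeeds {p : Fin d → ℝ} {b₁ C : ℝ} {ω : Coins n d} {S : Fin n → Vec d}
    {q : Vec d} {j : Fin n} (hj : b₁ ≤ braunBlanquet q (S j))
    (h : ∃ r, ∃ u, u ∈ (filters p b₁ C (ω r) q).val ∧ u ∈ (filters p b₁ C (ω r) (S j)).val) :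
    ∃ j, (search p b₁ C (build p b₁ C ω S).val q).val = some j ∧
      b₁ ≤ braunBlanquet q (S j) := by
  obtain ⟨r, u, h1, h2⟩ := h
  have hne : (search p b₁ C (build p b₁ C ω S).val q).val ≠ none := by
    rw [search, build_data, build_tables]
    refine searchTables_ne_none (T := (ω r, table p b₁ C S (ω r)))
      (List.mem_map.2 ⟨r, List.mem_finRange r, rfl⟩) ?_
    exact searchPaths_ne_none h1 (mem_lookup_table.2 h2) hj
  obtain ⟨j', hj'⟩ := Option.ne_none_iff_exists'.1 hne
  refine ⟨j', hj', ?_⟩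
  rw [search, build_data] at hj'
  exact searchTables_some hj'

theorem search_steps_le (p : Fin d → ℝ) (b₁ C : ℝ) (ω : Coins n d) (S : Fin n → Vec d)
    (q : Vec d) :
    (search p b₁ C (build p b₁ C ω S).val q).steps ≤ ∑ r : Fin (reps n),
      (1 + (filters p b₁ C (ω r) q).steps +
        ((filters p b₁ C (ω r) q).val.map fun v =>
          1 + (d + depth n * (d + 1)) + cover S v * (3 * d + 2)).sum) := by
  rw [search, build_data, build_tables, Fin.sum_univ_def]
  refine (searchTables_steps_le _ _ _ _ _ _).trans ?_
  rw [List.map_map]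
  refine List.sum_le_sum fun r _ => ?_
  refine Nat.add_le_add_left ((searchPaths_steps_le _ _ _ _ _).trans ?_) _
  refine List.sum_le_sum fun v hv => ?_
  have hD := distinct_table p b₁ C S (ω r)
  have s1 := Trie.lookup_steps_le (table p b₁ C S (ω r)) v hD
  have s2 := Trie.length_keys_le hD
  have s3 := Nat.mul_le_mul_right (d + 1) (exists_isPathIn_of_mem_filters hv).2.1
  have s4 := Nat.mul_le_mul_right (3 * d + 2) (length_lookup_table_le p b₁ C S (ω r) v)
  dsimp only
  omega

end Trie

/-! ### Uniform expectations -/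

section CoinExp

variable {Ω : Type} [Fintype Ω]

theorem coinExp_mono {f g : Ω → ℝ} (h : ∀ ω, f ω ≤ g ω) : coinExp f ≤ coinExp g :=
  div_le_div_of_nonneg_right (Finset.sum_le_sum fun ω _ => h ω) (Nat.cast_nonneg _)

theorem coinExp_nonneg {f : Ω → ℝ} (h : ∀ ω, 0 ≤ f ω) : 0 ≤ coinExp f :=
  div_nonneg (Finset.sum_nonneg fun ω _ => h ω) (Nat.cast_nonneg _)

theorem coinExp_add (f g : Ω → ℝ) : coinExp (fun ω => f ω + g ω) = coinExp f + coinExp g := by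
  simp [coinExp, Finset.sum_add_distrib, add_div]

theorem coinExp_const_mul (a : ℝ) (f : Ω → ℝ) : coinExp (fun ω => a * f ω) = a * coinExp f := by
  simp [coinExp, ← Finset.mul_sum, mul_div_assoc]

theorem coinExp_mul_const (a : ℝ) (f : Ω → ℝ) : coinExp (fun ω => f ω * a) = coinExp f * a := by
  simp only [mul_comm _ a, coinExp_const_mul]

theorem coinExp_sum {ι : Type*} (s : Finset ι) (f : ι → Ω → ℝ) :
    coinExp (fun ω => ∑ i ∈ s, f i ω) = ∑ i ∈ s, coinExp (f i) := by
  simp only [coinExp]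
  rw [Finset.sum_comm, Finset.sum_div]

theorem coinExp_const [Nonempty Ω] (a : ℝ) : coinExp (fun _ : Ω => a) = a := by
  simp [coinExp]

/-- Resampling one coordinate of a uniformly random function leaves it uniformly random. -/
theorem coinExp_update {ι α : Type} [Fintype ι] [DecidableEq ι] [Fintype α] [Nonempty α] (r : ι)
    (F : (ι → α) → ℝ) :
    coinExp F = coinExp fun ω => coinExp fun a => F (Function.update ω r a) := by
  have hinv : Function.Involutive
      fun z : (ι → α) × α => (Function.update z.1 r z.2, z.1 r) := by
    rintro ⟨ω, a⟩
    simp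
  have h := Equiv.sum_comp hinv.toPerm fun z : (ι → α) × α => F z.1
  simp only [Fintype.sum_prod_type, Function.Involutive.coe_toPerm] at h
  have hα : (Fintype.card α : ℝ) ≠ 0 := by exact_mod_cast Fintype.card_ne_zero
  simp only [Finset.sum_const, Finset.card_univ, nsmul_eq_mul] at h
  simp only [coinExp]
  rw [← Finset.sum_div, h, ← Finset.mul_sum, mul_div_cancel_left₀ _ hα]

theorem coinExp_eval {ι α : Type} [Fintype ι] [DecidableEq ι] [Fintype α] [Nonempty α] (r : ι)
    (f : α → ℝ) : coinExp (fun ω : ι → α => f (ω r)) = coinExp f := by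
  rw [coinExp_update r]
  simp [coinExp_const]

end CoinExp

/-! ### Pairwise independence of the hash function -/

section Hash

variable {n d : ℕ}

theorem hashPrime_prime (n d : ℕ) : (hashPrime n d).Prime :=
  (Nat.find_spec (Nat.exists_infinite_primes (n * d))).2

theorem le_hashPrime (n d : ℕ) : n * d ≤ hashPrime n d :=
  (Nat.find_spec (Nat.exists_infinite_primes (n * d))).1

instance (n d : ℕ) : Fact (hashPrime n d).Prime := ⟨hashPrime_prime n d⟩

instance (n d : ℕ) : NeZero (hashPrime n d) := ⟨(hashPrime_prime n d).ne_zero⟩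

theorem sum_fin_eq_sum_zmod (P : ℕ) [NeZero P] (f : ZMod P → ℝ) :
    ∑ a : Fin P, f ((a : ℕ) : ZMod P) = ∑ z, f z := by
  refine Fintype.sum_bijective (fun a : Fin P => ((a : ℕ) : ZMod P)) ?_ _ _ fun _ => rfl
  refine ⟨fun a b h => ?_, fun z => ⟨⟨z.val, ZMod.val_lt z⟩, by simp⟩⟩
  have := congrArg ZMod.val h
  simp only [ZMod.val_natCast, Nat.mod_eq_of_lt a.2, Nat.mod_eq_of_lt b.2] at this
  exact Fin.ext this

/-- The value `a 0 + a 1 * w 0 + a 2 * w 1 + …` of the affine form with coefficients `a`. The hash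
value of a path is this form at the entries of the path. -/
def affine (P : ℕ) {m : ℕ} (a : Fin (m + 1) → Fin P) (w : Fin m → ZMod P) : ZMod P :=
  (a 0 : ℕ) + ∑ k : Fin m, ((a k.succ : ℕ) : ZMod P) * w k

theorem affine_update_zero (P : ℕ) {m : ℕ} (a : Fin (m + 1) → Fin P) (w : Fin m → ZMod P)
    (α : Fin P) : affine P (Function.update a 0 α) w =
      (α : ℕ) + ∑ k : Fin m, ((a k.succ : ℕ) : ZMod P) * w k := by
  simp [affine]

theorem affine_update_succ (P : ℕ) {m : ℕ} (a : Fin (m + 1) → Fin P) (w : Fin m → ZMod P)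
    (s : Fin m) (α β : Fin P) :
    affine P (Function.update (Function.update a s.succ β) 0 α) w =
      (α : ℕ) + ((β : ℕ) * w s + ∑ k ∈ Finset.univ.erase s, ((a k.succ : ℕ) : ZMod P) * w k) := by
  rw [affine_update_zero, ← Finset.add_sum_erase _ _ (Finset.mem_univ s)]
  congr 2
  · simp
  · refine Finset.sum_congr rfl fun k hk => ?_
    rw [Function.update_of_ne]
    exact fun h => (Finset.mem_erase.1 hk).1 (Fin.succ_injective _ h)

theorem coinExp_affine (P : ℕ) [NeZero P] {m : ℕ} (w : Fin m → ZMod P) (f : ZMod P → ℝ) :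
    coinExp (fun a : Fin (m + 1) → Fin P => f (affine P a w)) = (∑ z, f z) / P := by
  rw [coinExp_update 0]
  have : ∀ a : Fin (m + 1) → Fin P, coinExp (fun α => f (affine P (Function.update a 0 α) w)) =
      (∑ z, f z) / P := by
    intro a
    simp only [affine_update_zero, coinExp, Fintype.card_fin]
    rw [sum_fin_eq_sum_zmod P fun z => f (z + ∑ k : Fin m, ((a k.succ : ℕ) : ZMod P) * w k)]
    congr 1
    exact Equiv.sum_comp (Equiv.addRight _) f
  simp only [this, coinExp_const]

/-- For distinct points the values of a random affine form are independent and uniform. -/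
theorem coinExp_affine_mul (P : ℕ) [Fact P.Prime] {m : ℕ} {w w' : Fin m → ZMod P}
    (hw : w ≠ w') (f g : ZMod P → ℝ) :
    coinExp (fun a : Fin (m + 1) → Fin P => f (affine P a w) * g (affine P a w')) =
      (∑ z, f z) / P * ((∑ z, g z) / P) := by
  have : NeZero P := ⟨(Fact.out : P.Prime).ne_zero⟩
  obtain ⟨s, hs⟩ := Function.ne_iff.1 hw
  rw [coinExp_update 0, coinExp_update s.succ]
  have key : ∀ a : Fin (m + 1) → Fin P, coinExp (fun β => coinExp (fun α =>
        f (affine P (Function.update (Function.update a s.succ β) 0 α) w) *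
          g (affine P (Function.update (Function.update a s.succ β) 0 α) w'))) =
      (∑ z, f z) / P * ((∑ z, g z) / P) := by
    intro a
    simp only [affine_update_succ]
    generalize ∑ k ∈ Finset.univ.erase s, ((a k.succ : ℕ) : ZMod P) * w k = R
    generalize ∑ k ∈ Finset.univ.erase s, ((a k.succ : ℕ) : ZMod P) * w' k = R'
    simp only [coinExp, Fintype.card_fin]
    rw [← Finset.sum_div, div_div, div_mul_div_comm]
    congr 1
    have e1 : ∀ β : Fin P, ∑ α : Fin P, f ((α : ℕ) + ((β : ℕ) * w s + R)) *
        g ((α : ℕ) + ((β : ℕ) * w' s + R')) =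
        ∑ y : ZMod P, f (y + ((β : ℕ) * w s + R)) * g (y + ((β : ℕ) * w' s + R')) := fun β =>
      sum_fin_eq_sum_zmod P fun y => f (y + ((β : ℕ) * w s + R)) * g (y + ((β : ℕ) * w' s + R'))
    simp only [e1]
    rw [sum_fin_eq_sum_zmod P fun z => ∑ y : ZMod P, f (y + (z * w s + R)) *
        g (y + (z * w' s + R')), Finset.sum_mul_sum, ← Fintype.sum_prod_type',
      ← Fintype.sum_prod_type']
    -- The two values determine the two resampled coefficients, since `w s ≠ w' s`.
    have hinj : Function.Injective fun z : ZMod P × ZMod P =>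
        (z.2 + (z.1 * w s + R), z.2 + (z.1 * w' s + R')) := by
      rintro ⟨z, y⟩ ⟨z', y'⟩ h
      simp only [Prod.mk.injEq] at h
      obtain ⟨h1, h2⟩ := h
      have h3 : (z - z') * (w s - w' s) = 0 := by linear_combination h1 - h2
      have h4 : z = z' :=
        sub_eq_zero.1 ((mul_eq_zero.1 h3).resolve_right (sub_ne_zero.2 hs))
      subst h4
      simpa using h1
    exact Fintype.sum_bijective _ (Finite.injective_iff_bijective.1 hinj) _ _ fun _ => rfl
  simp only [key, coinExp_const]

/-- The entries of a path as residues, padded by zeros. -/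
def digits (P m : ℕ) (u : Path d) : Fin m → ZMod P :=
  fun k => (((u.map Fin.val).getD k 0 : ℕ) : ZMod P)

theorem cast_hashLoop (P : ℕ) (row : ℕ → ℕ) (t : ℕ) (u : Path d) :
    ((hashLoop P row t u).val : ZMod P) =
      ∑ k ∈ Finset.range u.length, (row (t + k) : ZMod P) * ((u.map Fin.val).getD k 0 : ℕ) := by
  induction u generalizing t with
  | nil => simp [hashLoop]
  | cons i u ih =>
    simp only [hashLoop, Timed.val_bind, Timed.val_pure, ZMod.natCast_mod, Nat.cast_add,
      Nat.cast_mul, ih, List.length_cons, Finset.sum_range_succ', List.map_cons]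
    rw [add_comm]
    congr 1
    refine Finset.sum_congr rfl fun k _ => ?_
    rw [show t + 1 + k = t + (k + 1) by ring]
    simp

/-- The hash value of a path with `l + 1` entries depends on row `l` of the coefficients only, as an
affine form in that row. -/
theorem hash_update (c : Coeffs n d) {l : ℕ} (hl : l < depth n)
    (a : Fin (depth n + 1) → Fin (hashPrime n d)) {u : Path d} (hu : u.length = l + 1) :
    (hash (Function.update c ⟨l, hl⟩ a) u).val =
      (affine (hashPrime n d) a (digits (hashPrime n d) (depth n) u)).val := by
  have hex : ∃ c' : Coeffs n d, c' = Function.update c ⟨l, hl⟩ a := ⟨_, rfl⟩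
  obtain ⟨c', hc'⟩ := hex
  rw [← hc']
  have hlt : (hash c' u).val < hashPrime n d := by
    simp only [hash, Timed.val_bind, Timed.val_pure]
    exact Nat.mod_lt _ (hashPrime_prime n d).pos
  have hcoef : ∀ t (ht : t < depth n + 1), coef c' l t = (a ⟨t, ht⟩ : ℕ) := by
    intro t ht
    simp [coef, hl, ht, hc']
  rw [← Nat.mod_eq_of_lt hlt, ← ZMod.val_natCast]
  congr 1
  simp only [hash, Timed.val_bind, Timed.val_pure, hu, Nat.add_sub_cancel]
  rw [ZMod.natCast_mod, Nat.cast_add, cast_hashLoop, hu, affine, hcoef 0 (by omega)]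
  congr 1
  rw [Finset.sum_subset (Finset.range_mono (Nat.succ_le_of_lt hl)), Finset.sum_range]
  · refine Finset.sum_congr rfl fun k _ => ?_
    rw [hcoef _ (by omega), digits]
    congr 4
    exact Fin.ext (by simp [add_comm])
  · intro k _ hk
    rw [List.getD_eq_default]
    · simp
    · simp only [List.length_map, hu]
      simpa using hk

theorem digits_ne {u u' : Path d} {m : ℕ} {P : ℕ} (hP : d ≤ P) (hu : u.length ≤ m)
    (hlen : u.length = u'.length) (h : u ≠ u') : digits P m u ≠ digits P m u' := by
  intro heq
  apply h
  refine List.ext_getElem hlen fun k h1 h2 => ?_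
  have hk := congrFun heq ⟨k, h1.trans_le hu⟩
  simp only [digits, List.getD_eq_getElem?_getD, List.getElem?_map, h1, h2,
    List.getElem?_eq_getElem, Option.map_some, Option.getD_some] at hk
  have := congrArg ZMod.val hk
  rw [ZMod.val_natCast, ZMod.val_natCast, Nat.mod_eq_of_lt (u[k].2.trans_le hP),
    Nat.mod_eq_of_lt (u'[k].2.trans_le hP)] at this
  exact Fin.ext this

open Classical in
/-- The probability that a path with `l + 1` entries passes the hash test for the threshold
parameter `m`. -/
noncomputable def selProb (n d : ℕ) (b₁ : ℝ) (m l : ℕ) : ℝ :=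
  (∑ z : ZMod (hashPrime n d), if (z.val : ℝ) * (b₁ * m - l) < hashPrime n d then 1 else 0) /
    hashPrime n d

variable (b₁ : ℝ) (c : Coeffs n d) (m : ℕ) {l : ℕ} (hl : l < depth n)

theorem selected_update_iff (a : Fin (depth n + 1) → Fin (hashPrime n d)) {u : Path d}
    (hu : u.length = l + 1) :
    Selected b₁ (Function.update c ⟨l, hl⟩ a) m u ↔
      ((affine (hashPrime n d) a (digits (hashPrime n d) (depth n) u)).val : ℝ) * (b₁ * m - l) <
        hashPrime n d := by
  rw [Selected, hash_update c hl a hu, hu, Nat.add_sub_cancel]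

open Classical in
theorem coinExp_selected {u : Path d} (hu : u.length = l + 1) :
    coinExp (fun a => if Selected b₁ (Function.update c ⟨l, hl⟩ a) m u then (1 : ℝ) else 0) =
      selProb n d b₁ m l := by
  simp only [selected_update_iff b₁ c m hl _ hu]
  exact coinExp_affine (hashPrime n d) _ fun z =>
    if (z.val : ℝ) * (b₁ * m - l) < hashPrime n d then 1 else 0

open Classical in
theorem coinExp_selected_mul (hn : 1 ≤ n) {u u' : Path d} (hu : u.length = l + 1)
    (hu' : u'.length = l + 1) (h : u ≠ u') :
    coinExp (fun a => (if Selected b₁ (Function.update c ⟨l, hl⟩ a) m u then (1 : ℝ) else 0) *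
      if Selected b₁ (Function.update c ⟨l, hl⟩ a) m u' then (1 : ℝ) else 0) =
      selProb n d b₁ m l ^ 2 := by
  simp only [selected_update_iff b₁ c m hl _ hu, selected_update_iff b₁ c m hl _ hu']
  have hd : d ≤ hashPrime n d := (Nat.le_mul_of_pos_left d hn).trans (le_hashPrime n d)
  rw [sq]
  exact coinExp_affine_mul (hashPrime n d)
    (digits_ne hd (by omega) (hu.trans hu'.symm) h)
    (fun z => if (z.val : ℝ) * (b₁ * m - l) < hashPrime n d then 1 else 0)
    (fun z => if (z.val : ℝ) * (b₁ * m - l) < hashPrime n d then 1 else 0)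

theorem selProb_nonneg (n d : ℕ) (b₁ : ℝ) (m l : ℕ) : 0 ≤ selProb n d b₁ m l :=
  div_nonneg (Finset.sum_nonneg fun z _ => by split_ifs <;> norm_num) (Nat.cast_nonneg _)

theorem selProb_eq_card (n d : ℕ) (b₁ : ℝ) (m l : ℕ) : open Classical in
    selProb n d b₁ m l = (((Finset.range (hashPrime n d)).filter
      fun h : ℕ => (h : ℝ) * (b₁ * m - l) < hashPrime n d).card : ℝ) / hashPrime n d := by
  classical
  rw [selProb]
  congr 1
  rw [← sum_fin_eq_sum_zmod, Finset.card_filter, Finset.sum_range]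
  push_cast
  refine Finset.sum_congr rfl fun a _ => ?_
  rw [ZMod.val_natCast, Nat.mod_eq_of_lt a.2]

theorem selProb_le {n d : ℕ} {b₁ : ℝ} {m l : ℕ} (h : 0 < b₁ * m - l) :
    selProb n d b₁ m l ≤ 1 / (b₁ * m - l) + 1 / hashPrime n d := by
  classical
  have hP : (0 : ℝ) < hashPrime n d := by exact_mod_cast (hashPrime_prime n d).pos
  rw [selProb_eq_card, div_le_iff₀ hP, add_mul, div_mul_cancel₀ _ hP.ne']
  have h1 : (Finset.range (hashPrime n d)).filter
      (fun k : ℕ => (k : ℝ) * (b₁ * m - l) < hashPrime n d) ⊆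
      Finset.range ⌈(hashPrime n d : ℝ) / (b₁ * m - l)⌉₊ := by
    intro k hk
    rw [Finset.mem_range, Nat.lt_ceil, lt_div_iff₀ h]
    exact (Finset.mem_filter.1 hk).2
  have h2 : (((Finset.range (hashPrime n d)).filter
      fun k : ℕ => (k : ℝ) * (b₁ * m - l) < hashPrime n d).card : ℝ) ≤
      ⌈(hashPrime n d : ℝ) / (b₁ * m - l)⌉₊ := by
    exact_mod_cast (Finset.card_le_card h1).trans (Finset.card_range _).le
  have h3 := Nat.ceil_lt_add_one (show (0 : ℝ) ≤ (hashPrime n d : ℝ) / (b₁ * m - l) by positivity)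
  rw [div_mul_eq_mul_div, one_mul]
  linarith

theorem le_selProb {n d : ℕ} {b₁ : ℝ} {m l : ℕ} (h : 1 ≤ b₁ * m - l) :
    1 / (b₁ * m - l) ≤ selProb n d b₁ m l := by
  classical
  have hP : (0 : ℝ) < hashPrime n d := by exact_mod_cast (hashPrime_prime n d).pos
  have h0 : 0 < b₁ * m - l := by linarith
  rw [selProb_eq_card, le_div_iff₀ hP]
  have h1 : Finset.range ⌈(hashPrime n d : ℝ) / (b₁ * m - l)⌉₊ ⊆
      (Finset.range (hashPrime n d)).filter
        (fun k : ℕ => (k : ℝ) * (b₁ * m - l) < hashPrime n d) := by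
    intro k hk
    rw [Finset.mem_range, Nat.lt_ceil, lt_div_iff₀ h0] at hk
    refine Finset.mem_filter.2 ⟨Finset.mem_range.2 ?_, hk⟩
    have : (k : ℝ) * 1 ≤ k * (b₁ * m - l) := mul_le_mul_of_nonneg_left h (Nat.cast_nonneg _)
    have : (k : ℝ) < hashPrime n d := by linarith
    exact_mod_cast this
  have h2 : (⌈(hashPrime n d : ℝ) / (b₁ * m - l)⌉₊ : ℝ) ≤
      ((Finset.range (hashPrime n d)).filter
        fun k : ℕ => (k : ℝ) * (b₁ * m - l) < hashPrime n d).card := by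
    exact_mod_cast (Finset.card_range _).symm.le.trans (Finset.card_le_card h1)
  have h3 := Nat.le_ceil ((hashPrime n d : ℝ) / (b₁ * m - l))
  rw [div_mul_eq_mul_div, one_mul]
  linarith

end Hash

/-! ### Expected sums over the paths of a fixed vector -/

section Levels

variable {n d : ℕ}

instance : Nonempty (Coeffs n d) := ⟨fun _ _ => ⟨0, (hashPrime_prime n d).pos⟩⟩

theorem coinExp_list_sum {Ω ι : Type} [Fintype Ω] (l : List ι) (f : ι → Ω → ℝ) :
    coinExp (fun ω => (l.map fun i => f i ω).sum) = (l.map fun i => coinExp (f i)).sum := by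
  induction l with
  | nil => simp [coinExp]
  | cons i l ih => simp only [List.map_cons, List.sum_cons, coinExp_add, ih]

theorem sum_map_filter {ι : Type} (P : ι → Prop) [DecidablePred P] (l : List ι) (g : ι → ℝ) :
    ((l.filter fun i => P i).map g).sum = (l.map fun i => if P i then g i else 0).sum := by
  induction l with
  | nil => rfl
  | cons i l ih => by_cases h : P i <;> simp [h, ih]

theorem hash_update_of_ne (c : Coeffs n d) {l : Fin (depth n)}
    (a : Fin (depth n + 1) → Fin (hashPrime n d)) {u : Path d} (hu : u.length - 1 ≠ l) :
    hash (Function.update c l a) u = hash c u := by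
  have : coef (Function.update c l a) (u.length - 1) = coef c (u.length - 1) := by
    funext t
    unfold coef
    split_ifs with h
    · rw [Function.update_of_ne]
      exact fun h' => hu (by rw [← h'])
    · rfl
  rw [hash, hash, this]

theorem children_update (b₁ : ℝ) (c : Coeffs n d) (x : Vec d) (m : ℕ) {l : Fin (depth n)}
    (a : Fin (depth n + 1) → Fin (hashPrime n d)) {v : Path d} (hv : v.length ≠ l) :
    children b₁ (Function.update c l a) x m v = children b₁ c x m v := by
  refine List.filter_congr fun u hu => ?_
  obtain ⟨i, -, rfl⟩ := List.mem_map.1 hu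
  have h : hash (Function.update c l a) (v ++ [i]) = hash c (v ++ [i]) :=
    hash_update_of_ne c a (by simpa using hv)
  have h' : Selected b₁ (Function.update c l a) m (v ++ [i]) ↔ Selected b₁ c m (v ++ [i]) := by
    rw [Selected, Selected, h]
  exact decide_eq_decide.2 h'

/-- The first levels depend on the first rows of the coefficients only. -/
theorem front_update (p : Fin d → ℝ) (b₁ : ℝ) (c : Coeffs n d) (x : Vec d) (m : ℕ)
    {l : Fin (depth n)} (a : Fin (depth n + 1) → Fin (hashPrime n d)) {s : ℕ} (hs : s ≤ l) :
    front p b₁ (Function.update c l a) x m s = front p b₁ c x m s := by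
  induction s with
  | zero => rfl
  | succ s ih =>
    rw [front, front, ih (by omega)]
    congr 1
    refine List.flatMap_congr fun v hv => children_update b₁ c x m a ?_
    rw [(isPathIn_of_mem_front hv).1]
    omega

theorem done_update (p : Fin d → ℝ) (b₁ : ℝ) (c : Coeffs n d) (x : Vec d) (m : ℕ)
    {l : Fin (depth n)} (a : Fin (depth n + 1) → Fin (hashPrime n d)) {s : ℕ} (hs : s < l) :
    done p b₁ (Function.update c l a) x m s = done p b₁ c x m s := by
  rw [done, done, front_update p b₁ c x m a hs.le]
  congr 1
  refine List.flatMap_congr fun v hv => children_update b₁ c x m a ?_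
  rw [(isPathIn_of_mem_front hv).1]
  omega

/-- The one-step extensions of the listed paths by elements of `x`, chosen or not. -/
def candidates (x : Vec d) (F : List (Path d)) : List (Path d) :=
  F.flatMap fun v => (freshCoords x v).map fun i => v ++ [i]

theorem length_of_mem_candidates {x : Vec d} {F : List (Path d)} {l : ℕ}
    (hF : ∀ v ∈ F, v.length = l) {u : Path d} (hu : u ∈ candidates x F) : u.length = l + 1 := by
  simp only [candidates, List.mem_flatMap, List.mem_map] at hu
  obtain ⟨v, hv, i, -, rfl⟩ := hu
  simp [hF v hv]

theorem sum_candidates (x : Vec d) (F : List (Path d)) (g : Path d → ℝ) :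
    ((candidates x F).map g).sum =
      (F.map fun v => ((freshCoords x v).map fun i => g (v ++ [i])).sum).sum := by
  induction F with
  | nil => rfl
  | cons v F ih =>
    rw [candidates] at ih
    simp [candidates, ih, Function.comp_def]

theorem sum_freshCoords (x : Vec d) (v : Path d) (g : Fin d → ℝ) :
    ((freshCoords x v).map g).sum = ∑ i, if x i = true ∧ i ∉ v then g i else 0 := by
  rw [freshCoords, sum_map_filter, Fin.sum_univ_def]

open Classical in
/-- The row of coefficients that decides about extensions of paths with `l` entries is independent
of these paths. -/
theorem coinExp_next (p : Fin d → ℝ) (b₁ : ℝ) (x : Vec d) (m : ℕ) {l : ℕ} (hl : l < depth n)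
    (g : Path d → ℝ) :
    coinExp (fun c : Coeffs n d =>
      (((front p b₁ c x m l).flatMap (children b₁ c x m)).map g).sum) =
    selProb n d b₁ m l *
      coinExp fun c : Coeffs n d => ((candidates x (front p b₁ c x m l)).map g).sum := by
  rw [coinExp_update ⟨l, hl⟩, ← coinExp_const_mul]
  congr 1
  funext c
  simp only [flatMap_children, front_update p b₁ c x m (l := ⟨l, hl⟩) _ le_rfl, sum_map_filter]
  rw [← candidates, coinExp_list_sum, ← List.sum_map_mul_left]
  congr 1
  refine List.map_congr_left fun u hu => ?_
  have hlen := length_of_mem_candidates (fun v hv => (isPathIn_of_mem_front hv).1) hu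
  rw [← coinExp_selected b₁ c m hl hlen, ← coinExp_mul_const]
  congr 1
  funext a
  split_ifs <;> simp

/-- The sum of `g` over all sequences of `l` coordinates, distinct or not, built up by appending
entries. -/
def pathSum : ℕ → (Path d → ℝ) → ℝ
  | 0, g => g []
  | l + 1, g => pathSum l fun v => ∑ i, g (v ++ [i])

theorem pathSum_mono {l : ℕ} {g h : Path d → ℝ} (H : ∀ v, v.length = l → g v ≤ h v) :
    pathSum l g ≤ pathSum l h := by
  induction l generalizing g h with
  | zero => exact H [] rfl
  | succ l ih => exact ih fun v hv => Finset.sum_le_sum fun i _ => H _ (by simp [hv])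

theorem pathSum_nonneg {l : ℕ} {g : Path d → ℝ} (H : ∀ v, 0 ≤ g v) : 0 ≤ pathSum l g := by
  induction l generalizing g with
  | zero => exact H []
  | succ l ih => exact ih fun v => Finset.sum_nonneg fun i _ => H _

theorem pathSum_const_mul (l : ℕ) (a : ℝ) (g : Path d → ℝ) :
    pathSum l (fun v => a * g v) = a * pathSum l g := by
  induction l generalizing g with
  | zero => rfl
  | succ l ih => simp only [pathSum, ← Finset.mul_sum, ih]

theorem pathSum_sum {ι : Type*} (s : Finset ι) (l : ℕ) (g : ι → Path d → ℝ) :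
    pathSum l (fun v => ∑ j ∈ s, g j v) = ∑ j ∈ s, pathSum l (g j) := by
  induction l generalizing g with
  | zero => rfl
  | succ l ih =>
    simp only [pathSum]
    rw [← ih]
    congr 1
    funext v
    exact Finset.sum_comm

theorem pathSum_prod (l : ℕ) (a : Fin d → ℝ) :
    pathSum l (fun v => (v.map a).prod) = (∑ i, a i) ^ l := by
  induction l with
  | zero => simp [pathSum]
  | succ l ih =>
    simp only [pathSum, List.map_append, List.prod_append, List.map_cons, List.map_nil,
      List.prod_singleton, ← Finset.mul_sum]
    simp only [mul_comm _ (∑ i, a i), pathSum_const_mul, ih]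
    rw [pow_succ, mul_comm]

/-- The probability that a sequence of `l` coordinates passes all hash tests. -/
noncomputable def pathProb (n d : ℕ) (b₁ : ℝ) (m l : ℕ) : ℝ :=
  ∏ j ∈ Finset.range l, selProb n d b₁ m j

theorem pathProb_nonneg (n d : ℕ) (b₁ : ℝ) (m l : ℕ) : 0 ≤ pathProb n d b₁ m l :=
  Finset.prod_nonneg fun _ _ => selProb_nonneg _ _ _ _ _

theorem not_finished_nil (hn : 2 ≤ n) (p : Fin d → ℝ) : ¬ Finished n p [] := by
  have : (1 : ℝ) < n := by exact_mod_cast hn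
  simp only [Finished, List.map_nil, List.prod_nil, not_le]
  rw [div_lt_one (by linarith)]
  exact this

open Classical in
/-- A sequence of `l` coordinates is an unfinished path with probability at most `pathProb`. -/
theorem coinExp_sum_front_le (hn : 2 ≤ n) (p : Fin d → ℝ) (b₁ : ℝ) (x : Vec d) (m : ℕ) {l : ℕ}
    (hl : l ≤ depth n) (g : Path d → ℝ) (hg : ∀ v, 0 ≤ g v) :
    coinExp (fun c : Coeffs n d => ((front p b₁ c x m l).map g).sum) ≤
      pathProb n d b₁ m l * pathSum l fun v =>
        if IsPathIn x l v ∧ ¬ Finished n p v then g v else 0 := by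
  induction l generalizing g with
  | zero =>
    have : IsPathIn x 0 ([] : Path d) := ⟨rfl, List.nodup_nil, by simp⟩
    simp [front, coinExp_const, pathProb, pathSum, this, not_finished_nil hn p]
  | succ l ih =>
    simp only [front, sum_map_filter]
    rw [coinExp_next p b₁ x m hl, pathProb, Finset.prod_range_succ, mul_comm _ (selProb _ _ _ _ _),
      mul_assoc]
    refine mul_le_mul_of_nonneg_left ?_ (selProb_nonneg _ _ _ _ _)
    simp only [sum_candidates, sum_freshCoords]
    refine (ih (by omega) _ fun v => Finset.sum_nonneg fun i _ => ?_).trans ?_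
    · split_ifs <;> simp [hg]
    · refine mul_le_mul_of_nonneg_left ?_ (pathProb_nonneg _ _ _ _ _)
      rw [pathSum]
      refine pathSum_mono fun v _ => ?_
      split_ifs with hv
      · refine Finset.sum_le_sum fun i _ => ?_
        by_cases h1 : x i = true ∧ i ∉ v
        · simp [h1, hv.1.snoc h1.1 h1.2]
        · rw [if_neg h1]
          split_ifs <;> simp [hg]
      · exact Finset.sum_nonneg fun i _ => by split_ifs <;> simp [hg]

open Classical in
/-- A sequence of `l + 1` coordinates is a finished path with probability at most `pathProb`. -/
theorem coinExp_sum_done_le (hn : 2 ≤ n) (p : Fin d → ℝ) (b₁ : ℝ) (x : Vec d) (m : ℕ) {l : ℕ}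
    (hl : l < depth n) (g : Path d → ℝ) (hg : ∀ v, 0 ≤ g v) :
    coinExp (fun c : Coeffs n d => ((done p b₁ c x m l).map g).sum) ≤
      pathProb n d b₁ m (l + 1) * pathSum (l + 1) fun v =>
        if IsPathIn x (l + 1) v ∧ Finished n p v then g v else 0 := by
  simp only [done, sum_map_filter]
  rw [coinExp_next p b₁ x m hl, pathProb, Finset.prod_range_succ, mul_comm _ (selProb _ _ _ _ _),
    mul_assoc]
  refine mul_le_mul_of_nonneg_left ?_ (selProb_nonneg _ _ _ _ _)
  simp only [sum_candidates, sum_freshCoords]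
  refine (coinExp_sum_front_le hn p b₁ x m hl.le _ fun v => Finset.sum_nonneg fun i _ => ?_).trans
    ?_
  · split_ifs <;> simp [hg]
  · refine mul_le_mul_of_nonneg_left ?_ (pathProb_nonneg _ _ _ _ _)
    rw [pathSum]
    refine pathSum_mono fun v _ => ?_
    split_ifs with hv
    · refine Finset.sum_le_sum fun i _ => ?_
      by_cases h1 : x i = true ∧ i ∉ v
      · simp [h1, hv.1.snoc h1.1 h1.2]
      · rw [if_neg h1]
        split_ifs <;> simp [hg]
    · exact Finset.sum_nonneg fun i _ => by split_ifs <;> simp [hg]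

theorem length_freshCoords (x : Vec d) {l : ℕ} {v : Path d} (hv : IsPathIn x l v) :
    (freshCoords x v).length + l = size x := by
  obtain ⟨h1, h2, h3⟩ := hv
  have h4 : (freshCoords x v).Nodup := (List.nodup_finRange d).filter _
  rw [← List.toFinset_card_of_nodup h4, ← h1, ← List.toFinset_card_of_nodup h2,
    ← Finset.card_union_of_disjoint, size]
  · congr 1
    ext i
    simp only [freshCoords, Finset.mem_union, List.mem_toFinset, List.mem_filter,
      List.mem_finRange, true_and, decide_eq_true_eq, Finset.mem_filter, Finset.mem_univ]
    constructor
    · rintro (h | h)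
      · exact h.1
      · exact h3 i h
    · intro h
      by_cases hi : i ∈ v
      · exact Or.inr hi
      · exact Or.inl ⟨h, hi⟩
  · rw [Finset.disjoint_left]
    intro i hi
    simp only [freshCoords, List.mem_toFinset, List.mem_filter, decide_eq_true_eq] at hi ⊢
    exact hi.2.2

theorem length_candidates_front (p : Fin d → ℝ) (b₁ : ℝ) (c : Coeffs n d) (x : Vec d) (m l : ℕ) :
    ((candidates x (front p b₁ c x m l)).length : ℝ) =
      ((size x : ℝ) - l) * (front p b₁ c x m l).length := by
  have H : ∀ F : List (Path d), (∀ v ∈ F, IsPathIn x l v) →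
      ((candidates x F).length : ℝ) = ((size x : ℝ) - l) * F.length := by
    intro F hF
    induction F with
    | nil => simp [candidates]
    | cons v F ih =>
      have h1 := ih fun w hw => hF w (by simp [hw])
      have h2 := length_freshCoords x (hF v (by simp))
      rw [candidates] at h1
      simp only [candidates, List.flatMap_cons, List.length_append, List.length_map,
        List.length_cons, Nat.cast_add, h1, ← h2]
      push_cast
      ring
  exact H _ fun v hv => isPathIn_of_mem_front hv

theorem coinExp_length_next (p : Fin d → ℝ) (b₁ : ℝ) (x : Vec d) (m : ℕ) {l : ℕ}
    (hl : l < depth n) :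
    coinExp (fun c : Coeffs n d =>
      (((front p b₁ c x m l).flatMap (children b₁ c x m)).length : ℝ)) =
    selProb n d b₁ m l * (((size x : ℝ) - l) *
      coinExp fun c : Coeffs n d => ((front p b₁ c x m l).length : ℝ)) := by
  have h := coinExp_next p b₁ x m hl fun _ => 1
  simp only [List.map_const', List.sum_replicate, nsmul_eq_mul, mul_one,
    length_candidates_front, coinExp_const_mul] at h
  exact h

theorem coinExp_length_done_le (p : Fin d → ℝ) (b₁ : ℝ) (x : Vec d) (m : ℕ) {l : ℕ}
    (hl : l < depth n) :
    coinExp (fun c : Coeffs n d => ((done p b₁ c x m l).length : ℝ)) ≤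
    selProb n d b₁ m l * (size x *
      coinExp fun c : Coeffs n d => ((front p b₁ c x m l).length : ℝ)) := by
  refine (coinExp_mono fun c => ?_).trans ((coinExp_length_next p b₁ x m hl).le.trans ?_)
  · exact_mod_cast List.length_filter_le _ _
  · refine mul_le_mul_of_nonneg_left (mul_le_mul_of_nonneg_right ?_ ?_) (selProb_nonneg _ _ _ _ _)
    · linarith [(Nat.cast_nonneg l : (0 : ℝ) ≤ l)]
    · exact coinExp_nonneg fun c => Nat.cast_nonneg _

end Levels

/-! ### The success probability -/

section Success

variable {n d : ℕ}

open Classical in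
/-- Chebyshev-type bound: by pairwise independence, the number of selected paths among given paths
has variance at most its mean. -/
theorem coinExp_variance_le (hn : 1 ≤ n) (b₁ : ℝ) (c : Coeffs n d) (m : ℕ) {l : ℕ}
    (hl : l < depth n) (U : Finset (Path d)) (hU : ∀ u ∈ U, u.length = l + 1) :
    coinExp (fun a => ((∑ u ∈ U, if Selected b₁ (Function.update c ⟨l, hl⟩ a) m u then (1 : ℝ)
      else 0) - selProb n d b₁ m l * U.card) ^ 2) ≤ selProb n d b₁ m l * U.card := by
  set π := selProb n d b₁ m l with hπ
  have : Nonempty (Fin (hashPrime n d)) := ⟨⟨0, (hashPrime_prime n d).pos⟩⟩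
  set X : Path d → (Fin (depth n + 1) → Fin (hashPrime n d)) → ℝ := fun u a =>
    if Selected b₁ (Function.update c ⟨l, hl⟩ a) m u then (1 : ℝ) else 0 with hX
  have hE : ∀ u ∈ U, coinExp (X u) = π := fun u hu => coinExp_selected b₁ c m hl (hU u hu)
  have hXX : ∀ u, ∀ a, X u a * X u a = X u a := by
    intro u a
    simp only [hX]
    split_ifs <;> simp
  have hexp : ∀ u ∈ U, ∀ u' ∈ U, coinExp (fun a => (X u a - π) * (X u' a - π)) =
      coinExp (fun a => X u a * X u' a) - π ^ 2 := by
    intro u hu u' hu'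
    have : ∀ a, (X u a - π) * (X u' a - π) =
        X u a * X u' a + ((-π) * X u a + ((-π) * X u' a + π ^ 2)) := by intro a; ring
    simp only [this, coinExp_add, coinExp_const_mul, coinExp_const, hE u hu, hE u' hu']
    ring
  have h1 : ∀ a, ((∑ u ∈ U, X u a) - π * U.card) ^ 2 =
      ∑ u ∈ U, ∑ u' ∈ U, (X u a - π) * (X u' a - π) := by
    intro a
    rw [← Finset.sum_mul_sum, Finset.sum_sub_distrib]
    simp
    ring
  change coinExp (fun a => ((∑ u ∈ U, X u a) - π * U.card) ^ 2) ≤ _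
  simp only [h1, coinExp_sum]
  calc ∑ u ∈ U, ∑ u' ∈ U, coinExp (fun a => (X u a - π) * (X u' a - π))
      ≤ ∑ u ∈ U, ∑ u' ∈ U, if u = u' then π else 0 := by
        refine Finset.sum_le_sum fun u hu => Finset.sum_le_sum fun u' hu' => ?_
        rw [hexp u hu u' hu']
        split_ifs with h
        · subst h
          simp only [hXX, hE u hu]
          nlinarith [sq_nonneg π]
        · have := coinExp_selected_mul b₁ c m hl hn (hU u hu) (hU u' hu') h
          simp only [hX]
          rw [this, hπ, sub_self]
    _ = π * U.card := by
        simp [mul_comm]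

/-- The weight of a path with `l` entries: the reciprocal of the expected number of chosen paths
with `l` entries if no path were ever finished. -/
noncomputable def pathWeight (n d : ℕ) (b₁ : ℝ) (y : Vec d) (m l : ℕ) : ℝ :=
  ∏ j ∈ Finset.range l, 1 / (selProb n d b₁ m j * ((size y : ℝ) - j))

/-- The total weight of the unfinished paths after `l` levels and of all paths finished so far. -/
noncomputable def totalWeight (p : Fin d → ℝ) (b₁ : ℝ) (y : Vec d) (m l : ℕ) (c : Coeffs n d) :
    ℝ :=
  pathWeight n d b₁ y m l * (front p b₁ c y m l).length +
    ∑ s ∈ Finset.range l, pathWeight n d b₁ y m (s + 1) * (done p b₁ c y m s).length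

theorem length_filter_add (P : Path d → Prop) [DecidablePred P] (F : List (Path d)) :
    (F.filter fun v => ¬ P v).length + (F.filter fun v => P v).length = F.length := by
  induction F with
  | nil => rfl
  | cons v F ih =>
    by_cases h : P v <;> simp [h] at ih ⊢ <;> omega

theorem totalWeight_succ (p : Fin d → ℝ) (b₁ : ℝ) (y : Vec d) (m l : ℕ) (c : Coeffs n d) :
    totalWeight p b₁ y m (l + 1) c = totalWeight p b₁ y m l c +
      (pathWeight n d b₁ y m (l + 1) *
        ((front p b₁ c y m l).flatMap (children b₁ c y m)).length -
        pathWeight n d b₁ y m l * (front p b₁ c y m l).length) := by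
  classical
  have h := length_filter_add (Finished n p)
    ((front p b₁ c y m l).flatMap (children b₁ c y m))
  rw [totalWeight, totalWeight, Finset.sum_range_succ, ← h, front, done]
  push_cast
  ring

theorem totalWeight_update (p : Fin d → ℝ) (b₁ : ℝ) (y : Vec d) (m : ℕ) {l : ℕ}
    (hl : l < depth n) (c : Coeffs n d) (a : Fin (depth n + 1) → Fin (hashPrime n d)) :
    totalWeight p b₁ y m l (Function.update c ⟨l, hl⟩ a) = totalWeight p b₁ y m l c := by
  rw [totalWeight, totalWeight, front_update p b₁ c y m (l := ⟨l, hl⟩) a le_rfl]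
  congr 1
  refine Finset.sum_congr rfl fun s hs => ?_
  rw [done_update p b₁ c y m (l := ⟨l, hl⟩) a (Finset.mem_range.1 hs)]

section Critical

variable {p : Fin d → ℝ} {b₁ : ℝ} {y : Vec d} {m : ℕ}

theorem one_le_sub (hm : (depth n : ℝ) ≤ b₁ * m) {l : ℕ} (hl : l < depth n) : 1 ≤ b₁ * m - l := by
  have : (l : ℝ) + 1 ≤ depth n := by exact_mod_cast hl
  linarith

/-- On average every path has at least one chosen extension. -/
theorem one_le_selProb_mul (hm : (depth n : ℝ) ≤ b₁ * m)
    (hy : b₁ * m ≤ size y) {l : ℕ} (hl : l < depth n) :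
    1 ≤ selProb n d b₁ m l * ((size y : ℝ) - l) := by
  have h1 := one_le_sub hm hl
  have h2 := le_selProb (n := n) (d := d) h1
  calc (1 : ℝ) = 1 / (b₁ * m - l) * (b₁ * m - l) := by
        rw [div_mul_cancel₀]
        linarith
    _ ≤ _ := by
        refine mul_le_mul h2 (by linarith) (by linarith) (selProb_nonneg _ _ _ _ _)

theorem pathWeight_nonneg (hm : (depth n : ℝ) ≤ b₁ * m)
    (hy : b₁ * m ≤ size y) {l : ℕ} (hl : l ≤ depth n) : 0 ≤ pathWeight n d b₁ y m l := by
  refine Finset.prod_nonneg fun j hj => ?_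
  have := one_le_selProb_mul (n := n) (d := d) hm hy
    (show j < depth n by have := Finset.mem_range.1 hj; omega)
  positivity

theorem pathWeight_le_one (hm : (depth n : ℝ) ≤ b₁ * m)
    (hy : b₁ * m ≤ size y) {l : ℕ} (hl : l ≤ depth n) : pathWeight n d b₁ y m l ≤ 1 := by
  refine Finset.prod_le_one (fun j hj => ?_) fun j hj => ?_
  all_goals
    have := one_le_selProb_mul (n := n) (d := d) hm hy
      (show j < depth n by have := Finset.mem_range.1 hj; omega)
  · positivity
  · exact div_le_one_of_le₀ this (by linarith)

theorem pathWeight_succ (hm : (depth n : ℝ) ≤ b₁ * m)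
    (hy : b₁ * m ≤ size y) {l : ℕ} (hl : l < depth n) :
    pathWeight n d b₁ y m (l + 1) * (selProb n d b₁ m l * ((size y : ℝ) - l)) =
      pathWeight n d b₁ y m l := by
  have := one_le_selProb_mul (n := n) (d := d) hm hy hl
  rw [pathWeight, Finset.prod_range_succ, mul_assoc, div_mul_cancel₀ _ (by linarith), mul_one,
    ← pathWeight]

/-- The total weight is a martingale. -/
theorem coinExp_totalWeight (hm : (depth n : ℝ) ≤ b₁ * m)
    (hy : b₁ * m ≤ size y) {l : ℕ} (hl : l ≤ depth n) :
    coinExp (totalWeight (n := n) p b₁ y m l) = 1 := by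
  induction l with
  | zero =>
    have : totalWeight (n := n) p b₁ y m 0 = fun _ => 1 := by
      funext c
      simp [totalWeight, pathWeight, front]
    rw [this, coinExp_const]
  | succ l ih =>
    have h1 : totalWeight (n := n) p b₁ y m (l + 1) = fun c => totalWeight p b₁ y m l c +
      (pathWeight n d b₁ y m (l + 1) *
        ((front p b₁ c y m l).flatMap (children b₁ c y m)).length +
        (-pathWeight n d b₁ y m l) * (front p b₁ c y m l).length) := by
      funext c
      rw [totalWeight_succ]
      ring
    rw [h1, coinExp_add, coinExp_add, coinExp_const_mul, coinExp_const_mul, ih (by omega),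
      coinExp_length_next p b₁ y m (by omega), ← pathWeight_succ hm hy (by omega : l < depth n)]
    ring

/-- Each level increases the second moment by at most the expected total weight, which is `1`. -/
theorem coinExp_totalWeight_sq_le (hm : (depth n : ℝ) ≤ b₁ * m)
    (hy : b₁ * m ≤ size y) (hn : 1 ≤ n) {l : ℕ} (hl : l ≤ depth n) :
    coinExp (fun c : Coeffs n d => totalWeight p b₁ y m l c ^ 2) ≤ l + 1 := by
  classical
  induction l with
  | zero =>
    have : ∀ c : Coeffs n d, totalWeight p b₁ y m 0 c = 1 := by
      intro c
      simp [totalWeight, pathWeight, front]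
    simp [this, coinExp_const]
  | succ l ih =>
    have hl' : l < depth n := by omega
    have : Nonempty (Fin (hashPrime n d)) := ⟨⟨0, (hashPrime_prime n d).pos⟩⟩
    have hstep : ∀ c : Coeffs n d, coinExp (fun a =>
        totalWeight p b₁ y m (l + 1) (Function.update c ⟨l, hl'⟩ a) ^ 2) ≤
        totalWeight p b₁ y m l c ^ 2 + totalWeight p b₁ y m l c := by
      intro c
      set W := totalWeight p b₁ y m l c with hW
      set w := pathWeight n d b₁ y m (l + 1) with hw
      set π := selProb n d b₁ m l with hπ
      set U := (candidates y (front p b₁ c y m l)).toFinset with hU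
      have hnd : (candidates y (front p b₁ c y m l)).Nodup :=
        nodup_flatMap_freshCoords y (nodup_front p b₁ c y m l)
      have hlen : ∀ u ∈ U, u.length = l + 1 := fun u hu =>
        length_of_mem_candidates (fun v hv => (isPathIn_of_mem_front hv).1)
          (List.mem_toFinset.1 hu)
      set X : Path d → (Fin (depth n + 1) → Fin (hashPrime n d)) → ℝ := fun u a =>
        if Selected b₁ (Function.update c ⟨l, hl'⟩ a) m u then (1 : ℝ) else 0 with hX
      have hcard : (U.card : ℝ) = ((size y : ℝ) - l) * (front p b₁ c y m l).length := by
        rw [hU, List.toFinset_card_of_nodup hnd, length_candidates_front]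
      have hmean : w * (π * U.card) =
          pathWeight n d b₁ y m l * (front p b₁ c y m l).length := by
        rw [hcard, ← pathWeight_succ hm hy hl']
        ring
      have hval : ∀ a, totalWeight p b₁ y m (l + 1) (Function.update c ⟨l, hl'⟩ a) =
          W + w * ((∑ u ∈ U, X u a) - π * U.card) := by
        intro a
        have h1 : ((((front p b₁ c y m l).flatMap
            (children b₁ (Function.update c ⟨l, hl'⟩ a) y m)).length : ℕ) : ℝ) =
            ∑ u ∈ U, X u a := by
          rw [flatMap_children, hU, List.sum_toFinset _ hnd, ← sum_map_filter]
          simp [candidates]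
        rw [totalWeight_succ, totalWeight_update p b₁ y m hl' c a,
          front_update p b₁ c y m (l := ⟨l, hl'⟩) a le_rfl, h1, ← hmean]
        ring
      have hE : coinExp (fun a => (∑ u ∈ U, X u a) - π * U.card) = 0 := by
        simp only [sub_eq_add_neg]
        rw [coinExp_add, coinExp_sum, coinExp_const, Finset.sum_congr rfl fun u hu =>
          coinExp_selected b₁ c m hl' (hlen u hu)]
        simp [hπ, mul_comm]
      have hV := coinExp_variance_le hn b₁ c m hl' U hlen
      have hexp : ∀ a, totalWeight p b₁ y m (l + 1) (Function.update c ⟨l, hl'⟩ a) ^ 2 =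
          W ^ 2 + (2 * W * w * ((∑ u ∈ U, X u a) - π * U.card) +
            w ^ 2 * ((∑ u ∈ U, X u a) - π * U.card) ^ 2) := by
        intro a
        rw [hval]
        ring
      simp only [hexp]
      rw [coinExp_add, coinExp_const, coinExp_add, coinExp_const_mul, coinExp_const_mul, hE]
      have hw0 : 0 ≤ w := pathWeight_nonneg hm hy hl
      have hw1 : w ≤ 1 := pathWeight_le_one hm hy hl
      have hπ0 : 0 ≤ π * U.card := mul_nonneg (selProb_nonneg _ _ _ _ _) (Nat.cast_nonneg _)
      have h2 : w ^ 2 * coinExp (fun a => ((∑ u ∈ U, X u a) - π * U.card) ^ 2) ≤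
          w * (π * U.card) := by
        calc _ ≤ w ^ 2 * (π * U.card) := mul_le_mul_of_nonneg_left hV (sq_nonneg w)
          _ ≤ w * (π * U.card) := by
            refine mul_le_mul_of_nonneg_right ?_ hπ0
            nlinarith
      have h3 : w * (π * U.card) ≤ W := by
        rw [hmean, hW, totalWeight]
        refine le_add_of_nonneg_right (Finset.sum_nonneg fun s hs =>
          mul_nonneg (pathWeight_nonneg hm hy ?_) (Nat.cast_nonneg _))
        have := Finset.mem_range.1 hs
        omega
      linarith
    rw [coinExp_update ⟨l, hl'⟩]
    refine (coinExp_mono hstep).trans ?_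
    rw [coinExp_add]
    have h1 := ih hl'.le
    have h2 := coinExp_totalWeight (p := p) hm hy hl'.le
    push_cast
    linarith

/-- As all probabilities are below `1 / 2`, every path is finished after `⌈log₂ n⌉` levels. -/
theorem finished_of_length {p : Fin d → ℝ} (hn : 1 ≤ n) (hp : ∀ i, 0 ≤ p i ∧ p i < 1 / 2)
    {v : Path d} (hv : depth n ≤ v.length) : Finished n p v := by
  have h1 : (v.map p).prod ≤ (1 / 2) ^ v.length := by
    clear hv
    induction v with
    | nil => simp
    | cons i v ih =>
      have h0 : 0 ≤ (v.map p).prod := List.prod_nonneg (by simpa using fun i _ => (hp i).1)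
      rw [List.map_cons, List.prod_cons, List.length_cons, pow_succ, mul_comm]
      exact mul_le_mul ih (hp i).2.le (hp i).1 (by positivity)
  have h2 : (n : ℝ) ≤ 2 ^ v.length := by
    have : n ≤ 2 ^ v.length :=
      (Nat.le_pow_clog (by norm_num) n).trans (Nat.pow_le_pow_right (by norm_num) hv)
    exact_mod_cast this
  have h3 : (0 : ℝ) < n := by exact_mod_cast hn
  refine h1.trans ?_
  rw [one_div_pow]
  exact one_div_le_one_div_of_le h3 h2

theorem front_depth (hn : 1 ≤ n) (hp : ∀ i, 0 ≤ p i ∧ p i < 1 / 2) (c : Coeffs n d)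
    (hL : 1 ≤ depth n) : front p b₁ c y m (depth n) = [] := by
  classical
  rw [List.eq_nil_iff_forall_not_mem]
  intro v hv
  have h1 := (isPathIn_of_mem_front hv).1
  obtain ⟨L, hL⟩ := Nat.exists_eq_add_of_le' hL
  rw [hL, front, List.mem_filter, decide_eq_true_eq] at hv
  exact hv.2 (finished_of_length hn hp h1.ge)

/-- Second moment bound: some path inside `y` is finished with probability at least
`1 / (⌈log₂ n⌉ + 1)`. -/
theorem coinProb_done (hm : (depth n : ℝ) ≤ b₁ * m)
    (hy : b₁ * m ≤ size y) (hn : 2 ≤ n) (hp : ∀ i, 0 ≤ p i ∧ p i < 1 / 2) :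
    1 / ((depth n : ℝ) + 1) ≤
      coinProb fun c : Coeffs n d => ∃ l < depth n, ∃ u, u ∈ done p b₁ c y m l := by
  classical
  -- For `W ≥ 0` the indicator of `W > 0` is at least `2 t W - (t W) ^ 2`; this `t` is optimal.
  set t : ℝ := 1 / ((depth n : ℝ) + 1) with ht
  have hL : (0 : ℝ) < (depth n : ℝ) + 1 := by positivity
  have hpt : ∀ c : Coeffs n d, 2 * t * totalWeight p b₁ y m (depth n) c +
      (-t ^ 2) * totalWeight p b₁ y m (depth n) c ^ 2 ≤
      @ite ℝ (∃ l < depth n, ∃ u, u ∈ done p b₁ c y m l) (Classical.propDecidable _) 1 0 := by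
    intro c
    split_ifs with h
    · nlinarith [sq_nonneg (1 - t * totalWeight p b₁ y m (depth n) c)]
    · have : totalWeight p b₁ y m (depth n) c = 0 := by
        rw [totalWeight, front_depth (by omega) hp c (one_le_depth hn)]
        simp only [List.length_nil, Nat.cast_zero, mul_zero, zero_add]
        refine Finset.sum_eq_zero fun s hs => ?_
        have : done p b₁ c y m s = [] := by
          rw [List.eq_nil_iff_forall_not_mem]
          exact fun u hu => h ⟨s, Finset.mem_range.1 hs, u, hu⟩
        simp [this]
      simp [this]
  refine le_trans ?_ (coinExp_mono hpt)
  rw [coinExp_add, coinExp_const_mul, coinExp_const_mul]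
  have h1 := coinExp_totalWeight (n := n) (p := p) hm hy le_rfl
  have h2 := coinExp_totalWeight_sq_le (n := n) (p := p) hm hy (by omega) le_rfl
  have h3 : t ^ 2 * coinExp (fun c : Coeffs n d => totalWeight p b₁ y m (depth n) c ^ 2) ≤ t := by
    calc _ ≤ t ^ 2 * ((depth n : ℝ) + 1) := mul_le_mul_of_nonneg_left h2 (sq_nonneg t)
      _ = t := by
        rw [ht]
        field_simp
  change t ≤ 2 * t * coinExp (totalWeight (n := n) p b₁ y m (depth n)) + _
  rw [h1]
  linarith

end Critical

/-- The path process is monotone in the vector and antitone in its threshold parameter. -/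
theorem done_subset {p : Fin d → ℝ} {b₁ : ℝ} (hb : 0 ≤ b₁) (c : Coeffs n d) {x y : Vec d}
    {m m' : ℕ} (hxy : ∀ i, y i = true → x i = true) (hm : m' ≤ m) (l : ℕ) :
    done p b₁ c y m l ⊆ done p b₁ c x m' l := by
  have hch : ∀ v, children b₁ c y m v ⊆ children b₁ c x m' v := by
    intro v u hu
    rw [mem_children] at hu ⊢
    obtain ⟨i, h1, h2, h3, h4⟩ := hu
    refine ⟨i, hxy i h1, h2, h3, lt_of_le_of_lt ?_ h4⟩
    refine mul_le_mul_of_nonneg_left ?_ (Nat.cast_nonneg _)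
    have : (m' : ℝ) ≤ m := by exact_mod_cast hm
    have := mul_le_mul_of_nonneg_left this hb
    linarith
  have hnext : ∀ {F G : List (Path d)}, F ⊆ G →
      F.flatMap (children b₁ c y m) ⊆ G.flatMap (children b₁ c x m') := by
    intro F G hFG u hu
    rw [List.mem_flatMap] at hu ⊢
    obtain ⟨v, hv, hu⟩ := hu
    exact ⟨v, hFG hv, hch v hu⟩
  have hfront : front p b₁ c y m l ⊆ front p b₁ c x m' l := by
    induction l with
    | zero => exact fun _ h => h
    | succ l ih => exact List.filter_subset _ (hnext ih)
  exact List.filter_subset _ (hnext hfront)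

theorem coinProb_mono {Ω : Type} [Fintype Ω] {E E' : Ω → Prop} (h : ∀ ω, E ω → E' ω) :
    coinProb E ≤ coinProb E' := by
  classical
  refine coinExp_mono fun ω => ?_
  by_cases h1 : E ω
  · simp [h1, h ω h1]
  · simp only [h1, if_false]
    split_ifs <;> norm_num

/-- Amplification by independent repetitions. -/
theorem coinProb_exists {Ω : Type} [Fintype Ω] [Nonempty Ω] (R : ℕ) (E : Ω → Prop) :
    coinProb (fun ω : Fin R → Ω => ∃ r, E (ω r)) = 1 - (1 - coinProb E) ^ R := by
  classical
  have h1 : ∀ ω : Fin R → Ω, (if ∃ r, E (ω r) then (1 : ℝ) else 0) =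
      1 + (-1) * ∏ r, (1 + (-1) * if E (ω r) then (1 : ℝ) else 0) := by
    intro ω
    split_ifs with h
    · obtain ⟨r, hr⟩ := h
      rw [Finset.prod_eq_zero (Finset.mem_univ r) (by simp [hr])]
      simp
    · push Not at h
      simp [h]
  have h2 : ∀ f : Ω → ℝ, coinExp (fun ω : Fin R → Ω => ∏ r, f (ω r)) = coinExp f ^ R := by
    intro f
    rw [coinExp, coinExp, div_pow, Fintype.sum_pow]
    simp
  have h3 : coinProb (fun ω : Fin R → Ω => ∃ r, E (ω r)) =
      coinExp fun ω : Fin R → Ω => 1 + (-1) * ∏ r, (1 + (-1) * if E (ω r) then (1 : ℝ) else 0) := by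
    rw [coinProb]
    congr 1
    funext ω
    rw [← h1]
    congr
  rw [h3, coinExp_add, coinExp_const, coinExp_const_mul,
    h2 (fun x => 1 + (-1) * if E x then (1 : ℝ) else 0), coinExp_add, coinExp_const,
    coinExp_const_mul, coinProb]
  ring

theorem le_size_inter {b₁ : ℝ} {q x : Vec d} (h : b₁ ≤ braunBlanquet q x) :
    b₁ * (max (size q) (size x) : ℕ) ≤ size (inter q x) := by
  rcases Nat.eq_zero_or_pos (max (size q) (size x)) with h0 | h0
  · simp [h0]
  · have : (0 : ℝ) < (max (size q) (size x) : ℕ) := by exact_mod_cast h0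
    exact (le_div_iff₀ this).1 h

theorem size_inter_le_right (q x : Vec d) : size (inter q x) ≤ size x :=
  Finset.card_le_card fun i => by simp [inter]

theorem size_inter_le_left (q x : Vec d) : size (inter q x) ≤ size q :=
  Finset.card_le_card fun i => by simp +contextual [inter]

/-- A search succeeds with probability at least `1 / 2`: in each repetition, the query `q` and the
similar vector `x` share the finished paths inside `q ∩ x` for the threshold parameter `max |q|
|x|`. -/
theorem search_success {p : Fin d → ℝ} {b₁ C : ℝ} (hb₀ : 0 < b₁) (hb₁ : b₁ ≤ 1) (hn : 2 ≤ n)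
    (hp : ∀ i, 0 ≤ p i ∧ p i < 1 / 2) (hC₀ : 0 ≤ C * Real.log n)
    (hC : (depth n : ℝ) ≤ b₁ * (C * Real.log n)) {S : Fin n → Vec d} {q : Vec d}
    (hq : IsQuery b₁ C S q) :
    1 / 2 ≤ coinProb fun ω : Coins n d =>
      ∃ j, (search p b₁ C (build p b₁ C ω S).val q).val = some j ∧
        b₁ ≤ braunBlanquet q (S j) := by
  obtain ⟨hq1, j, hj⟩ := hq
  set m := max (size q) (size (S j)) with hmdef
  set y := inter q (S j) with hydef
  have hy : b₁ * m ≤ size y := le_size_inter hj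
  have hqm : (size q : ℝ) ≤ m := by exact_mod_cast le_max_left _ _
  have hbm : b₁ * (C * Real.log n) ≤ b₁ * m := mul_le_mul_of_nonneg_left (hq1.trans hqm) hb₀.le
  have hm : (depth n : ℝ) ≤ b₁ * m := hC.trans hbm
  have hlq : ¬ IsLight n b₁ C q := by
    rw [IsLight, not_lt]
    exact (mul_le_of_le_one_left hC₀ hb₁).trans hq1
  have hlx : ¬ IsLight n b₁ C (S j) := by
    rw [IsLight, not_lt]
    refine (hbm.trans hy).trans ?_
    exact_mod_cast size_inter_le_right q (S j)
  have hstep : coinProb (fun ω : Coins n d =>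
      ∃ r, ∃ l < depth n, ∃ u, u ∈ done p b₁ (ω r) y m l) ≤ coinProb fun ω : Coins n d =>
      ∃ j, (search p b₁ C (build p b₁ C ω S).val q).val = some j ∧
        b₁ ≤ braunBlanquet q (S j) := by
    refine coinProb_mono fun ω => ?_
    rintro ⟨r, l, hl, u, hu⟩
    refine search_succeeds hj ⟨r, u, mem_filters.2 ⟨hlq, l, hl, ?_⟩, mem_filters.2 ⟨hlx, l, hl, ?_⟩⟩
    · exact done_subset hb₀.le (ω r) (by simp +contextual [hydef, inter]) (le_max_left _ _) l hu
    · exact done_subset hb₀.le (ω r) (by simp [hydef, inter]) (le_max_right _ _) l hu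
  refine le_trans ?_ hstep
  rw [coinProb_exists (reps n) fun c : Coeffs n d => ∃ l < depth n, ∃ u, u ∈ done p b₁ c y m l]
  have hs := coinProb_done (n := n) hm hy hn hp
  set s := coinProb fun c : Coeffs n d => ∃ l < depth n, ∃ u, u ∈ done p b₁ c y m l
  have hL : (1 : ℝ) ≤ depth n := by exact_mod_cast one_le_depth hn
  have hs1 : s ≤ 1 := by
    have : s ≤ coinExp fun _ : Coeffs n d => (1 : ℝ) :=
      coinExp_mono fun c => by split_ifs <;> norm_num
    rwa [coinExp_const] at this
  -- Bernoulli's inequality gives `(1 + 1 / L) ^ L ≥ 2`.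
  have hB : (2 : ℝ) ≤ (1 + 1 / depth n) ^ depth n := by
    have := one_add_mul_le_pow (a := 1 / (depth n : ℝ)) (by
      have : (0 : ℝ) ≤ 1 / depth n := by positivity
      linarith) (depth n)
    rw [mul_one_div_cancel (by linarith)] at this
    linarith
  have h1 : (1 - s) ^ reps n ≤ 1 / 2 := by
    have h2 : 1 - s ≤ (1 + 1 / (depth n : ℝ))⁻¹ := by
      have : (1 + 1 / (depth n : ℝ))⁻¹ = 1 - 1 / ((depth n : ℝ) + 1) := by
        field_simp
        ring
      linarith
    have h3 : (1 - s) ^ depth n ≤ 1 / 2 := by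
      refine (pow_le_pow_left₀ (by linarith) h2 _).trans ?_
      rw [inv_pow, one_div (2 : ℝ)]
      exact inv_anti₀ (by norm_num) hB
    rw [reps, mul_comm, pow_mul]
    have h4 : 0 ≤ (1 - s) ^ depth n := pow_nonneg (by linarith) _
    nlinarith
  linarith

end Success

/-! ### Expectations over the data -/

section Data

variable {n d : ℕ} {p : Fin d → ℝ}

/-- Expectation of `F x` for a single random vector `x`. -/
noncomputable def vecExp (p : Fin d → ℝ) (F : Vec d → ℝ) : ℝ :=
  ∑ x : Vec d, (∏ i, if x i then p i else 1 - p i) * F x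

theorem bitProd_nonneg (hp : ∀ i, 0 ≤ p i ∧ p i < 1 / 2) (x : Vec d) :
    0 ≤ ∏ i, if x i then p i else 1 - p i :=
  Finset.prod_nonneg fun i _ => by
    split_ifs
    · exact (hp i).1
    · linarith [(hp i).2]

theorem vecExp_mono (hp : ∀ i, 0 ≤ p i ∧ p i < 1 / 2) {F G : Vec d → ℝ} (h : ∀ x, F x ≤ G x) :
    vecExp p F ≤ vecExp p G :=
  Finset.sum_le_sum fun x _ => mul_le_mul_of_nonneg_left (h x) (bitProd_nonneg hp x)

theorem vecExp_add (F G : Vec d → ℝ) : vecExp p (fun x => F x + G x) = vecExp p F + vecExp p G := by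
  simp [vecExp, mul_add, Finset.sum_add_distrib]

theorem vecExp_const_mul (a : ℝ) (F : Vec d → ℝ) :
    vecExp p (fun x => a * F x) = a * vecExp p F := by
  simp only [vecExp, Finset.mul_sum]
  exact Finset.sum_congr rfl fun x _ => by ring

theorem vecExp_sum {ι : Type*} (s : Finset ι) (F : ι → Vec d → ℝ) :
    vecExp p (fun x => ∑ i ∈ s, F i x) = ∑ i ∈ s, vecExp p (F i) := by
  simp only [vecExp, Finset.mul_sum]
  exact Finset.sum_comm

theorem vecExp_prod (f : Fin d → Bool → ℝ) :
    vecExp p (fun x => ∏ i, f i (x i)) = ∏ i, (p i * f i true + (1 - p i) * f i false) := by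
  have h := Finset.prod_univ_sum (fun _ : Fin d => (Finset.univ : Finset Bool))
    fun i b => (if b then p i else 1 - p i) * f i b
  simp only [Fintype.piFinset_univ, Fintype.sum_bool, if_true, Bool.false_eq_true, if_false] at h
  rw [h, vecExp]
  exact Finset.sum_congr rfl fun x _ => by rw [Finset.prod_mul_distrib]

theorem vecExp_const (a : ℝ) : vecExp p (fun _ => a) = a := by
  have h := vecExp_prod (p := p) fun _ _ => 1
  simp only [Finset.prod_const_one, mul_one, add_sub_cancel] at h
  have h2 := vecExp_const_mul (p := p) a fun _ => 1
  rw [h, mul_one] at h2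
  exact h2

theorem dataExp_mono (hp : ∀ i, 0 ≤ p i ∧ p i < 1 / 2) {F G : (Fin n → Vec d) → ℝ}
    (h : ∀ S, F S ≤ G S) : dataExp p F ≤ dataExp p G :=
  Finset.sum_le_sum fun S _ => mul_le_mul_of_nonneg_left (h S)
    (Finset.prod_nonneg fun j _ => bitProd_nonneg hp (S j))

theorem dataExp_add (F G : (Fin n → Vec d) → ℝ) :
    dataExp p (fun S => F S + G S) = dataExp p F + dataExp p G := by
  simp [dataExp, mul_add, Finset.sum_add_distrib]

theorem dataExp_const_mul (a : ℝ) (F : (Fin n → Vec d) → ℝ) :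
    dataExp p (fun S => a * F S) = a * dataExp p F := by
  simp only [dataExp, Finset.mul_sum]
  exact Finset.sum_congr rfl fun x _ => by ring

theorem dataExp_sum {ι : Type*} (s : Finset ι) (F : ι → (Fin n → Vec d) → ℝ) :
    dataExp p (fun S => ∑ i ∈ s, F i S) = ∑ i ∈ s, dataExp p (F i) := by
  simp only [dataExp, Finset.mul_sum]
  exact Finset.sum_comm

theorem dataExp_prod (F : Fin n → Vec d → ℝ) :
    dataExp p (fun S => ∏ j, F j (S j)) = ∏ j, vecExp p (F j) := by
  have h := Finset.prod_univ_sum (fun _ : Fin n => (Finset.univ : Finset (Vec d)))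
    fun j x => (∏ i, if x i then p i else 1 - p i) * F j x
  simp only [Fintype.piFinset_univ] at h
  simp only [vecExp]
  rw [h, dataExp]
  exact Finset.sum_congr rfl fun x _ => by rw [Finset.prod_mul_distrib]

theorem dataExp_eval (j : Fin n) (f : Vec d → ℝ) :
    dataExp p (fun S : Fin n → Vec d => f (S j)) = vecExp p f := by
  have h := dataExp_prod (p := p) fun (k : Fin n) x => if k = j then f x else 1
  simp only [Finset.prod_ite_eq', Finset.mem_univ, if_true] at h
  rw [h, Finset.prod_eq_single j]
  · simp
  · intro k _ hk
    simp [hk, vecExp_const]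
  · simp

theorem dataExp_const (a : ℝ) : dataExp p (fun _ : Fin n → Vec d => a) = a := by
  have h := dataExp_prod (p := p) fun (_ : Fin n) _ => 1
  simp only [Finset.prod_const_one, vecExp_const] at h
  have h2 := dataExp_const_mul (p := p) (n := n) a fun _ => 1
  rw [h, mul_one] at h2
  exact h2

/-- The probability that a random vector contains a given sequence of distinct coordinates. -/
theorem vecExp_contains {v : Path d} (hv : v.Nodup) :
    vecExp p (fun x => if ∀ i ∈ v, x i = true then 1 else 0) = (v.map p).prod := by
  have h := vecExp_prod (p := p) fun i b => if i ∈ v then (if b = true then 1 else 0) else 1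
  have h1 : ∀ x : Vec d, (∏ i, if i ∈ v then (if x i = true then (1 : ℝ) else 0) else 1) =
      if ∀ i ∈ v, x i = true then 1 else 0 := by
    intro x
    split_ifs with hx
    · refine Finset.prod_eq_one fun i _ => ?_
      by_cases hi : i ∈ v
      · simp [hi, hx i hi]
      · simp [hi]
    · push Not at hx
      obtain ⟨i, hi, hxi⟩ := hx
      exact Finset.prod_eq_zero (Finset.mem_univ i) (by simp [hi, hxi])
  simp only [h1] at h
  rw [h, ← List.prod_toFinset _ hv, ← Finset.prod_filter_mul_prod_filter_not _ (· ∈ v),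
    Finset.prod_congr rfl (g := p) (fun i hi => by simp [(Finset.mem_filter.1 hi).2]),
    Finset.prod_congr (s₁ := Finset.univ.filter fun i => i ∉ v) (g := fun _ => 1) rfl
      (fun i hi => by simp [(Finset.mem_filter.1 hi).2]), Finset.prod_const_one, mul_one]
  congr 1
  ext i
  simp

theorem list_prod_map_nonneg (hp : ∀ i, 0 ≤ p i ∧ p i < 1 / 2) (v : Path d) :
    0 ≤ (v.map p).prod :=
  List.prod_nonneg (by simpa using fun i _ => (hp i).1)

/-- Chernoff bound for the lower tail of the weight of a random vector. -/
theorem vecExp_size_lt_le (hp : ∀ i, 0 ≤ p i ∧ p i < 1 / 2) {δ : ℝ} (hδ : 0 ≤ δ) :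
    open Classical in
    vecExp p (fun x => if (size x : ℝ) < (1 - δ) * ∑ i, p i then 1 else 0) ≤
      Real.exp (-(δ ^ 2 / 2 * ∑ i, p i)) := by
  classical
  set M := ∑ i, p i with hM
  -- Exponential Markov inequality with parameter `δ`, which is optimal up to second order.
  have hpt : ∀ x : Vec d, (if (size x : ℝ) < (1 - δ) * M then (1 : ℝ) else 0) ≤
      Real.exp (δ * ((1 - δ) * M)) * ∏ i, if x i = true then Real.exp (-δ) else 1 := by
    intro x
    have h1 : (∏ i, if x i = true then Real.exp (-δ) else 1) = Real.exp (-δ * size x) := by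
      rw [Finset.prod_ite, Finset.prod_const, Finset.prod_const_one, mul_one, ← Real.exp_nat_mul,
        size, mul_comm]
    rw [h1, ← Real.exp_add]
    split_ifs with h
    · rw [Real.one_le_exp_iff]
      nlinarith
    · exact (Real.exp_pos _).le
  have h2 : Real.exp (-δ) ≤ 1 - δ + δ ^ 2 / 2 := by
    have h3 := Real.quadratic_le_exp_of_nonneg hδ
    have h4 : Real.exp (-δ) * Real.exp δ = 1 := by rw [← Real.exp_add]; simp
    have h5 := Real.exp_pos (-δ)
    have h6 : 0 ≤ 1 - δ + δ ^ 2 / 2 := by nlinarith [sq_nonneg (1 - δ)]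
    have h7 : 1 ≤ (1 - δ + δ ^ 2 / 2) * (1 + δ + δ ^ 2 / 2) := by nlinarith [sq_nonneg (δ ^ 2)]
    have h8 : (1 - δ + δ ^ 2 / 2) * (1 + δ + δ ^ 2 / 2) ≤ (1 - δ + δ ^ 2 / 2) * Real.exp δ :=
      mul_le_mul_of_nonneg_left h3 h6
    have h9 : Real.exp (-δ) * Real.exp δ ≤ (1 - δ + δ ^ 2 / 2) * Real.exp δ := by linarith
    exact le_of_mul_le_mul_right h9 (Real.exp_pos δ)
  have h3 : ∏ i, (p i * Real.exp (-δ) + (1 - p i) * 1) ≤ Real.exp (-((δ - δ ^ 2 / 2) * M)) := by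
    have : Real.exp (-((δ - δ ^ 2 / 2) * M)) = ∏ i, Real.exp (-((δ - δ ^ 2 / 2) * p i)) := by
      rw [← Real.exp_sum, hM, Finset.mul_sum, Finset.sum_neg_distrib]
    rw [this]
    refine Finset.prod_le_prod (fun i _ => ?_) fun i _ => ?_
    · have := mul_nonneg (hp i).1 (Real.exp_pos (-δ)).le
      linarith [(hp i).2]
    · have h4 := Real.add_one_le_exp (-((δ - δ ^ 2 / 2) * p i))
      have h5 := mul_le_mul_of_nonneg_left h2 (hp i).1
      linarith
  refine (vecExp_mono hp hpt).trans ?_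
  rw [vecExp_const_mul, vecExp_prod (p := p) fun _ b => if b = true then Real.exp (-δ) else 1]
  simp only [if_true, Bool.false_eq_true, if_false]
  refine (mul_le_mul_of_nonneg_left h3 (Real.exp_pos _).le).trans ?_
  rw [← Real.exp_add]
  refine Real.exp_le_exp.2 ?_
  ring_nf
  exact le_refl _

/-- An exponential moment of the number of data vectors that contain a given finished path. The
factor `∏ p_i` on the right makes the bound summable over all sequences of coordinates. -/
theorem dataExp_cover_le (hp : ∀ i, 0 ≤ p i ∧ p i < 1 / 2) {v : Path d} (hv : v.Nodup) {a : ℝ}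
    (ha : 1 ≤ a) (hfin : Finished n p v) :
    dataExp p (fun S : Fin n → Vec d => (cover S v : ℝ) * a ^ cover S v) ≤
      n * a * Real.exp (a - 1) * (v.map p).prod := by
  set P := (v.map p).prod with hP
  have hP0 : 0 ≤ P := list_prod_map_nonneg hp v
  -- Written as a sum of products over the data vectors, the moment factorizes.
  have h1 : ∀ S : Fin n → Vec d, (cover S v : ℝ) * a ^ cover S v =
      ∑ j, ∏ k, if k = j then a * (if ∀ i ∈ v, S k i = true then (1 : ℝ) else 0)
        else 1 + (a - 1) * if ∀ i ∈ v, S k i = true then (1 : ℝ) else 0 := by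
    intro S
    have e1 : a ^ cover S v = ∏ k, if ∀ i ∈ v, S k i = true then a else 1 := by
      rw [Finset.prod_ite, Finset.prod_const, Finset.prod_const_one, mul_one, cover]
    have e2 : (cover S v : ℝ) = ∑ j, if ∀ i ∈ v, S j i = true then (1 : ℝ) else 0 := by
      rw [cover, Finset.card_filter]
      push_cast
      rfl
    rw [e1, e2, Finset.sum_mul]
    refine Finset.sum_congr rfl fun j _ => ?_
    rw [← Finset.mul_prod_erase _ _ (Finset.mem_univ j),
      ← Finset.mul_prod_erase _ (fun k => if k = j then _ else _) (Finset.mem_univ j), ← mul_assoc]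
    congr 1
    · rw [if_pos rfl]
      split_ifs <;> simp
    · refine Finset.prod_congr rfl fun k hk => ?_
      rw [if_neg (Finset.mem_erase.1 hk).1]
      split_ifs <;> simp
  simp only [h1]
  rw [dataExp_sum]
  have h2 : ∀ j : Fin n, dataExp p (fun S : Fin n → Vec d =>
      ∏ k, if k = j then a * (if ∀ i ∈ v, S k i = true then (1 : ℝ) else 0)
        else 1 + (a - 1) * if ∀ i ∈ v, S k i = true then (1 : ℝ) else 0) ≤
      a * P * Real.exp (a - 1) := by
    intro j
    have h3 := dataExp_prod (p := p) fun (k : Fin n) x =>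
      if k = j then a * (if ∀ i ∈ v, x i = true then (1 : ℝ) else 0)
        else 1 + (a - 1) * if ∀ i ∈ v, x i = true then (1 : ℝ) else 0
    rw [h3]
    have h4 : ∀ k : Fin n, vecExp p (fun x =>
        if k = j then a * (if ∀ i ∈ v, x i = true then (1 : ℝ) else 0)
          else 1 + (a - 1) * if ∀ i ∈ v, x i = true then (1 : ℝ) else 0) =
        if k = j then a * P else 1 + (a - 1) * P := by
      intro k
      split_ifs
      · rw [vecExp_const_mul, vecExp_contains hv]
      · rw [vecExp_add, vecExp_const, vecExp_const_mul, vecExp_contains hv]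
    simp only [h4]
    rw [← Finset.mul_prod_erase _ _ (Finset.mem_univ j), if_pos rfl]
    refine mul_le_mul_of_nonneg_left ?_ (by positivity)
    have hnP : (n : ℝ) * P ≤ 1 := by
      have hn : (0 : ℝ) < n := by exact_mod_cast j.pos
      have h5 : P ≤ 1 / n := hfin
      rw [le_div_iff₀ hn] at h5
      linarith
    calc (∏ k ∈ Finset.univ.erase j, if k = j then a * P else 1 + (a - 1) * P)
        ≤ ∏ k ∈ Finset.univ.erase j, Real.exp ((a - 1) * P) := by
          refine Finset.prod_le_prod (fun k hk => ?_) fun k hk => ?_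
          · rw [if_neg (Finset.mem_erase.1 hk).1]
            have := mul_nonneg (sub_nonneg.2 ha) hP0
            linarith
          · rw [if_neg (Finset.mem_erase.1 hk).1]
            linarith [Real.add_one_le_exp ((a - 1) * P)]
      _ = Real.exp (((n - 1 : ℕ) : ℝ) * ((a - 1) * P)) := by
          rw [Finset.prod_const, ← Real.exp_nat_mul]
          simp
      _ ≤ Real.exp (a - 1) := by
          refine Real.exp_le_exp.2 ?_
          have h6 : ((n - 1 : ℕ) : ℝ) ≤ n := by exact_mod_cast Nat.sub_le _ _
          have h7 := mul_nonneg (sub_nonneg.2 ha) hP0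
          calc _ ≤ (n : ℝ) * ((a - 1) * P) := mul_le_mul_of_nonneg_right h6 h7
            _ = (a - 1) * (n * P) := by ring
            _ ≤ (a - 1) * 1 := mul_le_mul_of_nonneg_left hnP (sub_nonneg.2 ha)
            _ = a - 1 := mul_one _
  refine (Finset.sum_le_sum fun j _ => h2 j).trans (le_of_eq ?_)
  simp
  ring

end Data

/-! ### Bounds on the expected number of paths -/

section Bounds

variable {n d : ℕ}

theorem depth_le_log (hn : 2 ≤ n) : (depth n : ℝ) ≤ 3 * Real.log n := by
  have h2 : (2 : ℝ) ≤ n := by exact_mod_cast hn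
  have hlog2 : 0 < Real.log 2 := Real.log_pos (by norm_num)
  have h4 : Real.log 2 ≤ Real.log n := Real.log_le_log (by norm_num) h2
  have h3 : (depth n : ℝ) < Real.logb 2 n + 1 := by
    have h5 := Real.natCeil_logb_natCast 2 n
    rw [depth, ← h5]
    refine Nat.ceil_lt_add_one (div_nonneg ?_ ?_)
    · linarith
    · simpa using hlog2.le
  -- The constant is slightly above `1 / log 2`.
  have h6 := Real.log_two_gt_d9
  have h7 : Real.logb 2 n ≤ 1.4428 * Real.log n := by
    rw [Real.logb, div_le_iff₀ hlog2]
    nlinarith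
  have h8 : 1 ≤ 1.4428 * Real.log n := by nlinarith
  linarith

theorem depth_le_self (n : ℕ) : depth n ≤ n := by
  rw [depth, Nat.clog_le_iff_le_pow (by norm_num)]
  exact Nat.lt_two_pow_self.le

theorem depth_pow_three_le (hn : 2 ≤ n) {δ : ℝ} (hδ : 0 < δ) :
    (depth n : ℝ) ^ 3 ≤ 27 / δ ^ 3 * (n : ℝ) ^ (3 * δ) := by
  have h0 : (0 : ℝ) ≤ n := Nat.cast_nonneg _
  have h1 : (depth n : ℝ) ≤ 3 * ((n : ℝ) ^ δ / δ) :=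
    (depth_le_log hn).trans (by linarith [Real.log_le_rpow_div h0 hδ])
  calc (depth n : ℝ) ^ 3 ≤ (3 * ((n : ℝ) ^ δ / δ)) ^ 3 :=
        pow_le_pow_left₀ (Nat.cast_nonneg _) h1 3
    _ = 27 / δ ^ 3 * ((n : ℝ) ^ δ) ^ 3 := by
        field_simp
        norm_num
    _ = 27 / δ ^ 3 * (n : ℝ) ^ (3 * δ) := by
        rw [mul_comm 3 δ, Real.rpow_mul h0, Real.rpow_ofNat]

/-- The factor by which the selection probability may exceed its ideal value `1 / (b₁ m)`: the term
`δ` accounts for the number of entries in the threshold, and `1 / n` for the discrete hash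
values. -/
noncomputable def slack (n : ℕ) (δ : ℝ) : ℝ := 1 + δ + 1 / n

theorem one_le_slack (n : ℕ) {δ : ℝ} (hδ : 0 ≤ δ) : 1 ≤ slack n δ := by
  have : (0 : ℝ) ≤ 1 / n := by positivity
  rw [slack]
  linarith

theorem slack_le_two (hn : 2 ≤ n) {δ : ℝ} (hδ : δ ≤ 1 / 2) : slack n δ ≤ 2 := by
  have h2 : (2 : ℝ) ≤ n := by exact_mod_cast hn
  have : (1 : ℝ) / n ≤ 1 / 2 := one_div_le_one_div_of_le (by norm_num) h2
  rw [slack]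
  linarith

theorem slack_pow_le (hn : 2 ≤ n) {δ : ℝ} (hδ : 0 ≤ δ) {l : ℕ} (hl : l ≤ depth n) :
    slack n δ ^ l ≤ Real.exp 1 * (n : ℝ) ^ (3 * δ) := by
  have hn0 : (0 : ℝ) < n := by exact_mod_cast (by omega : 0 < n)
  calc slack n δ ^ l ≤ slack n δ ^ depth n := pow_le_pow_right₀ (one_le_slack n hδ) hl
    _ ≤ Real.exp (δ + 1 / n) ^ depth n := by
        refine pow_le_pow_left₀ (by linarith [one_le_slack n hδ]) ?_ _
        rw [slack]
        linarith [Real.add_one_le_exp (δ + 1 / n)]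
    _ = Real.exp (depth n * (δ + 1 / n)) := by rw [Real.exp_nat_mul]
    _ ≤ Real.exp (1 + 3 * δ * Real.log n) := by
        refine Real.exp_le_exp.2 ?_
        have h1 : (depth n : ℝ) * (1 / n) ≤ 1 := by
          rw [mul_one_div, div_le_one hn0]
          exact_mod_cast depth_le_self n
        have h2 := mul_le_mul_of_nonneg_right (depth_le_log hn) hδ
        linarith
    _ = Real.exp 1 * (n : ℝ) ^ (3 * δ) := by
        rw [Real.exp_add, Real.rpow_def_of_pos hn0]
        congr 2
        ring

theorem selProb_le_slack (hn : 2 ≤ n) {b₁ δ : ℝ} (hb₁ : b₁ ≤ 1) (hδ : 0 < δ)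
    (hδ' : δ ≤ 1 / 2) {m l : ℕ} (hm : 6 * Real.log n ≤ δ * (b₁ * m)) (hmd : m ≤ d)
    (hl : l < depth n) : selProb n d b₁ m l ≤ slack n δ / (b₁ * m) := by
  have hn0 : (0 : ℝ) < n := by exact_mod_cast (by omega : 0 < n)
  have hlog : 0 < Real.log n := Real.log_pos (by exact_mod_cast (by omega : 1 < n))
  have ht0 : 0 < b₁ * m := by
    by_contra h
    push Not at h
    nlinarith
  have hl' : (l : ℝ) ≤ depth n := by exact_mod_cast hl.le
  have hle : (1 - δ / 2) * (b₁ * m) ≤ b₁ * m - l := by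
    have := depth_le_log hn
    linarith
  have hpos : 0 < (1 - δ / 2) * (b₁ * m) := mul_pos (by linarith) ht0
  refine (selProb_le (by linarith)).trans ?_
  have h1 : 1 / (b₁ * m - l) ≤ (1 + δ) / (b₁ * m) := by
    rw [div_le_div_iff₀ (by linarith) ht0]
    have h3 : 1 ≤ (1 + δ) * (1 - δ / 2) := by nlinarith
    have h4 := mul_le_mul_of_nonneg_left hle (by linarith : (0 : ℝ) ≤ 1 + δ)
    nlinarith
  have h2 : 1 / (hashPrime n d : ℝ) ≤ 1 / n / (b₁ * m) := by
    rw [div_div]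
    refine one_div_le_one_div_of_le (by positivity) ?_
    have h3 : ((n * d : ℕ) : ℝ) ≤ hashPrime n d := by exact_mod_cast le_hashPrime n d
    have h4 : b₁ * m ≤ d := by
      have h5 : (m : ℝ) ≤ d := by exact_mod_cast hmd
      have h6 : (0 : ℝ) ≤ m := Nat.cast_nonneg _
      nlinarith
    push_cast at h3
    have := mul_le_mul_of_nonneg_left h4 hn0.le
    linarith
  rw [slack, add_div]
  linarith

theorem pathProb_le (hn : 2 ≤ n) {b₁ δ : ℝ} (hb₁ : b₁ ≤ 1) (hδ : 0 < δ)
    (hδ' : δ ≤ 1 / 2) {m l : ℕ} (hm : 6 * Real.log n ≤ δ * (b₁ * m)) (hmd : m ≤ d)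
    (hl : l ≤ depth n) : pathProb n d b₁ m l ≤ (slack n δ / (b₁ * m)) ^ l := by
  refine (Finset.prod_le_prod (fun j _ => selProb_nonneg _ _ _ _ _) fun j hj =>
    selProb_le_slack hn hb₁ hδ hδ' hm hmd ?_).trans (le_of_eq (by simp [div_pow]))
  have := Finset.mem_range.1 hj
  omega

theorem size_le (x : Vec d) : size x ≤ d := by
  refine (Finset.card_le_univ _).trans (by simp)

theorem list_prod_rpow {p : Fin d → ℝ} (hp : ∀ i, 0 ≤ p i) (ρ : ℝ) (v : Path d) :
    (v.map fun i => p i ^ ρ).prod = (v.map p).prod ^ ρ := by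
  induction v with
  | nil => simp
  | cons i v ih =>
    rw [List.map_cons, List.prod_cons, ih, List.map_cons, List.prod_cons, Real.mul_rpow (hp i)]
    exact List.prod_nonneg (by simpa using fun i _ => hp i)

theorem list_prod_indicator (x : Vec d) (g : Fin d → ℝ) {v : Path d} (hv : ∀ i ∈ v, x i = true) :
    (v.map fun i => if x i = true then g i else 0).prod = (v.map g).prod := by
  congr 1
  exact List.map_congr_left fun i hi => if_pos (hv i hi)

/-- An unfinished path `v` has `∏ p_i > 1 / n`, so `n ^ ρ * ∏ p_i ^ ρ ≥ 1`. -/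
theorem one_le_of_not_finished (hn : 1 ≤ n) {p : Fin d → ℝ} (hp : ∀ i, 0 ≤ p i) {ρ : ℝ}
    (hρ : 0 ≤ ρ) {v : Path d} (hv : ¬ Finished n p v) :
    1 ≤ (n : ℝ) ^ ρ * (v.map fun i => p i ^ ρ).prod := by
  have hn0 : (0 : ℝ) < n := by exact_mod_cast hn
  have hP : 0 ≤ (v.map p).prod := List.prod_nonneg (by simpa using fun i _ => hp i)
  rw [list_prod_rpow hp, ← Real.mul_rpow hn0.le hP]
  refine Real.one_le_rpow ?_ hρ
  rw [Finished, not_le, div_lt_iff₀ hn0] at hv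
  linarith

theorem coinExp_length_front_le_pathSum (hn : 2 ≤ n) (p : Fin d → ℝ) (b₁ : ℝ) (x : Vec d)
    (m : ℕ) {l : ℕ} (hl : l ≤ depth n) : open Classical in
    coinExp (fun c : Coeffs n d => ((front p b₁ c x m l).length : ℝ)) ≤
      pathProb n d b₁ m l * pathSum l fun v =>
        if IsPathIn x l v ∧ ¬ Finished n p v then 1 else 0 := by
  have h := coinExp_sum_front_le hn p b₁ x m hl (fun _ => 1) fun _ => zero_le_one
  simpa using h

section FixedVector

variable {b₁ δ : ℝ} {x : Vec d}

theorem size_pos_of_le (hn : 2 ≤ n) (hδ : 0 < δ)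
    (hm : 6 * Real.log n ≤ δ * (b₁ * size x)) : 0 < b₁ * size x := by
  have hlog : 0 < Real.log n := Real.log_pos (by exact_mod_cast (by omega : 1 < n))
  by_contra h
  push Not at h
  nlinarith

/-- The expected number of unfinished paths of a vector with exponent `ρ`. -/
theorem coinExp_length_front_le (hn : 2 ≤ n) (hb₁ : b₁ ≤ 1) (hδ : 0 < δ)
    (hδ' : δ ≤ 1 / 2) (hm : 6 * Real.log n ≤ δ * (b₁ * size x)) {p : Fin d → ℝ}
    (hp : ∀ i, 0 ≤ p i) {ρ : ℝ} (hρ : 0 ≤ ρ)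
    (hsum : ∑ i with x i = true, p i ^ ρ ≤ b₁ * size x) {l : ℕ} (hl : l ≤ depth n) :
    coinExp (fun c : Coeffs n d => ((front p b₁ c x (size x) l).length : ℝ)) ≤
      Real.exp 1 * (n : ℝ) ^ (ρ + 3 * δ) := by
  classical
  have hn0 : (0 : ℝ) < n := by exact_mod_cast (by omega : 0 < n)
  have hpos := size_pos_of_le hn hδ hm
  have h1 : (pathSum l fun v => if IsPathIn x l v ∧ ¬ Finished n p v then (1 : ℝ) else 0) ≤
      (n : ℝ) ^ ρ * (b₁ * size x) ^ l := by
    calc _ ≤ pathSum l fun v =>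
          (n : ℝ) ^ ρ * (v.map fun i => if x i = true then p i ^ ρ else 0).prod := by
          refine pathSum_mono fun v _ => ?_
          split_ifs with hv
          · rw [list_prod_indicator x _ hv.1.2.2]
            exact one_le_of_not_finished (by omega) hp hρ hv.2
          · refine mul_nonneg (Real.rpow_nonneg hn0.le _) (List.prod_nonneg ?_)
            simp only [List.mem_map]
            rintro _ ⟨i, -, rfl⟩
            split_ifs
            · exact Real.rpow_nonneg (hp i) _
            · exact le_rfl
      _ = (n : ℝ) ^ ρ * (∑ i with x i = true, p i ^ ρ) ^ l := by
          rw [pathSum_const_mul, pathSum_prod, Finset.sum_filter]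
      _ ≤ _ := by
          refine mul_le_mul_of_nonneg_left (pow_le_pow_left₀ ?_ hsum _)
            (Real.rpow_nonneg hn0.le _)
          exact Finset.sum_nonneg fun i _ => Real.rpow_nonneg (hp i) _
  have h2 := pathProb_le (d := d) hn hb₁ hδ hδ' hm (size_le x) hl
  have h0 : 0 ≤ slack n δ / (b₁ * size x) :=
    div_nonneg (by linarith [one_le_slack n hδ.le]) hpos.le
  calc _ ≤ _ := coinExp_length_front_le_pathSum hn p b₁ x (size x) hl
    _ ≤ (slack n δ / (b₁ * size x)) ^ l * ((n : ℝ) ^ ρ * (b₁ * size x) ^ l) :=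
        mul_le_mul h2 h1 (pathSum_nonneg fun v => by split_ifs <;> norm_num) (pow_nonneg h0 _)
    _ = slack n δ ^ l * (n : ℝ) ^ ρ := by
        rw [div_pow]
        have := (pow_pos hpos l).ne'
        field_simp
    _ ≤ Real.exp 1 * (n : ℝ) ^ (3 * δ) * (n : ℝ) ^ ρ :=
        mul_le_mul_of_nonneg_right (slack_pow_le hn hδ.le hl) (Real.rpow_nonneg hn0.le _)
    _ = _ := by
        rw [mul_assoc, ← Real.rpow_add hn0, add_comm]

/-- A crude bound on the expected number of unfinished paths, valid for all vectors. -/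
theorem coinExp_length_front_le_crude (hn : 2 ≤ n) (hb₀ : 0 < b₁) (hb₁ : b₁ ≤ 1) (hδ : 0 < δ)
    (hδ' : δ ≤ 1 / 2) (hm : 6 * Real.log n ≤ δ * (b₁ * size x)) (p : Fin d → ℝ)
    {l : ℕ} (hl : l ≤ depth n) :
    coinExp (fun c : Coeffs n d => ((front p b₁ c x (size x) l).length : ℝ)) ≤
      Real.exp 1 * (n : ℝ) ^ (3 * δ) * (1 / b₁) ^ depth n := by
  classical
  have hn0 : (0 : ℝ) < n := by exact_mod_cast (by omega : 0 < n)
  have hpos := size_pos_of_le hn hδ hm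
  have hx : (0 : ℝ) < size x := (mul_pos_iff_of_pos_left hb₀).1 hpos
  have h1 : (pathSum l fun v => if IsPathIn x l v ∧ ¬ Finished n p v then (1 : ℝ) else 0) ≤
      (size x : ℝ) ^ l := by
    calc _ ≤ pathSum l fun v => (v.map fun i => if x i = true then (1 : ℝ) else 0).prod := by
          refine pathSum_mono fun v _ => ?_
          split_ifs with hv
          · rw [list_prod_indicator x _ hv.1.2.2]
            simp
          · refine List.prod_nonneg ?_
            simp only [List.mem_map]
            rintro _ ⟨i, -, rfl⟩
            split_ifs <;> norm_num
      _ = (size x : ℝ) ^ l := by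
          rw [pathSum_prod]
          simp [size]
  have h2 := pathProb_le (d := d) hn hb₁ hδ hδ' hm (size_le x) hl
  have h0 : 0 ≤ slack n δ / (b₁ * size x) :=
    div_nonneg (by linarith [one_le_slack n hδ.le]) hpos.le
  calc _ ≤ _ := coinExp_length_front_le_pathSum hn p b₁ x (size x) hl
    _ ≤ (slack n δ / (b₁ * size x)) ^ l * (size x : ℝ) ^ l :=
        mul_le_mul h2 h1 (pathSum_nonneg fun v => by split_ifs <;> norm_num) (pow_nonneg h0 _)
    _ = slack n δ ^ l * (1 / b₁) ^ l := by
        rw [← mul_pow, ← mul_pow]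
        congr 1
        field_simp
    _ ≤ _ := by
        refine mul_le_mul (slack_pow_le hn hδ.le hl) (pow_le_pow_right₀ ?_ hl) (by positivity)
          (by positivity)
        rw [le_div_iff₀ hb₀]
        linarith

theorem frontCount_eq {p : Fin d → ℝ} {C : ℝ} (hx : ¬ IsLight n b₁ C x) (c : Coeffs n d) :
    (frontCount p b₁ C c x : ℝ) =
      ∑ l ∈ Finset.range (depth n), ((front p b₁ c x (size x) l).length : ℝ) := by
  rw [frontCount, if_neg hx]
  push_cast
  rfl

theorem length_filters {p : Fin d → ℝ} {C : ℝ} (hx : ¬ IsLight n b₁ C x) (c : Coeffs n d) :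
    ((filters p b₁ C c x).val.length : ℝ) =
      ∑ l ∈ Finset.range (depth n), ((done p b₁ c x (size x) l).length : ℝ) := by
  have h : (filters p b₁ C c x).val.length =
      ∑ l ∈ Finset.range (depth n), (done p b₁ c x (size x) l).length := by
    rw [filters_val, if_neg hx, List.length_flatMap]
    rfl
  exact_mod_cast h

theorem sum_filters {p : Fin d → ℝ} {C : ℝ} (hx : ¬ IsLight n b₁ C x) (c : Coeffs n d)
    (g : Path d → ℝ) : ((filters p b₁ C c x).val.map g).sum =
      ∑ l ∈ Finset.range (depth n), ((done p b₁ c x (size x) l).map g).sum := by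
  rw [filters_val, if_neg hx, List.map_flatMap, List.flatMap, List.sum_flatten, List.map_map]
  rfl

/-- The expected number of finished paths is at most a constant times the expected number of
unfinished ones. -/
theorem coinExp_length_filters_le (hn : 2 ≤ n) (hb₀ : 0 < b₁) (hb₁ : b₁ ≤ 1) (hδ : 0 < δ)
    (hδ' : δ ≤ 1 / 2) (p : Fin d → ℝ) {C : ℝ} (x : Vec d)
    (hm : ¬ IsLight n b₁ C x → 6 * Real.log n ≤ δ * (b₁ * size x)) :
    coinExp (fun c : Coeffs n d => ((filters p b₁ C c x).val.length : ℝ)) ≤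
      2 / b₁ * coinExp fun c : Coeffs n d => (frontCount p b₁ C c x : ℝ) := by
  by_cases hx : IsLight n b₁ C x
  · simp [filters_val, frontCount, hx, coinExp_const]
  · have hm := hm hx
    have hpos := size_pos_of_le hn hδ hm
    have hx0 : (0 : ℝ) < size x := (mul_pos_iff_of_pos_left hb₀).1 hpos
    simp only [length_filters hx, frontCount_eq hx, coinExp_sum, Finset.mul_sum]
    refine Finset.sum_le_sum fun l hl => ?_
    refine (coinExp_length_done_le p b₁ x (size x) (Finset.mem_range.1 hl)).trans ?_
    rw [← mul_assoc]
    refine mul_le_mul_of_nonneg_right ?_ (coinExp_nonneg fun c => Nat.cast_nonneg _)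
    have h1 := selProb_le_slack (d := d) hn hb₁ hδ hδ' hm (size_le x) (Finset.mem_range.1 hl)
    calc _ ≤ slack n δ / (b₁ * size x) * size x := mul_le_mul_of_nonneg_right h1 hx0.le
      _ = slack n δ / b₁ := by
        field_simp
      _ ≤ 2 / b₁ := div_le_div_of_nonneg_right (slack_le_two hn hδ') hb₀.le

/-- Vectors that choose paths are so heavy that their paths are short compared with `b₁ |x|`. -/
theorem not_isLight_imp {C : ℝ} (hb₀ : 0 < b₁) (hδ : 0 < δ) (hn : 2 ≤ n)
    (hC : 6 ≤ C * (b₁ ^ 2 * δ)) (hx : ¬ IsLight n b₁ C x) :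
    6 * Real.log n ≤ δ * (b₁ * size x) := by
  have hlog : 0 < Real.log n := Real.log_pos (by exact_mod_cast (by omega : 1 < n))
  rw [IsLight, not_lt] at hx
  have h1 := mul_le_mul_of_nonneg_left hx (mul_pos hδ hb₀).le
  have h2 := mul_le_mul_of_nonneg_right hC hlog.le
  calc 6 * Real.log n ≤ C * (b₁ ^ 2 * δ) * Real.log n := h2
    _ = δ * b₁ * (b₁ * (C * Real.log n)) := by ring
    _ ≤ δ * b₁ * size x := h1
    _ = _ := by ring

end FixedVector

end Bounds

/-! ### Expected space and building time -/

section Build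

variable {n d : ℕ} {p : Fin d → ℝ} {b₁ δ C ρ : ℝ}

theorem vecExp_pathSum (l : ℕ) (g : Vec d → Path d → ℝ) :
    vecExp p (fun x => pathSum l (g x)) = pathSum l fun v => vecExp p fun x => g x v := by
  simp only [vecExp]
  rw [pathSum_sum]
  simp only [pathSum_const_mul]

theorem dataExp_pathSum (l : ℕ) (g : (Fin n → Vec d) → Path d → ℝ) :
    dataExp p (fun S => pathSum l (g S)) = pathSum l fun v => dataExp p fun S => g S v := by
  simp only [dataExp]
  rw [pathSum_sum]
  simp only [pathSum_const_mul]

theorem inv_one_sub_pow_le (hn : 2 ≤ n) (hδ : 0 < δ) (hδ' : δ ≤ 1 / 2) {l : ℕ}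
    (hl : l ≤ depth n) : (1 / (1 - δ)) ^ l ≤ (n : ℝ) ^ (6 * δ) := by
  have hn0 : (0 : ℝ) < n := by exact_mod_cast (by omega : 0 < n)
  have h1 : (0 : ℝ) < 1 - δ := by linarith
  calc (1 / (1 - δ)) ^ l ≤ (1 / (1 - δ)) ^ depth n := by
        refine pow_le_pow_right₀ ?_ hl
        rw [le_div_iff₀ h1]
        linarith
    _ ≤ Real.exp (2 * δ) ^ depth n := by
        refine pow_le_pow_left₀ (by positivity) ?_ _
        rw [div_le_iff₀ h1]
        have h2 := mul_le_mul_of_nonneg_right (Real.add_one_le_exp (2 * δ)) h1.le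
        nlinarith
    _ = Real.exp (depth n * (2 * δ)) := by rw [Real.exp_nat_mul]
    _ ≤ Real.exp (Real.log n * (6 * δ)) := by
        refine Real.exp_le_exp.2 ?_
        have := mul_le_mul_of_nonneg_right (depth_le_log hn) hδ.le
        linarith
    _ = _ := by rw [Real.rpow_def_of_pos hn0]

/-- The expected number of unfinished paths with `l` entries of a random vector, restricted to
vectors whose weight is not much below its mean. -/
theorem vecExp_pathSum_le (hn : 2 ≤ n) (hb₀ : 0 < b₁) (hδ : 0 < δ) (hδ' : δ ≤ 1 / 2)
    (hp : ∀ i, 0 ≤ p i ∧ p i < 1 / 2) (hM : 0 < ∑ i, p i) (hρ : 0 ≤ ρ)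
    (hsum : ∑ i, p i ^ (1 + ρ) = b₁ * ∑ i, p i) {l : ℕ} (hl : l ≤ depth n) :
    open Classical in
    vecExp p (fun x => (slack n δ / (b₁ * ((1 - δ) * ∑ i, p i))) ^ l * pathSum l fun v =>
      if IsPathIn x l v ∧ ¬ Finished n p v then (1 : ℝ) else 0) ≤
      Real.exp 1 * (n : ℝ) ^ (ρ + 9 * δ) := by
  classical
  have hn0 : (0 : ℝ) < n := by exact_mod_cast (by omega : 0 < n)
  have h1δ : (0 : ℝ) < 1 - δ := by linarith
  set M := ∑ i, p i with hMdef
  have hs := one_le_slack n hδ.le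
  rw [vecExp_const_mul, vecExp_pathSum]
  have h1 : ∀ v : Path d, vecExp p (fun x => if IsPathIn x l v ∧ ¬ Finished n p v then (1 : ℝ)
      else 0) ≤ (n : ℝ) ^ ρ * (v.map fun i => p i ^ (1 + ρ)).prod := by
    intro v
    have hprod : (v.map fun i => p i ^ (1 + ρ)).prod =
        (v.map p).prod * (v.map fun i => p i ^ ρ).prod := by
      rw [← List.prod_map_mul]
      congr 1
      refine List.map_congr_left fun i _ => ?_
      rw [Real.rpow_add_of_nonneg (hp i).1 zero_le_one hρ, Real.rpow_one]
    by_cases hv : v.Nodup ∧ ¬ Finished n p v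
    · calc _ ≤ vecExp p fun x => if ∀ i ∈ v, x i = true then (1 : ℝ) else 0 := by
            refine vecExp_mono hp fun x => ?_
            by_cases h : IsPathIn x l v
            · rw [if_pos ⟨h, hv.2⟩, if_pos h.2.2]
            · simp only [h, false_and, if_false]
              split_ifs <;> norm_num
        _ = (v.map p).prod * 1 := by rw [vecExp_contains hv.1, mul_one]
        _ ≤ (v.map p).prod * ((n : ℝ) ^ ρ * (v.map fun i => p i ^ ρ).prod) :=
            mul_le_mul_of_nonneg_left
              (one_le_of_not_finished (by omega) (fun i => (hp i).1) hρ hv.2)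
              (list_prod_map_nonneg hp v)
        _ = _ := by rw [hprod]; ring
    · have h0 : ∀ x : Vec d, (if IsPathIn x l v ∧ ¬ Finished n p v then (1 : ℝ) else 0) = 0 :=
        fun x => if_neg fun h => hv ⟨h.1.2.1, h.2⟩
      simp only [h0, vecExp_const]
      refine mul_nonneg (Real.rpow_nonneg hn0.le _) (List.prod_nonneg ?_)
      simp only [List.mem_map]
      rintro _ ⟨i, -, rfl⟩
      exact Real.rpow_nonneg (hp i).1 _
  have h2 : pathSum l (fun v => vecExp p fun x =>
      if IsPathIn x l v ∧ ¬ Finished n p v then (1 : ℝ) else 0) ≤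
      (n : ℝ) ^ ρ * (b₁ * M) ^ l := by
    refine (pathSum_mono fun v _ => h1 v).trans (le_of_eq ?_)
    rw [pathSum_const_mul, pathSum_prod, hsum]
  calc _ ≤ (slack n δ / (b₁ * ((1 - δ) * M))) ^ l * ((n : ℝ) ^ ρ * (b₁ * M) ^ l) :=
        mul_le_mul_of_nonneg_left h2 (by positivity)
    _ = slack n δ ^ l * (1 / (1 - δ)) ^ l * (n : ℝ) ^ ρ := by
        rw [mul_left_comm, ← mul_pow, ← mul_pow, mul_comm]
        congr 2
        field_simp
    _ ≤ Real.exp 1 * (n : ℝ) ^ (3 * δ) * (n : ℝ) ^ (6 * δ) * (n : ℝ) ^ ρ := by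
        refine mul_le_mul_of_nonneg_right ?_ (Real.rpow_nonneg hn0.le _)
        exact mul_le_mul (slack_pow_le hn hδ.le hl) (inv_one_sub_pow_le hn hδ hδ' hl)
          (by positivity) (by positivity)
    _ = _ := by
        rw [mul_assoc, mul_assoc, ← Real.rpow_add hn0, ← Real.rpow_add hn0]
        congr 2
        ring

/-- The expected number of unfinished paths of a random vector. Vectors of weight below `(1 - δ) ∑
p_i` are so rare that the crude bound suffices for them. -/
theorem vecExp_frontCount_le (hn : 2 ≤ n) (hb₀ : 0 < b₁) (hb₁ : b₁ ≤ 1) (hδ : 0 < δ)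
    (hδ' : δ ≤ 1 / 2) (hp : ∀ i, 0 ≤ p i ∧ p i < 1 / 2) (hC0 : 0 < C)
    (hC1 : 6 ≤ C * (b₁ ^ 2 * δ)) (hC2 : 6 * Real.log (1 / b₁) ≤ C * δ ^ 2)
    (hM : C * Real.log n ≤ ∑ i, p i) (hρ : 0 ≤ ρ)
    (hsum : ∑ i, p i ^ (1 + ρ) = b₁ * ∑ i, p i) :
    vecExp p (fun x => coinExp fun c : Coeffs n d => (frontCount p b₁ C c x : ℝ)) ≤
      depth n * (2 * (Real.exp 1 * (n : ℝ) ^ (ρ + 9 * δ))) := by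
  classical
  have hn0 : (0 : ℝ) < n := by exact_mod_cast (by omega : 0 < n)
  have hn1 : (1 : ℝ) ≤ n := by exact_mod_cast (by omega : 1 ≤ n)
  have hlog : 0 < Real.log n := Real.log_pos (by exact_mod_cast (by omega : 1 < n))
  have h1δ : (0 : ℝ) < 1 - δ := by linarith
  have hs := one_le_slack n hδ.le
  have hM0 : 0 < ∑ i, p i := (mul_pos hC0 hlog).trans_le hM
  set M := ∑ i, p i with hMdef
  set B : ℝ := Real.exp 1 * (n : ℝ) ^ (3 * δ) * (1 / b₁) ^ depth n with hB
  have hB0 : 0 ≤ B := by positivity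
  have hpt : ∀ x : Vec d, coinExp (fun c : Coeffs n d => (frontCount p b₁ C c x : ℝ)) ≤
      ∑ l ∈ Finset.range (depth n), ((slack n δ / (b₁ * ((1 - δ) * M))) ^ l * (pathSum l fun v =>
        if IsPathIn x l v ∧ ¬ Finished n p v then (1 : ℝ) else 0) +
        B * if (size x : ℝ) < (1 - δ) * M then 1 else 0) := by
    intro x
    have hA : ∀ l, 0 ≤ (slack n δ / (b₁ * ((1 - δ) * M))) ^ l * (pathSum l fun v =>
        if IsPathIn x l v ∧ ¬ Finished n p v then (1 : ℝ) else 0) := fun l =>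
      mul_nonneg (by positivity) (pathSum_nonneg fun v => by split_ifs <;> norm_num)
    by_cases hx : IsLight n b₁ C x
    · simp only [frontCount, if_pos hx, Nat.cast_zero, coinExp_const]
      refine Finset.sum_nonneg fun l _ => add_nonneg (hA l) (mul_nonneg hB0 ?_)
      split_ifs <;> norm_num
    · have hm := not_isLight_imp hb₀ hδ hn hC1 hx
      simp only [frontCount_eq hx, coinExp_sum]
      refine Finset.sum_le_sum fun l hl => ?_
      have hl' := (Finset.mem_range.1 hl).le
      split_ifs with h
      · have := coinExp_length_front_le_crude hn hb₀ hb₁ hδ hδ' hm p hl'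
        have := hA l
        linarith
      · rw [mul_zero, add_zero]
        refine (coinExp_length_front_le_pathSum hn p b₁ x (size x) hl').trans ?_
        refine mul_le_mul_of_nonneg_right ?_ (pathSum_nonneg fun v => by split_ifs <;> norm_num)
        refine (pathProb_le hn hb₁ hδ hδ' hm (size_le x) hl').trans ?_
        push Not at h
        gcongr
  refine (vecExp_mono hp hpt).trans ?_
  rw [vecExp_sum]
  have hterm : ∀ l ∈ Finset.range (depth n), vecExp p (fun x =>
      (slack n δ / (b₁ * ((1 - δ) * M))) ^ l * (pathSum l fun v =>
        if IsPathIn x l v ∧ ¬ Finished n p v then (1 : ℝ) else 0) +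
        B * if (size x : ℝ) < (1 - δ) * M then 1 else 0) ≤
      2 * (Real.exp 1 * (n : ℝ) ^ (ρ + 9 * δ)) := by
    intro l hl
    rw [vecExp_add, vecExp_const_mul (a := B)]
    have h1 := vecExp_pathSum_le hn hb₀ hδ hδ' hp hM0 hρ hsum (Finset.mem_range.1 hl).le
    have h2 := mul_le_mul_of_nonneg_left (vecExp_size_lt_le hp hδ.le) hB0
    have h3 : B * Real.exp (-(δ ^ 2 / 2 * M)) ≤ Real.exp 1 * (n : ℝ) ^ (ρ + 9 * δ) := by
      have h4 : (1 / b₁) ^ depth n * Real.exp (-(δ ^ 2 / 2 * M)) ≤ 1 := by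
        have hb : 0 < 1 / b₁ := by positivity
        have hlb : 0 ≤ Real.log (1 / b₁) := Real.log_nonneg (by
          rw [le_div_iff₀ hb₀]
          linarith)
        rw [← Real.exp_log (pow_pos hb (depth n)), ← Real.exp_add, Real.log_pow,
          Real.exp_le_one_iff]
        have e1 := mul_le_mul_of_nonneg_right (depth_le_log hn) hlb
        have e2 := mul_le_mul_of_nonneg_left hM (by positivity : 0 ≤ δ ^ 2 / 2)
        have e3 := mul_le_mul_of_nonneg_right hC2 hlog.le
        nlinarith
      have h5 : (n : ℝ) ^ (3 * δ) ≤ (n : ℝ) ^ (ρ + 9 * δ) :=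
        Real.rpow_le_rpow_of_exponent_le hn1 (by linarith)
      calc B * Real.exp (-(δ ^ 2 / 2 * M)) = Real.exp 1 * (n : ℝ) ^ (3 * δ) *
            ((1 / b₁) ^ depth n * Real.exp (-(δ ^ 2 / 2 * M))) := by rw [hB]; ring
        _ ≤ Real.exp 1 * (n : ℝ) ^ (3 * δ) * 1 := mul_le_mul_of_nonneg_left h4 (by positivity)
        _ ≤ _ := by
          rw [mul_one]
          exact mul_le_mul_of_nonneg_left h5 (Real.exp_pos _).le
    linarith
  refine (Finset.sum_le_sum hterm).trans (le_of_eq ?_)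
  simp

theorem coinExp_sum_reps (f : Coeffs n d → ℝ) :
    coinExp (fun ω : Coins n d => ∑ r, f (ω r)) = reps n * coinExp f := by
  rw [coinExp_sum]
  simp only [coinExp_eval]
  simp

theorem dataExp_sum_eval (f : Vec d → ℝ) :
    dataExp p (fun S : Fin n → Vec d => ∑ j, f (S j)) = n * vecExp p f := by
  rw [dataExp_sum]
  simp only [dataExp_eval]
  simp

theorem cast_reps (n : ℕ) : (reps n : ℝ) = 2 * depth n := by
  rw [reps]
  push_cast
  rfl

/-- The exponent for building is nonnegative. -/
theorem exponent_nonneg (hb₁ : b₁ ≤ 1) (hp : ∀ i, 0 ≤ p i ∧ p i < 1 / 2)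
    (hM : 0 < ∑ i, p i) (hsum : ∑ i, p i ^ (1 + ρ) = b₁ * ∑ i, p i) : 0 ≤ ρ := by
  by_contra hρ
  push Not at hρ
  -- With a negative exponent every positive `p i` would contribute more than `p i`.
  have h1 : ∀ i, p i ≤ p i ^ (1 + ρ) := by
    intro i
    rcases (hp i).1.eq_or_lt with h | h
    · rw [← h]
      exact Real.rpow_nonneg le_rfl _
    · calc p i = p i ^ (1 : ℝ) := (Real.rpow_one _).symm
        _ ≤ _ := Real.rpow_le_rpow_of_exponent_ge h (by linarith [(hp i).2]) (by linarith)
  obtain ⟨i, -, hi⟩ := Finset.exists_lt_of_sum_lt (s := Finset.univ) (f := fun _ => (0 : ℝ))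
    (g := p) (by simpa using hM)
  have h2 : ∑ i, p i < ∑ i, p i ^ (1 + ρ) := by
    refine Finset.sum_lt_sum (fun i _ => h1 i) ⟨i, Finset.mem_univ i, ?_⟩
    calc p i = p i ^ (1 : ℝ) := (Real.rpow_one _).symm
      _ < _ := Real.rpow_lt_rpow_of_exponent_gt hi (by linarith [(hp i).2]) (by linarith)
  nlinarith

theorem one_le_dim (hM : 0 < ∑ i, p i) : 1 ≤ d := by
  rcases Nat.eq_zero_or_pos d with rfl | h
  · simp at hM
  · exact h

/-- The logarithmic factors are absorbed into `n ^ ε`. -/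
theorem depth_pow_mul_le (hn : 2 ≤ n) (hδ : 0 < δ) {ε σ : ℝ} (hε : 12 * δ ≤ ε) :
    (depth n : ℝ) ^ 3 * (n * (Real.exp 1 * (n : ℝ) ^ (σ + 9 * δ))) ≤
      27 * Real.exp 1 / δ ^ 3 * (n : ℝ) ^ (1 + σ + ε) := by
  have hn0 : (0 : ℝ) < n := by exact_mod_cast (by omega : 0 < n)
  have hn1 : (1 : ℝ) ≤ n := by exact_mod_cast (by omega : 1 ≤ n)
  calc _ ≤ 27 / δ ^ 3 * (n : ℝ) ^ (3 * δ) * (n * (Real.exp 1 * (n : ℝ) ^ (σ + 9 * δ))) :=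
        mul_le_mul_of_nonneg_right (depth_pow_three_le hn hδ) (by positivity)
    _ = 27 * Real.exp 1 / δ ^ 3 * ((n : ℝ) ^ (3 * δ) * ((n : ℝ) ^ (1 : ℝ) *
          (n : ℝ) ^ (σ + 9 * δ))) := by
        rw [Real.rpow_one]
        ring
    _ = 27 * Real.exp 1 / δ ^ 3 * (n : ℝ) ^ (1 + σ + 12 * δ) := by
        rw [← Real.rpow_add hn0, ← Real.rpow_add hn0]
        congr 2
        ring
    _ ≤ _ := by
        refine mul_le_mul_of_nonneg_left ?_ (by positivity)
        exact Real.rpow_le_rpow_of_exponent_le hn1 (by linarith)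

theorem vecExp_length_filters_le (hn : 2 ≤ n) (hb₀ : 0 < b₁) (hb₁ : b₁ ≤ 1) (hδ : 0 < δ)
    (hδ' : δ ≤ 1 / 2) (hp : ∀ i, 0 ≤ p i ∧ p i < 1 / 2) (hC1 : 6 ≤ C * (b₁ ^ 2 * δ)) :
    vecExp p (fun x => coinExp fun c : Coeffs n d => ((filters p b₁ C c x).val.length : ℝ)) ≤
      2 / b₁ * vecExp p fun x => coinExp fun c : Coeffs n d => (frontCount p b₁ C c x : ℝ) := by
  rw [← vecExp_const_mul]
  exact vecExp_mono hp fun x => coinExp_length_filters_le hn hb₀ hb₁ hδ hδ' p x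
    (not_isLight_imp hb₀ hδ hn hC1)

theorem dataExp_words_le (hn : 2 ≤ n) (hb₀ : 0 < b₁) (hb₁ : b₁ ≤ 1) (hδ : 0 < δ)
    (hδ' : δ ≤ 1 / 2) (hp : ∀ i, 0 ≤ p i ∧ p i < 1 / 2) (hC0 : 0 < C)
    (hC1 : 6 ≤ C * (b₁ ^ 2 * δ)) (hC2 : 6 * Real.log (1 / b₁) ≤ C * δ ^ 2)
    (hM : C * Real.log n ≤ ∑ i, p i) (hρ : 0 ≤ ρ)
    (hsum : ∑ i, p i ^ (1 + ρ) = b₁ * ∑ i, p i) :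
    dataExp p (fun S : Fin n → Vec d => coinExp fun ω : Coins n d =>
      ((build p b₁ C ω S).val.words : ℝ)) ≤
    2 * (d * n) + (4 + 48 / b₁) *
      ((depth n : ℝ) ^ 3 * (n * (Real.exp 1 * (n : ℝ) ^ (ρ + 9 * δ)))) := by
  have hn1 : (1 : ℝ) ≤ n := by exact_mod_cast (by omega : 1 ≤ n)
  have hL : (1 : ℝ) ≤ depth n := by exact_mod_cast one_le_depth hn
  set L : ℝ := (depth n : ℝ) with hLdef
  set E : ℝ := Real.exp 1 * (n : ℝ) ^ (ρ + 9 * δ) with hE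
  have hE1 : 1 ≤ E := by
    have h1 : (1 : ℝ) ≤ (n : ℝ) ^ (ρ + 9 * δ) := Real.one_le_rpow hn1 (by linarith)
    have h2 : (1 : ℝ) ≤ Real.exp 1 := Real.one_le_exp zero_le_one
    nlinarith
  set f : Vec d → ℝ := fun x => coinExp fun c : Coeffs n d =>
    ((filters p b₁ C c x).val.length : ℝ) with hf
  have hS : ∀ S : Fin n → Vec d, coinExp (fun ω : Coins n d =>
      ((build p b₁ C ω S).val.words : ℝ)) ≤
      ((n * d + d) + 2 * L * (L * (L + 1))) + 2 * L * (4 * L + 2) * ∑ j, f (S j) := by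
    intro S
    have h1 : ∀ ω : Coins n d, ((build p b₁ C ω S).val.words : ℝ) ≤ (n * d + d : ℝ) +
        ∑ r, (L * (L + 1) +
          ∑ j, (4 * L + 2) * ((filters p b₁ C (ω r) (S j)).val.length : ℝ)) := by
      intro ω
      have := (Nat.cast_le (α := ℝ)).2 (build_words_le p b₁ C ω S)
      push_cast at this
      simpa only [mul_comm (4 * L + 2)] using this
    refine (coinExp_mono h1).trans (le_of_eq ?_)
    have : Nonempty (Coins n d) := ⟨fun _ => Classical.arbitrary _⟩
    rw [coinExp_add, coinExp_const, coinExp_sum_reps (n := n) fun c => L * (L + 1) +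
      ∑ j, (4 * L + 2) * ((filters p b₁ C c (S j)).val.length : ℝ), coinExp_add, coinExp_const,
      coinExp_sum, cast_reps]
    simp only [coinExp_const_mul]
    rw [← Finset.mul_sum]
    ring
  refine (dataExp_mono hp hS).trans ?_
  rw [dataExp_add, dataExp_const, dataExp_const_mul, dataExp_sum_eval]
  have h1 : vecExp p f ≤ 2 / b₁ * (L * (2 * E)) :=
    (vecExp_length_filters_le hn hb₀ hb₁ hδ hδ' hp hC1).trans (mul_le_mul_of_nonneg_left
      (vecExp_frontCount_le hn hb₀ hb₁ hδ hδ' hp hC0 hC1 hC2 hM hρ hsum) (by positivity))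
  have h2 : 2 * L * (4 * L + 2) * (n * vecExp p f) ≤ 2 * L * (6 * L) *
      (n * (2 / b₁ * (L * (2 * E)))) := by
    refine mul_le_mul (by nlinarith) (mul_le_mul_of_nonneg_left h1 (by linarith)) ?_ (by positivity)
    refine mul_nonneg (by linarith) ?_
    have := vecExp_mono hp (F := fun _ => 0) (G := f) fun x =>
      coinExp_nonneg fun c => Nat.cast_nonneg _
    rwa [vecExp_const] at this
  have h3 : 2 * L * (L * (L + 1)) ≤ 4 * (L ^ 3 * (n * E)) := by
    have h4 : 2 * L * (L * (L + 1)) ≤ 4 * L ^ 3 := by nlinarith [sq_nonneg L]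
    have h5 : 1 ≤ n * E := one_le_mul_of_one_le_of_one_le hn1 hE1
    have h6 := mul_le_mul_of_nonneg_left h5 (by positivity : 0 ≤ 4 * L ^ 3)
    linarith
  have h4 : (d : ℝ) ≤ d * n := le_mul_of_one_le_right (Nat.cast_nonneg _) hn1
  have h5 : 2 * L * (6 * L) * (n * (2 / b₁ * (L * (2 * E)))) = 48 / b₁ * (L ^ 3 * (n * E)) := by
    ring
  rw [add_mul, ← h5]
  linarith

theorem dataExp_steps_le (hn : 2 ≤ n) (hb₀ : 0 < b₁) (hb₁ : b₁ ≤ 1) (hδ : 0 < δ)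
    (hδ' : δ ≤ 1 / 2) (hp : ∀ i, 0 ≤ p i ∧ p i < 1 / 2) (hC0 : 0 < C)
    (hC1 : 6 ≤ C * (b₁ ^ 2 * δ)) (hC2 : 6 * Real.log (1 / b₁) ≤ C * δ ^ 2)
    (hM : C * Real.log n ≤ ∑ i, p i) (hρ : 0 ≤ ρ)
    (hsum : ∑ i, p i ^ (1 + ρ) = b₁ * ∑ i, p i) :
    dataExp p (fun S : Fin n → Vec d => coinExp fun ω : Coins n d =>
      ((build p b₁ C ω S).steps : ℝ)) ≤
    (73 + 32 / b₁) *
      (d * ((depth n : ℝ) ^ 3 * (n * (Real.exp 1 * (n : ℝ) ^ (ρ + 9 * δ))))) := by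
  have hn1 : (1 : ℝ) ≤ n := by exact_mod_cast (by omega : 1 ≤ n)
  have hlog : 0 < Real.log n := Real.log_pos (by exact_mod_cast (by omega : 1 < n))
  have hdN : 1 ≤ d := one_le_dim ((mul_pos hC0 hlog).trans_le hM)
  have hd : (1 : ℝ) ≤ d := by exact_mod_cast hdN
  have hL : (1 : ℝ) ≤ depth n := by exact_mod_cast one_le_depth hn
  set L : ℝ := (depth n : ℝ) with hLdef
  set E : ℝ := Real.exp 1 * (n : ℝ) ^ (ρ + 9 * δ) with hE
  have hE1 : 1 ≤ E := by
    have h1 : (1 : ℝ) ≤ (n : ℝ) ^ (ρ + 9 * δ) := Real.one_le_rpow hn1 (by linarith)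
    have h2 : (1 : ℝ) ≤ Real.exp 1 := Real.one_le_exp zero_le_one
    nlinarith
  have hdL : 1 ≤ d * L := one_le_mul_of_one_le_of_one_le hd hL
  set f : Vec d → ℝ := fun x => coinExp fun c : Coeffs n d =>
    ((filters p b₁ C c x).val.length : ℝ) with hf
  set g : Vec d → ℝ := fun x => coinExp fun c : Coeffs n d => (frontCount p b₁ C c x : ℝ) with hg
  have hS : ∀ S : Fin n → Vec d, coinExp (fun ω : Coins n d =>
      ((build p b₁ C ω S).steps : ℝ)) ≤
      (n * d + 2 * L * (L * (L + 1))) +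
        2 * L * ∑ j, (d * L * 4 + (d * L * 15 * g (S j) + d * L * 4 * f (S j))) := by
    intro S
    have h1 : ∀ ω : Coins n d, ((build p b₁ C ω S).steps : ℝ) ≤ (n * d : ℝ) +
        ∑ r, (L * (L + 1) + ∑ j, (d * L * 4 + (d * L * 15 * (frontCount p b₁ C (ω r) (S j) : ℝ) +
          d * L * 4 * ((filters p b₁ C (ω r) (S j)).val.length : ℝ)))) := by
      intro ω
      have := (Nat.cast_le (α := ℝ)).2 (build_steps_le p b₁ C ω S)
      push_cast at this
      refine this.trans (add_le_add_right (Finset.sum_le_sum fun r _ => add_le_add_right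
        (Finset.sum_le_sum fun j _ => ?_) _) _)
      have h2 := (Nat.cast_le (α := ℝ)).2 (filters_steps_le p b₁ C (ω r) (S j) hn hdN)
      push_cast at h2
      have h3 : (1 : ℝ) + (d + L * (d + 1)) ≤ d * L * 4 := by nlinarith
      have h4 := mul_le_mul_of_nonneg_left h3
        (Nat.cast_nonneg (filters p b₁ C (ω r) (S j)).val.length)
      linarith
    refine (coinExp_mono h1).trans (le_of_eq ?_)
    have : Nonempty (Coins n d) := ⟨fun _ => Classical.arbitrary _⟩
    rw [coinExp_add, coinExp_const, coinExp_sum_reps (n := n) fun c => L * (L + 1) +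
      ∑ j, (d * L * 4 + (d * L * 15 * (frontCount p b₁ C c (S j) : ℝ) +
          d * L * 4 * ((filters p b₁ C c (S j)).val.length : ℝ))), coinExp_add, coinExp_const,
      coinExp_sum, cast_reps]
    simp only [coinExp_add, coinExp_const_mul, coinExp_const]
    ring
  refine (dataExp_mono hp hS).trans ?_
  rw [dataExp_add, dataExp_const, dataExp_const_mul, dataExp_sum_eval fun x =>
    d * L * 4 + (d * L * 15 * g x + d * L * 4 * f x), vecExp_add, vecExp_const, vecExp_add,
    vecExp_const_mul, vecExp_const_mul]
  have h0 : vecExp p g ≤ L * (2 * E) :=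
    vecExp_frontCount_le hn hb₀ hb₁ hδ hδ' hp hC0 hC1 hC2 hM hρ hsum
  have h1 : vecExp p f ≤ 2 / b₁ * (L * (2 * E)) :=
    (vecExp_length_filters_le hn hb₀ hb₁ hδ hδ' hp hC1).trans
      (mul_le_mul_of_nonneg_left h0 (by positivity))
  have hLE : 1 ≤ L * E := one_le_mul_of_one_le_of_one_le hL hE1
  have h2 : d * L * 4 + (d * L * 15 * vecExp p g + d * L * 4 * vecExp p f) ≤
      d * L * (L * E) * (34 + 16 / b₁) := by
    have e1 : d * L * 15 * vecExp p g ≤ d * L * 15 * (L * (2 * E)) :=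
      mul_le_mul_of_nonneg_left h0 (by positivity)
    have e2 : d * L * 4 * vecExp p f ≤ d * L * 4 * (2 / b₁ * (L * (2 * E))) :=
      mul_le_mul_of_nonneg_left h1 (by positivity)
    have e3 : d * L * 4 * 1 ≤ d * L * 4 * (L * E) :=
      mul_le_mul_of_nonneg_left hLE (by positivity)
    calc _ ≤ d * L * 4 * (L * E) + (d * L * 15 * (L * (2 * E)) +
          d * L * 4 * (2 / b₁ * (L * (2 * E)))) := by linarith
      _ = _ := by ring
  have h3 : 2 * L * (n * (d * L * 4 + (d * L * 15 * vecExp p g + d * L * 4 * vecExp p f))) ≤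
      2 * L * (n * (d * L * (L * E) * (34 + 16 / b₁))) :=
    mul_le_mul_of_nonneg_left (mul_le_mul_of_nonneg_left h2 (by linarith)) (by positivity)
  have hL3 : 1 ≤ L ^ 3 := one_le_pow₀ hL
  have h4 : 2 * L * (L * (L + 1)) ≤ 4 * (d * (L ^ 3 * (n * E))) := by
    have e1 : 2 * L * (L * (L + 1)) ≤ 4 * L ^ 3 := by nlinarith [sq_nonneg L]
    have e2 : 1 ≤ d * (n * E) := one_le_mul_of_one_le_of_one_le hd
      (one_le_mul_of_one_le_of_one_le hn1 hE1)
    have e3 := mul_le_mul_of_nonneg_left e2 (by positivity : 0 ≤ 4 * L ^ 3)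
    linarith
  have h5 : (n * d : ℝ) ≤ d * (L ^ 3 * (n * E)) := by
    have e1 : 1 ≤ L ^ 3 * E := one_le_mul_of_one_le_of_one_le hL3 hE1
    have e2 := mul_le_mul_of_nonneg_left e1 (by positivity : (0 : ℝ) ≤ n * d)
    linarith
  calc _ ≤ d * (L ^ 3 * (n * E)) + 4 * (d * (L ^ 3 * (n * E))) +
        2 * L * (n * (d * L * (L * E) * (34 + 16 / b₁))) := by linarith
    _ = _ := by ring

end Build

/-! ### Expected time of a search -/

section Search

variable {n d : ℕ} {p : Fin d → ℝ} {b₁ δ C ρ a : ℝ}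

open Classical in
/-- A sum over all finished paths, independent of any query, which bounds the contribution to a
search of those paths that are contained in unusually many data vectors. -/
noncomputable def heavyMoment (p : Fin d → ℝ) (b₁ a : ℝ) (S : Fin n → Vec d) : ℝ :=
  ∑ l ∈ Finset.range (depth n), (4 / (b₁ ^ 2 * ∑ i, p i)) ^ (l + 1) * pathSum (l + 1) fun v =>
    if v.Nodup ∧ Finished n p v then (cover S v : ℝ) * a ^ cover S v else 0

theorem dataExp_heavyMoment_le (hp : ∀ i, 0 ≤ p i ∧ p i < 1 / 2) (hM : 0 < ∑ i, p i)
    (hb₀ : 0 < b₁) (hb₁ : b₁ ≤ 1) (ha : 1 ≤ a) :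
    dataExp p (fun S : Fin n → Vec d => heavyMoment p b₁ a S) ≤
      depth n * ((4 / b₁ ^ 2) ^ depth n * (n * a * Real.exp (a - 1))) := by
  classical
  set M := ∑ i, p i with hMdef
  simp only [heavyMoment]
  rw [dataExp_sum]
  have hterm : ∀ l ∈ Finset.range (depth n), dataExp p (fun S : Fin n → Vec d =>
      (4 / (b₁ ^ 2 * ∑ i, p i)) ^ (l + 1) * pathSum (l + 1) fun v =>
        if v.Nodup ∧ Finished n p v then (cover S v : ℝ) * a ^ cover S v else 0) ≤
      (4 / b₁ ^ 2) ^ depth n * (n * a * Real.exp (a - 1)) := by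
    intro l hl
    rw [dataExp_const_mul, dataExp_pathSum, ← hMdef]
    have h1 : ∀ v : Path d, dataExp p (fun S : Fin n → Vec d =>
        if v.Nodup ∧ Finished n p v then (cover S v : ℝ) * a ^ cover S v else 0) ≤
        n * a * Real.exp (a - 1) * (v.map p).prod := by
      intro v
      by_cases hv : v.Nodup ∧ Finished n p v
      · simp only [if_pos hv]
        exact dataExp_cover_le hp hv.1 ha hv.2
      · simp only [if_neg hv, dataExp_const]
        have := list_prod_map_nonneg hp v
        positivity
    have h2 := pathSum_mono (l := l + 1) fun v _ => h1 v
    rw [pathSum_const_mul, pathSum_prod, ← hMdef] at h2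
    calc _ ≤ (4 / (b₁ ^ 2 * M)) ^ (l + 1) * (n * a * Real.exp (a - 1) * M ^ (l + 1)) :=
          mul_le_mul_of_nonneg_left h2 (by positivity)
      _ = (4 / b₁ ^ 2) ^ (l + 1) * (n * a * Real.exp (a - 1)) := by
          rw [mul_left_comm, ← mul_pow, mul_comm]
          congr 2
          field_simp
      _ ≤ _ := by
          refine mul_le_mul_of_nonneg_right (pow_le_pow_right₀ ?_ (Finset.mem_range.1 hl))
            (by positivity)
          rw [le_div_iff₀ (by positivity)]
          nlinarith
  refine (Finset.sum_le_sum hterm).trans (le_of_eq ?_)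
  simp

/-- The base `16 / b₁ ^ 2` is large enough for the heavy paths to be negligible. -/
theorem dataExp_heavyMoment_le_const (hp : ∀ i, 0 ≤ p i ∧ p i < 1 / 2) (hM : 0 < ∑ i, p i)
    (hb₀ : 0 < b₁) (hb₁ : b₁ ≤ 1) (ha : a = 16 / b₁ ^ 2) :
    (1 / a) ^ depth n * dataExp p (fun S : Fin n → Vec d => heavyMoment p b₁ a S) ≤
      a * Real.exp (a - 1) := by
  have ha1 : 1 ≤ a := by
    rw [ha, le_div_iff₀ (by positivity)]
    nlinarith
  have hn : (n : ℝ) ≤ 2 ^ depth n := by exact_mod_cast Nat.le_pow_clog (by norm_num) n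
  have hL : (depth n : ℝ) ≤ 2 ^ depth n := by exact_mod_cast Nat.lt_two_pow_self.le
  have h1 : (1 / a) ^ depth n * (4 / b₁ ^ 2) ^ depth n = 1 / (2 ^ depth n * 2 ^ depth n) := by
    rw [← mul_pow, ← mul_pow, ← one_div_pow, ha]
    congr 1
    field_simp
    norm_num
  calc _ ≤ (1 / a) ^ depth n *
        (depth n * ((4 / b₁ ^ 2) ^ depth n * (n * a * Real.exp (a - 1)))) :=
        mul_le_mul_of_nonneg_left (dataExp_heavyMoment_le hp hM hb₀ hb₁ ha1) (by positivity)
    _ = (1 / a) ^ depth n * (4 / b₁ ^ 2) ^ depth n * (depth n * n) *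
          (a * Real.exp (a - 1)) := by ring
    _ ≤ 1 / (2 ^ depth n * 2 ^ depth n) * (2 ^ depth n * 2 ^ depth n) *
          (a * Real.exp (a - 1)) := by
        rw [h1]
        refine mul_le_mul_of_nonneg_right (mul_le_mul_of_nonneg_left
          (mul_le_mul hL hn (Nat.cast_nonneg _) (by positivity)) (by positivity)) (by positivity)
    _ = a * Real.exp (a - 1) := by
        rw [div_mul_cancel₀ _ (by positivity), one_mul]

/-- The bound by `heavyMoment` holds for every query whose weight is not much below `b₁ ∑ p_i`, even
if it depends on the data. -/
theorem coinExp_sum_cover_le_heavyMoment (hn : 2 ≤ n) (hb₀ : 0 < b₁) (hb₁ : b₁ ≤ 1) (hδ : 0 < δ)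
    (hδ' : δ ≤ 1 / 2) (hC1 : 6 ≤ C * (b₁ ^ 2 * δ)) (hM : 0 < ∑ i, p i) (ha : 0 ≤ a)
    (S : Fin n → Vec d) {q : Vec d} (hq : ¬ IsLight n b₁ C q)
    (hqM : b₁ * ((1 - δ) * ∑ i, p i) ≤ size q) :
    coinExp (fun c : Coeffs n d =>
      ((filters p b₁ C c q).val.map fun v => (cover S v : ℝ) * a ^ cover S v).sum) ≤
      heavyMoment p b₁ a S := by
  classical
  set M := ∑ i, p i with hMdef
  have hm := not_isLight_imp hb₀ hδ hn hC1 hq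
  have hpos := size_pos_of_le hn hδ hm
  simp only [sum_filters hq, coinExp_sum, heavyMoment]
  refine Finset.sum_le_sum fun l hl => ?_
  have hl' := Finset.mem_range.1 hl
  refine (coinExp_sum_done_le hn p b₁ q (size q) hl' _ fun v => by positivity).trans ?_
  have h1 : pathProb n d b₁ (size q) (l + 1) ≤ (4 / (b₁ ^ 2 * M)) ^ (l + 1) := by
    refine (pathProb_le hn hb₁ hδ hδ' hm (size_le q) hl').trans ?_
    have hs := one_le_slack n hδ.le
    refine pow_le_pow_left₀ (div_nonneg (by linarith) hpos.le) ?_ _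
    rw [div_le_div_iff₀ hpos (by positivity)]
    have h2 : b₁ * (1 / 2 * M) ≤ size q := by
      refine le_trans (mul_le_mul_of_nonneg_left ?_ hb₀.le) hqM
      exact mul_le_mul_of_nonneg_right (by linarith) hM.le
    have h3 := mul_le_mul_of_nonneg_left h2 (by positivity : 0 ≤ 4 * b₁)
    have h4 := mul_le_mul_of_nonneg_right (slack_le_two hn hδ')
      (by positivity : 0 ≤ b₁ ^ 2 * M)
    nlinarith
  refine mul_le_mul h1 (pathSum_mono fun v _ => ?_)
    (pathSum_nonneg fun v => by split_ifs <;> positivity) (by positivity)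
  by_cases h2 : IsPathIn q (l + 1) v ∧ Finished n p v
  · rw [if_pos h2, if_pos ⟨h2.1.2.1, h2.2⟩]
  · rw [if_neg h2]
    split_ifs <;> positivity

theorem coinExp_search_steps_le (hn : 2 ≤ n) (hd : 1 ≤ d) (S : Fin n → Vec d) (q : Vec d) :
    coinExp (fun ω : Coins n d => ((search p b₁ C (build p b₁ C ω S).val q).steps : ℝ)) ≤
    2 * depth n * (d * depth n * 4 +
      (d * depth n * 15 * coinExp (fun c : Coeffs n d => (frontCount p b₁ C c q : ℝ)) +
      (d * depth n * 4 * coinExp (fun c : Coeffs n d =>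
          ((filters p b₁ C c q).val.length : ℝ)) +
        d * 5 * coinExp (fun c : Coeffs n d =>
          ((filters p b₁ C c q).val.map fun v => (cover S v : ℝ)).sum)))) := by
  have hL : (1 : ℝ) ≤ depth n := by exact_mod_cast one_le_depth hn
  have hd1 : (1 : ℝ) ≤ d := by exact_mod_cast hd
  have hdL : (1 : ℝ) ≤ d * depth n := one_le_mul_of_one_le_of_one_le hd1 hL
  have h1 : ∀ ω : Coins n d, ((search p b₁ C (build p b₁ C ω S).val q).steps : ℝ) ≤
      ∑ r, ((d * depth n * 4 : ℝ) + (d * depth n * 15 * (frontCount p b₁ C (ω r) q : ℝ) +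
        (d * depth n * 4 * ((filters p b₁ C (ω r) q).val.length : ℝ) +
        d * 5 * ((filters p b₁ C (ω r) q).val.map fun v => (cover S v : ℝ)).sum))) := by
    intro ω
    have h2 := (Nat.cast_le (α := ℝ)).2 (search_steps_le p b₁ C ω S q)
    rw [Nat.cast_sum] at h2
    refine h2.trans (Finset.sum_le_sum fun r _ => ?_)
    have h3 := (Nat.cast_le (α := ℝ)).2 (filters_steps_le p b₁ C (ω r) q hn hd)
    push_cast at h3
    have h4 : ∀ F : List (Path d), (((F.map fun v =>
        1 + (d + depth n * (d + 1)) + cover S v * (3 * d + 2)).sum : ℕ) : ℝ) ≤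
        d * depth n * 4 * (F.length : ℝ) + d * 5 * (F.map fun v => (cover S v : ℝ)).sum := by
      intro F
      induction F with
      | nil => simp
      | cons v F ih =>
        simp only [List.map_cons, List.sum_cons, List.length_cons]
        push_cast at ih ⊢
        have h5 : (1 : ℝ) + (d + depth n * (d + 1)) ≤ d * depth n * 4 := by nlinarith
        have h6 : (cover S v : ℝ) * (3 * d + 2) ≤ cover S v * (d * 5) :=
          mul_le_mul_of_nonneg_left (by linarith) (Nat.cast_nonneg _)
        linarith
    have h5 := h4 (filters p b₁ C (ω r) q).val
    rw [Nat.cast_add, Nat.cast_add, Nat.cast_one]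
    linarith
  refine (coinExp_mono h1).trans (le_of_eq ?_)
  rw [coinExp_sum_reps (n := n) fun c => (d * depth n * 4 : ℝ) +
    (d * depth n * 15 * (frontCount p b₁ C c q : ℝ) +
      (d * depth n * 4 * ((filters p b₁ C c q).val.length : ℝ) +
      d * 5 * ((filters p b₁ C c q).val.map fun v => (cover S v : ℝ)).sum)), cast_reps]
  simp only [coinExp_add, coinExp_const_mul, coinExp_const]

theorem cover_le (S : Fin n → Vec d) (v : Path d) : cover S v ≤ n :=
  (Finset.card_le_univ _).trans (by simp)

open Classical in
/-- The expected number of data vectors that a query is compared with in one repetition. If all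
data vectors have about the expected weight, then the paths that are contained in at most
`⌈log₂ n⌉` data vectors are charged to the number of paths and all others to `heavyMoment`. -/
theorem coinExp_sum_cover_le (hn : 2 ≤ n) (hb₀ : 0 < b₁) (hb₁ : b₁ ≤ 1) (hδ : 0 < δ)
    (hδ' : δ ≤ 1 / 2) (hC1 : 6 ≤ C * (b₁ ^ 2 * δ))
    (hM : 0 < ∑ i, p i) (ha : 1 ≤ a) (S : Fin n → Vec d) {q : Vec d} {j : Fin n}
    (hj : b₁ ≤ braunBlanquet q (S j)) (hq : ¬ IsLight n b₁ C q) :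
    coinExp (fun c : Coeffs n d =>
      ((filters p b₁ C c q).val.map fun v => (cover S v : ℝ)).sum) ≤
    (depth n + n * ∑ k, if (size (S k) : ℝ) < (1 - δ) * ∑ i, p i then (1 : ℝ) else 0) *
      coinExp (fun c : Coeffs n d => ((filters p b₁ C c q).val.length : ℝ)) +
    (1 / a) ^ depth n * heavyMoment p b₁ a S := by
  set M := ∑ i, p i with hMdef
  have ha0 : 0 < a := by linarith
  have hlen0 : 0 ≤ coinExp (fun c : Coeffs n d => ((filters p b₁ C c q).val.length : ℝ)) :=
    coinExp_nonneg fun c => Nat.cast_nonneg _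
  have hheavy0 : 0 ≤ heavyMoment p b₁ a S :=
    Finset.sum_nonneg fun l _ => mul_nonneg (by positivity)
      (pathSum_nonneg fun v => by split_ifs <;> positivity)
  have hind : ∀ k, (0 : ℝ) ≤ if (size (S k) : ℝ) < (1 - δ) * M then (1 : ℝ) else 0 := fun k => by
    split_ifs <;> norm_num
  have hpow0 : 0 ≤ (1 / a) ^ depth n := by positivity
  by_cases hgood : ∀ k, (1 - δ) * M ≤ size (S k)
  · have hqM : b₁ * ((1 - δ) * M) ≤ size q := by
      have h1 := le_size_inter hj
      have h2 : (size (S j) : ℝ) ≤ (max (size q) (size (S j)) : ℕ) := by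
        exact_mod_cast le_max_right _ _
      have h3 : (size (inter q (S j)) : ℝ) ≤ size q := by
        exact_mod_cast size_inter_le_left q (S j)
      have h4 := mul_le_mul_of_nonneg_left ((hgood j).trans h2) hb₀.le
      linarith
    have h1 := coinExp_sum_cover_le_heavyMoment hn hb₀ hb₁ hδ hδ' hC1 hM ha0.le S hq hqM
    have h2 : ∀ c : Coeffs n d, ((filters p b₁ C c q).val.map fun v => (cover S v : ℝ)).sum ≤
        depth n * ((filters p b₁ C c q).val.length : ℝ) + (1 / a) ^ depth n *
        ((filters p b₁ C c q).val.map fun v => (cover S v : ℝ) * a ^ cover S v).sum := by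
      intro c
      induction (filters p b₁ C c q).val with
      | nil => simp
      | cons v F ih =>
        simp only [List.map_cons, List.sum_cons, List.length_cons]
        push_cast
        have h3 : (cover S v : ℝ) ≤
            depth n + (1 / a) ^ depth n * ((cover S v : ℝ) * a ^ cover S v) := by
          rcases le_total (cover S v) (depth n) with h | h
          · have : (cover S v : ℝ) ≤ depth n := by exact_mod_cast h
            have : 0 ≤ (1 / a) ^ depth n * ((cover S v : ℝ) * a ^ cover S v) := by positivity
            linarith
          · have h4 : a ^ depth n ≤ a ^ cover S v := pow_le_pow_right₀ ha h
            have h5 : (1 / a) ^ depth n * a ^ depth n = 1 := by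
              rw [← mul_pow, one_div_mul_cancel ha0.ne', one_pow]
            have h6 := mul_le_mul_of_nonneg_left h4 hpow0
            rw [h5] at h6
            have h7 := mul_le_mul_of_nonneg_left h6 (Nat.cast_nonneg (α := ℝ) (cover S v))
            have h8 : (0 : ℝ) ≤ depth n := Nat.cast_nonneg _
            linarith
        linarith
    refine (coinExp_mono h2).trans ?_
    rw [coinExp_add, coinExp_const_mul, coinExp_const_mul]
    refine add_le_add (mul_le_mul_of_nonneg_right ?_ hlen0) (mul_le_mul_of_nonneg_left h1 hpow0)
    have : (0 : ℝ) ≤ n * ∑ k, if (size (S k) : ℝ) < (1 - δ) * M then (1 : ℝ) else 0 :=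
      mul_nonneg (Nat.cast_nonneg _) (Finset.sum_nonneg fun k _ => hind k)
    linarith
  · push Not at hgood
    obtain ⟨k, hk⟩ := hgood
    have h1 : (1 : ℝ) ≤ ∑ k, if (size (S k) : ℝ) < (1 - δ) * M then (1 : ℝ) else 0 := by
      refine le_trans (le_of_eq ?_) (Finset.single_le_sum (fun k _ => hind k) (Finset.mem_univ k))
      rw [if_pos hk]
    have h2 : ∀ c : Coeffs n d, ((filters p b₁ C c q).val.map fun v => (cover S v : ℝ)).sum ≤
        n * ((filters p b₁ C c q).val.length : ℝ) := by
      intro c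
      refine (List.sum_le_card_nsmul _ (n : ℝ) ?_).trans (le_of_eq (by simp [mul_comm]))
      simp only [List.mem_map]
      rintro _ ⟨v, -, rfl⟩
      exact_mod_cast cover_le S v
    refine (coinExp_mono h2).trans ?_
    rw [coinExp_const_mul]
    have h3 : (n : ℝ) ≤
        depth n + n * ∑ k, if (size (S k) : ℝ) < (1 - δ) * M then (1 : ℝ) else 0 := by
      have h4 := mul_le_mul_of_nonneg_left h1 (Nat.cast_nonneg (α := ℝ) n)
      have h8 : (0 : ℝ) ≤ depth n := Nat.cast_nonneg _
      linarith
    have h5 := mul_le_mul_of_nonneg_right h3 hlen0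
    have h6 := mul_nonneg hpow0 hheavy0
    linarith

open Classical in
/-- The expected search time for fixed data and a fixed query, with an error term that does not
depend on the query. -/
theorem search_ratio_le (hn : 2 ≤ n) (hb₀ : 0 < b₁) (hb₁ : b₁ ≤ 1) (hδ : 0 < δ)
    (hδ' : δ ≤ 1 / 2) {ε : ℝ} (hε : 6 * δ ≤ ε) (hp : ∀ i, 0 ≤ p i ∧ p i < 1 / 2)
    (hC0 : 0 ≤ C * Real.log n) (hC1 : 6 ≤ C * (b₁ ^ 2 * δ)) (hM : 0 < ∑ i, p i) (ha : 1 ≤ a)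
    (S : Fin n → Vec d) {q : Vec d} (hq : IsQuery b₁ C S q) (hρ : IsExponent p b₁ q ρ) :
    coinExp (fun ω : Coins n d => ((search p b₁ C (build p b₁ C ω S).val q).steps : ℝ)) /
      (d * (n : ℝ) ^ (ρ + ε)) ≤
    27 * Real.exp 1 / δ ^ 3 * (38 + 36 / b₁ +
      20 / b₁ * (n * ∑ k, if (size (S k) : ℝ) < (1 - δ) * ∑ i, p i then (1 : ℝ) else 0) +
      10 * ((1 / a) ^ depth n * heavyMoment p b₁ a S)) := by
  obtain ⟨hq1, j, hj⟩ := hq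
  obtain ⟨hρ0, hρ⟩ := hρ
  have hn0 : (0 : ℝ) < n := by exact_mod_cast (by omega : 0 < n)
  have hn1 : (1 : ℝ) ≤ n := by exact_mod_cast (by omega : 1 ≤ n)
  have hdN : 1 ≤ d := one_le_dim hM
  have hd : (1 : ℝ) ≤ d := by exact_mod_cast hdN
  have hL : (1 : ℝ) ≤ depth n := by exact_mod_cast one_le_depth hn
  have hlight : ¬ IsLight n b₁ C q := by
    rw [IsLight, not_lt]
    exact (mul_le_of_le_one_left hC0 hb₁).trans hq1
  have hm := not_isLight_imp hb₀ hδ hn hC1 hlight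
  have hsum : ∑ i with q i = true, p i ^ ρ ≤ b₁ * size q := by
    rcases hρ with h | h
    · exact h.le
    · rw [h]
      refine mul_le_mul_of_nonneg_left ?_ hb₀.le
      rw [size, ← nsmul_one, ← Finset.sum_const]
      exact Finset.sum_le_sum fun i _ => by linarith [(hp i).2]
  set L : ℝ := (depth n : ℝ) with hLdef
  set E : ℝ := Real.exp 1 * (n : ℝ) ^ (ρ + 3 * δ) with hE
  have hE1 : 1 ≤ E := by
    have h1 : (1 : ℝ) ≤ (n : ℝ) ^ (ρ + 3 * δ) := Real.one_le_rpow hn1 (by linarith)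
    have h2 : (1 : ℝ) ≤ Real.exp 1 := Real.one_le_exp zero_le_one
    nlinarith
  set Φ := coinExp (fun c : Coeffs n d => (frontCount p b₁ C c q : ℝ)) with hΦ
  set f := coinExp (fun c : Coeffs n d => ((filters p b₁ C c q).val.length : ℝ)) with hf
  set g := coinExp (fun c : Coeffs n d =>
      ((filters p b₁ C c q).val.map fun v => (cover S v : ℝ)).sum) with hg
  set T : ℝ := n * ∑ k, if (size (S k) : ℝ) < (1 - δ) * ∑ i, p i then (1 : ℝ) else 0 with hT
  set R : ℝ := (1 / a) ^ depth n * heavyMoment p b₁ a S with hR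
  have ha0 : 0 < a := by linarith
  have hT0 : 0 ≤ T := mul_nonneg hn0.le (Finset.sum_nonneg fun k _ => by split_ifs <;> norm_num)
  have hR0 : 0 ≤ R := mul_nonneg (by positivity) (Finset.sum_nonneg fun l _ =>
    mul_nonneg (by positivity) (pathSum_nonneg fun v => by split_ifs <;> positivity))
  have hΦle : Φ ≤ L * E := by
    simp only [hΦ, frontCount_eq hlight, coinExp_sum]
    refine (Finset.sum_le_sum fun l hl => coinExp_length_front_le hn hb₁ hδ hδ' hm
      (fun i => (hp i).1) hρ0 hsum (Finset.mem_range.1 hl).le).trans (le_of_eq ?_)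
    simp [hLdef, hE]
  have hfle : f ≤ 2 / b₁ * (L * E) :=
    (coinExp_length_filters_le hn hb₀ hb₁ hδ hδ' p q fun _ => hm).trans
      (mul_le_mul_of_nonneg_left hΦle (by positivity))
  have hgle : g ≤ (L + T) * (2 / b₁ * (L * E)) + R :=
    (coinExp_sum_cover_le hn hb₀ hb₁ hδ hδ' hC1 hM ha S hj hlight).trans
      (add_le_add_left (mul_le_mul_of_nonneg_left hfle (by positivity)) _)
  have hsteps := coinExp_search_steps_le (p := p) (b₁ := b₁) (C := C) hn hdN S q
  have hLE : 1 ≤ L * E := one_le_mul_of_one_le_of_one_le hL hE1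
  have hbound : 2 * L * (d * L * 4 + (d * L * 15 * Φ + (d * L * 4 * f + d * 5 * g))) ≤
      d * (L ^ 3 * E) * (38 + 36 / b₁ + 20 / b₁ * T + 10 * R) := by
    have e1 : d * L * 15 * Φ ≤ d * L * 15 * (L * E) :=
      mul_le_mul_of_nonneg_left hΦle (by positivity)
    have e2 : d * L * 4 * f ≤ d * L * 4 * (2 / b₁ * (L * E)) :=
      mul_le_mul_of_nonneg_left hfle (by positivity)
    have e3 : d * 5 * g ≤ d * 5 * ((L + T) * (2 / b₁ * (L * E)) + R) :=
      mul_le_mul_of_nonneg_left hgle (by positivity)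
    have e4 : d * L * 4 * 1 ≤ d * L * 4 * (L * E) :=
      mul_le_mul_of_nonneg_left hLE (by positivity)
    have e5 : d * 5 * (T * (2 / b₁ * (L * E))) ≤ d * 5 * (T * (2 / b₁ * (L * E))) * L :=
      le_mul_of_one_le_right (by positivity) hL
    have e6 : d * 5 * R ≤ d * 5 * R * (L * (L * E)) :=
      le_mul_of_one_le_right (by positivity) (one_le_mul_of_one_le_of_one_le hL hLE)
    calc _ ≤ 2 * L * (d * L * 4 * (L * E) + (d * L * 15 * (L * E) +
          (d * L * 4 * (2 / b₁ * (L * E)) + (d * 5 * (L * (2 / b₁ * (L * E))) +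
            d * 5 * (T * (2 / b₁ * (L * E))) * L + d * 5 * R * (L * (L * E)))))) := by
          refine mul_le_mul_of_nonneg_left ?_ (by positivity)
          linarith
      _ = _ := by ring
  have hpow : L ^ 3 * E ≤ 27 * Real.exp 1 / δ ^ 3 * (n : ℝ) ^ (ρ + ε) := by
    calc L ^ 3 * E ≤ 27 / δ ^ 3 * (n : ℝ) ^ (3 * δ) * E :=
          mul_le_mul_of_nonneg_right (depth_pow_three_le hn hδ) (by linarith)
      _ = 27 * Real.exp 1 / δ ^ 3 * (n : ℝ) ^ (ρ + 6 * δ) := by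
          have h1 : (n : ℝ) ^ (ρ + 6 * δ) = (n : ℝ) ^ (3 * δ) * (n : ℝ) ^ (ρ + 3 * δ) := by
            rw [← Real.rpow_add hn0]
            congr 1
            ring
          rw [hE, h1]
          generalize (n : ℝ) ^ (3 * δ) = A
          generalize (n : ℝ) ^ (ρ + 3 * δ) = B
          ring
      _ ≤ _ := by
          refine mul_le_mul_of_nonneg_left ?_ (by positivity)
          exact Real.rpow_le_rpow_of_exponent_le hn1 (by linarith)
  have hden : (0 : ℝ) < d * (n : ℝ) ^ (ρ + ε) := by positivity
  rw [div_le_iff₀ hden]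
  refine (hsteps.trans hbound).trans ?_
  have h0 : 0 ≤ 38 + 36 / b₁ + 20 / b₁ * T + 10 * R := by positivity
  calc d * (L ^ 3 * E) * (38 + 36 / b₁ + 20 / b₁ * T + 10 * R)
      ≤ d * (27 * Real.exp 1 / δ ^ 3 * (n : ℝ) ^ (ρ + ε)) *
        (38 + 36 / b₁ + 20 / b₁ * T + 10 * R) :=
        mul_le_mul_of_nonneg_right (mul_le_mul_of_nonneg_left hpow (by linarith)) h0
    _ = _ := by ring

theorem adversarialRatio_le (hn : 2 ≤ n) (hb₀ : 0 < b₁) (hb₁ : b₁ ≤ 1) (hδ : 0 < δ)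
    (hδ' : δ ≤ 1 / 2) {ε : ℝ} (hε : 6 * δ ≤ ε) (hp : ∀ i, 0 ≤ p i ∧ p i < 1 / 2)
    (hC0 : 0 < C) (hC1 : 6 ≤ C * (b₁ ^ 2 * δ)) (hC3 : 4 ≤ C * δ ^ 2)
    (hM : C * Real.log n ≤ ∑ i, p i) (ha : a = 16 / b₁ ^ 2)
    (Q : (Fin n → Vec d) → Vec d) (ρ : (Fin n → Vec d) → ℝ) :
    adversarialRatio p b₁ C ε Q ρ ≤
      27 * Real.exp 1 / δ ^ 3 * (38 + 56 / b₁ + 10 * (a * Real.exp (a - 1))) := by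
  classical
  have hn0 : (0 : ℝ) < n := by exact_mod_cast (by omega : 0 < n)
  have hlog : 0 < Real.log n := Real.log_pos (by exact_mod_cast (by omega : 1 < n))
  have hM0 : 0 < ∑ i, p i := (mul_pos hC0 hlog).trans_le hM
  have ha1 : 1 ≤ a := by
    rw [ha, le_div_iff₀ (by positivity)]
    nlinarith
  set K₀ : ℝ := 27 * Real.exp 1 / δ ^ 3 with hK₀
  have hK₀0 : 0 ≤ K₀ := by positivity
  have hpt : ∀ S : Fin n → Vec d, (if IsQuery b₁ C S (Q S) ∧ IsExponent p b₁ (Q S) (ρ S) then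
      (coinExp fun ω : Coins n d =>
        ((search p b₁ C (build p b₁ C ω S).val (Q S)).steps : ℝ)) /
        (d * (n : ℝ) ^ (ρ S + ε)) else 0) ≤
      K₀ * ((38 + 36 / b₁) + (20 / b₁ * (n * ∑ k,
        if (size (S k) : ℝ) < (1 - δ) * ∑ i, p i then (1 : ℝ) else 0) +
        10 * ((1 / a) ^ depth n * heavyMoment p b₁ a S))) := by
    intro S
    split_ifs with h
    · refine (search_ratio_le hn hb₀ hb₁ hδ hδ' hε hp (mul_pos hC0 hlog).le hC1 hM0 ha1 S h.1
        h.2).trans (le_of_eq ?_)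
      rw [hK₀]
      ring
    · have h1 : (0 : ℝ) ≤ ∑ k, if (size (S k) : ℝ) < (1 - δ) * ∑ i, p i then (1 : ℝ) else 0 :=
        Finset.sum_nonneg fun k _ => by split_ifs <;> norm_num
      have h2 : 0 ≤ heavyMoment p b₁ a S := Finset.sum_nonneg fun l _ =>
        mul_nonneg (by positivity) (pathSum_nonneg fun v => by split_ifs <;> positivity)
      positivity
  have hmono := dataExp_mono hp hpt
  rw [dataExp_const_mul, dataExp_add, dataExp_const, dataExp_add, dataExp_const_mul,
    dataExp_const_mul, dataExp_const_mul, dataExp_const_mul, dataExp_sum_eval fun x : Vec d =>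
      if (size x : ℝ) < (1 - δ) * ∑ i, p i then (1 : ℝ) else 0] at hmono
  have h1 := dataExp_heavyMoment_le_const (n := n) hp hM0 hb₀ hb₁ ha
  have h2 := vecExp_size_lt_le hp hδ.le
  have h3 : (n : ℝ) * (n * vecExp p fun x : Vec d =>
      if (size x : ℝ) < (1 - δ) * ∑ i, p i then (1 : ℝ) else 0) ≤ 1 := by
    calc _ ≤ (n : ℝ) * (n * Real.exp (-(δ ^ 2 / 2 * ∑ i, p i))) :=
          mul_le_mul_of_nonneg_left (mul_le_mul_of_nonneg_left h2 hn0.le) hn0.le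
      _ = Real.exp (Real.log n + (Real.log n + -(δ ^ 2 / 2 * ∑ i, p i))) := by
          rw [Real.exp_add, Real.exp_add, Real.exp_log hn0]
      _ ≤ 1 := by
          rw [Real.exp_le_one_iff]
          have e1 := mul_le_mul_of_nonneg_left hM (by positivity : 0 ≤ δ ^ 2 / 2)
          have e2 := mul_le_mul_of_nonneg_right hC3 hlog.le
          nlinarith
  rw [adversarialRatio]
  refine hmono.trans (mul_le_mul_of_nonneg_left ?_ hK₀0)
  have h4 := mul_le_mul_of_nonneg_left h3 (by positivity : 0 ≤ 20 / b₁)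
  have h5 : 56 / b₁ = 36 / b₁ + 20 / b₁ := by ring
  rw [h5]
  linarith

end Search

end SkewSearch

open SkewSearch in
theorem theorem2 (b₁ : ℝ) (hb₀ : 0 < b₁) (hb₁ : b₁ ≤ 1) (ε : ℝ) (hε : 0 < ε) :
    ∃ C₀ : ℝ, ∀ C : ℝ, C₀ ≤ C → ∃ K : ℝ, 0 < K ∧
      ∀ (n d : ℕ) (p : Fin d → ℝ), 2 ≤ n → (∀ i, 0 ≤ p i ∧ p i < 1 / 2) →
        C * Real.log n ≤ ∑ i, p i →
        -- expected space and expected time for building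
        (∀ ρu : ℝ, ∑ i, p i ^ (1 + ρu) = b₁ * ∑ i, p i →
          dataExp p (fun S : Fin n → Vec d => coinExp fun ω : Coins n d =>
              ((build p b₁ C ω S).val.words : ℝ)) ≤
            K * ((n : ℝ) ^ (1 + ρu + ε) + d * n) ∧
          dataExp p (fun S : Fin n → Vec d => coinExp fun ω : Coins n d =>
              ((build p b₁ C ω S).steps : ℝ)) ≤
            K * (d * (n : ℝ) ^ (1 + ρu + ε))) ∧
        -- expected time of a search, against every adversary
        (∀ (Q : (Fin n → Vec d) → Vec d) (ρ : (Fin n → Vec d) → ℝ),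
          adversarialRatio p b₁ C ε Q ρ ≤ K) ∧
        -- success probability of a search
        (∀ (S : Fin n → Vec d) (q : Vec d), IsQuery b₁ C S q →
          1 / 2 ≤ coinProb fun ω : Coins n d =>
            ∃ j, (search p b₁ C (build p b₁ C ω S).val q).val = some j ∧
              b₁ ≤ braunBlanquet q (S j)) := by
  obtain ⟨δ, hδ, hδ', hδε⟩ : ∃ δ : ℝ, 0 < δ ∧ δ ≤ 1 / 2 ∧ 12 * δ ≤ ε :=
    ⟨min (1 / 2) (ε / 12), lt_min (by norm_num) (by linarith), min_le_left _ _, by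
      linarith [min_le_right (1 / 2 : ℝ) (ε / 12)]⟩
  have hb2 : 0 < b₁ ^ 2 * δ := by positivity
  have hδ2 : 0 < δ ^ 2 := by positivity
  -- The three bounds make `⌈log₂ n⌉` small compared with `b₁ |x|`, and the lower tail of `|x|`
  -- small compared with `b₁ ^ ⌈log₂ n⌉` and with `n ^ (-2)`.
  refine ⟨max (6 / (b₁ ^ 2 * δ)) (max (6 * Real.log (1 / b₁) / δ ^ 2) (4 / δ ^ 2)),
    fun C hC => ?_⟩
  have hC1 : 6 ≤ C * (b₁ ^ 2 * δ) := (div_le_iff₀ hb2).1 ((le_max_left _ _).trans hC)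
  have hC2 : 6 * Real.log (1 / b₁) ≤ C * δ ^ 2 :=
    (div_le_iff₀ hδ2).1 (((le_max_left _ _).trans (le_max_right _ _)).trans hC)
  have hC3 : 4 ≤ C * δ ^ 2 :=
    (div_le_iff₀ hδ2).1 (((le_max_right _ _).trans (le_max_right _ _)).trans hC)
  have hC0 : 0 < C := by
    by_contra h
    push Not at h
    nlinarith
  set a : ℝ := 16 / b₁ ^ 2 with ha
  have ha0 : 0 < a := by positivity
  set K₀ : ℝ := 27 * Real.exp 1 / δ ^ 3 with hK₀
  have hK₀0 : 0 < K₀ := by positivity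
  set K₁ : ℝ := 2 + (4 + 48 / b₁) * K₀ with hK₁
  set K₂ : ℝ := (73 + 32 / b₁) * K₀ with hK₂
  set K₃ : ℝ := K₀ * (38 + 56 / b₁ + 10 * (a * Real.exp (a - 1))) with hK₃
  have hK₁0 : 0 < K₁ := by positivity
  have hK₂0 : 0 < K₂ := by positivity
  have hK₃0 : 0 < K₃ := by positivity
  refine ⟨K₁ + K₂ + K₃, by positivity, fun n d p hn hp hM => ⟨fun ρu hsum => ?_, fun Q ρ => ?_,
    fun S q hq => ?_⟩⟩
  · have hlog : 0 < Real.log n := Real.log_pos (by exact_mod_cast (by omega : 1 < n))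
    have hM0 : 0 < ∑ i, p i := (mul_pos hC0 hlog).trans_le hM
    have hρ := exponent_nonneg hb₁ hp hM0 hsum
    have hpow := depth_pow_mul_le (σ := ρu) hn hδ hδε
    have hX : (0 : ℝ) ≤ (n : ℝ) ^ (1 + ρu + ε) := by positivity
    have hdn : (0 : ℝ) ≤ d * n := by positivity
    constructor
    · refine (dataExp_words_le hn hb₀ hb₁ hδ hδ' hp hC0 hC1 hC2 hM hρ hsum).trans ?_
      have h1 := mul_le_mul_of_nonneg_left hpow (by positivity : 0 ≤ 4 + 48 / b₁)
      have h2 : 2 * (d * n : ℝ) + (4 + 48 / b₁) * (K₀ * (n : ℝ) ^ (1 + ρu + ε)) ≤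
          K₁ * ((n : ℝ) ^ (1 + ρu + ε) + d * n) := by
        have h3 : 0 ≤ (4 + 48 / b₁) * K₀ * (d * n) := by positivity
        rw [hK₁]
        linarith
      have h4 : K₁ * ((n : ℝ) ^ (1 + ρu + ε) + d * n) ≤
          (K₁ + K₂ + K₃) * ((n : ℝ) ^ (1 + ρu + ε) + d * n) :=
        mul_le_mul_of_nonneg_right (by linarith) (by linarith)
      linarith
    · refine (dataExp_steps_le hn hb₀ hb₁ hδ hδ' hp hC0 hC1 hC2 hM hρ hsum).trans ?_
      have hd0 : (0 : ℝ) ≤ d := Nat.cast_nonneg _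
      have h1 := mul_le_mul_of_nonneg_left (mul_le_mul_of_nonneg_left hpow hd0)
        (by positivity : 0 ≤ 73 + 32 / b₁)
      have h2 : K₂ * (d * (n : ℝ) ^ (1 + ρu + ε)) ≤
          (K₁ + K₂ + K₃) * (d * (n : ℝ) ^ (1 + ρu + ε)) :=
        mul_le_mul_of_nonneg_right (by linarith) (mul_nonneg hd0 hX)
      rw [hK₂] at h2
      linarith
  · have h := adversarialRatio_le (ε := ε) hn hb₀ hb₁ hδ hδ' (by linarith) hp hC0 hC1 hC3 hM ha Q ρ
    linarith
  · have hlog : 0 < Real.log n := Real.log_pos (by exact_mod_cast (by omega : 1 < n))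
    refine search_success hb₀ hb₁ hn hp (mul_pos hC0 hlog).le ?_ hq
    have h1 : 3 ≤ b₁ * C := by
      have h2 : b₁ ^ 2 * δ ≤ b₁ * (1 / 2) :=
        mul_le_mul (by nlinarith) hδ' hδ.le hb₀.le
      have h3 := mul_le_mul_of_nonneg_left h2 hC0.le
      linarith
    have h4 := mul_le_mul_of_nonneg_right h1 hlog.le
    linarith [depth_le_log hn]
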